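/- **Setting.** Let $a<b$, $T>0$, and consider the damped wave equation $$u_{tt}=u_{xx}-\gamma(x)u_t+g(x,t),\quad a\le x\le b,\ 0\le t\le T,$$ with $u(x,0)=\varphi(x)$, $u_t(x,0)=\psi(x)$, $u(a,t)=u_a(t)$, $u(b,t)=u_b(t)$, where $\gamma\ge 0$ attains on $[a,b]$ a maximum $\gamma_*$. Let $u$ be a classical solution that is $C^4$ on $[a,b]\times[0,T]$. For an integer $N\ge 2$ put $h=(b-a)/N$ and $x_i=a+ih$, let $k>0$ and $t_n=nk$, and set $$\mathcal M=\begin{pmatrix}0&I\\ h^{-2}A&-\Gamma\end{pmatrix},\qquad F(t)=\begin{pmatrix}0\\ G(t)+h^{-2}B(t)\end{pmatrix},$$ where $A$ is the tridiagonal matrix of order $N-1$ with $-2$ on the diagonal and $1$ next to it, $\Gamma=\mathrm{diag}(\gamma(x_1),\dots,\gamma(x_{N-1}))$, $G(t)=(g(x_i,t))_{i=1}^{N-1}$ and $B(t)=(u_a(t),0,\dots,0,u_b(t))^T$ (the single entry is $u_a(t)+u_b(t)$ if $N=2$). Starting from $V^0=(\varphi(x_1),\dots,\varphi(x_{N-1}),\psi(x_1),\dots,\psi(x_{N-1}))^T$,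 the scheme of the pair $(Q,P)$ is $$Q(k\mathcal M)V^{n+1}=P(k\mathcal M)V^n+\tfrac k2\bigl(P(k\mathcal M)F(t_n)+Q(k\mathcal M)F(t_{n+1})\bigr).$$ FD-(0,1) is the case $Q(\theta)=1$, $P(\theta)=1+\theta$, and FD-(1,1) the case $Q(\theta)=1-\frac\theta2$, $P(\theta)=1+\frac\theta2$. Write $V^n=(v^n,w^n)$ with $v^n,w^n\in\mathbb R^{N-1}$, where $v^n_i$ approximates $u(x_i,t_n)$ and $w^n_i$ approximates $u_t(x_i,t_n)$, and let $\|e\|_h=(h\sum_{i=1}^{N-1}|e_i|^2)^{1/2}$. **Corollary (convergence of FD-(0,1) and FD-(1,1)).** For all $N\ge2$ and $k>0$ each scheme determines the sequence $(V^n)_{n\ge 0}$ uniquely. Moreover: 1. *FD-(0,1).* As $h,k\to0$ subject to the stability conditions $k<2/\gamma_*$ and $\sqrt k/h<\sqrt{\gamma_*}/2$ (which exclude $\gamma_*=0$), $$\max_{t_n\le T}\max_i|v^n_i-u(x_i,t_n)|\to0\quad\text{and}\quad\max_{t_n\le T}\|(w^n_i-u_t(x_i,t_n))_i\|_h\to0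 .$$ 2. *FD-(1,1).* As $h,k\to0$, without any relation between $h$ and $k$, $$\max_{t_n\le T}\|(v^n_i-u(x_i,t_n))_i\|_h\to0 .$$ 3. *FD-(1,1).* Both limits of part 1 hold for FD-(1,1) as $h,k\to0$ without any relation between $h$ and $k$ if $u_a$ and $u_b$ are constant on $[0,T]$ (in particular if they vanish), and for arbitrary $u_a,u_b$ as $h,k\to0$ with $k^4/h^3\to0$ (in particular with $k/h$ bounded). -/

import Mathlib

noncomputable section

/-- The data of the initial-boundary value problem
`u_tt = u_xx - γ(x) u_t + g(x,t)` on `[a,b]`, with `u(x,0) = φ(x)`, `u_t(x,0) = ψ(x)`,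
`u(a,t) = ua(t)`, `u(b,t) = ub(t)`, and damping `γ ≥ 0`. -/
structure DampedWave where
  a : ℝ
  b : ℝ
  a_lt_b : a < b
  γ : ℝ → ℝ
  γ_nonneg : ∀ x ∈ Set.Icc a b, 0 ≤ γ x
  g : ℝ → ℝ → ℝ
  φ : ℝ → ℝ
  ψ : ℝ → ℝ
  ua : ℝ → ℝ
  ub : ℝ → ℝ

namespace DampedWave

/-- `u` is a classical solution on `[a,b] × [0,T]`, four times continuously differentiable up to
the boundary. All derivatives are one-sided at the ends of the intervals. -/
structure IsSolution (p : DampedWave) (T : ℝ) (u : ℝ → ℝ → ℝ) : Prop where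
  smooth : ContDiffOn ℝ 4 (fun z : ℝ × ℝ => u z.1 z.2) (Set.Icc p.a p.b ×ˢ Set.Icc 0 T)
  pde : ∀ x ∈ Set.Icc p.a p.b, ∀ t ∈ Set.Icc 0 T,
    iteratedDerivWithin 2 (fun s => u x s) (Set.Icc 0 T) t =
      iteratedDerivWithin 2 (fun y => u y t) (Set.Icc p.a p.b) x
        - p.γ x * derivWithin (fun s => u x s) (Set.Icc 0 T) t + p.g x t
  initial_position : ∀ x ∈ Set.Icc p.a p.b, u x 0 = p.φ x
  initial_velocity : ∀ x ∈ Set.Icc p.a p.b,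
    derivWithin (fun s => u x s) (Set.Icc 0 T) 0 = p.ψ x
  left_boundary : ∀ t ∈ Set.Icc 0 T, u p.a t = p.ua t
  right_boundary : ∀ t ∈ Set.Icc 0 T, u p.b t = p.ub t

/-- The mesh width `h = (b - a) / N`. -/
def h (p : DampedWave) (N : ℕ) : ℝ := (p.b - p.a) / N

/-- The interior mesh points `x_1, …, x_{N-1}`; the index `i : Fin (N - 1)` stands for
`x_{i+1} = a + (i+1) h`. -/
def node (p : DampedWave) (N : ℕ) (i : Fin (N - 1)) : ℝ := p.a + ((i : ℕ) + 1 : ℝ) * p.h N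

/-- Grid vectors of length `2N - 2`: `Sum.inl i` indexes the approximation of `u` and `Sum.inr i`
that of `u_t` at the `i`-th interior mesh point. -/
abbrev Grid (N : ℕ) : Type := Fin (N - 1) ⊕ Fin (N - 1) → ℝ

/-- The tridiagonal matrix `A` of order `N - 1`, with `-2` on the diagonal and `1` beside it. -/
def laplaceMatrix (N : ℕ) : Matrix (Fin (N - 1)) (Fin (N - 1)) ℝ :=
  Matrix.of fun i j =>
    if i = j then -2 else if (i : ℕ) + 1 = j ∨ (j : ℕ) + 1 = i then 1 else 0

/-- The matrix `M = [[0, I], [A / h², -Γ]]`, with `Γ = diag (γ(x_1), …, γ(x_{N-1}))`. -/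
def M (p : DampedWave) (N : ℕ) :
    Matrix (Fin (N - 1) ⊕ Fin (N - 1)) (Fin (N - 1) ⊕ Fin (N - 1)) ℝ :=
  Matrix.fromBlocks 0 1 ((1 / p.h N ^ 2) • laplaceMatrix N)
    (-Matrix.diagonal fun i => p.γ (p.node N i))

/-- The vector `B(t) = (ua(t), 0, …, 0, ub(t))`. -/
def boundaryVector (p : DampedWave) (N : ℕ) (t : ℝ) (i : Fin (N - 1)) : ℝ :=
  (if (i : ℕ) = 0 then p.ua t else 0) + (if (i : ℕ) + 1 = N - 1 then p.ub t else 0)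

/-- The forcing `F(t) = (0, G(t) + B(t) / h²)`. -/
def F (p : DampedWave) (N : ℕ) (t : ℝ) : Grid N :=
  Sum.elim 0 fun i => p.g (p.node N i) t + 1 / p.h N ^ 2 * p.boundaryVector N t i

/-- The vector of initial values of `u` and `u_t` at the interior mesh points. -/
def initialVector (p : DampedWave) (N : ℕ) : Grid N :=
  Sum.elim (fun i => p.φ (p.node N i)) fun i => p.ψ (p.node N i)

/-- `V` is produced by the scheme with time step `k` that replaces `e^θ` by `P(θ) / Q(θ)` and
integrates the forcing by the trapezoidal rule:
`Q(kM) V^{n+1} = P(kM) V^n + (k/2) (P(kM) F(t_n) + Q(kM) F(t_{n+1}))`, `t_n = n k`. -/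
def IsSchemeSolution (p : DampedWave) (Q P : Polynomial ℝ) (N : ℕ) (k : ℝ)
    (V : ℕ → Grid N) : Prop :=
  V 0 = p.initialVector N ∧
  ∀ n : ℕ,
    (Polynomial.aeval (k • p.M N) Q).mulVec (V (n + 1)) =
      (Polynomial.aeval (k • p.M N) P).mulVec (V n) +
        (k / 2) • ((Polynomial.aeval (k • p.M N) P).mulVec (p.F N (n * k)) +
          (Polynomial.aeval (k • p.M N) Q).mulVec (p.F N ((n + 1) * k)))

/-- The explicit scheme FD-(0,1): `Q(θ) = 1`, `P(θ) = 1 + θ`. -/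
def IsFD01 (p : DampedWave) (N : ℕ) (k : ℝ) (V : ℕ → Grid N) : Prop :=
  p.IsSchemeSolution 1 (1 + Polynomial.X) N k V

/-- The implicit scheme FD-(1,1): `Q(θ) = 1 - θ/2`, `P(θ) = 1 + θ/2`. -/
def IsFD11 (p : DampedWave) (N : ℕ) (k : ℝ) (V : ℕ → Grid N) : Prop :=
  p.IsSchemeSolution (1 - Polynomial.C (1 / 2) * Polynomial.X)
    (1 + Polynomial.C (1 / 2) * Polynomial.X) N k V

/-- The error in `u` at the time level `t_n = n k`. -/
def positionError {N : ℕ} (p : DampedWave) (u : ℝ → ℝ → ℝ) (k : ℝ) (V : ℕ → Grid N) (n : ℕ)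
    (i : Fin (N - 1)) : ℝ :=
  V n (Sum.inl i) - u (p.node N i) (n * k)

/-- The error in `u_t` at the time level `t_n = n k`. -/
def velocityError {N : ℕ} (p : DampedWave) (T : ℝ) (u : ℝ → ℝ → ℝ) (k : ℝ) (V : ℕ → Grid N)
    (n : ℕ) (i : Fin (N - 1)) : ℝ :=
  V n (Sum.inr i) - derivWithin (fun s => u (p.node N i) s) (Set.Icc 0 T) (n * k)

/-- The discrete `L²` norm `(h ∑ |e_i|²)^{1/2}` on the mesh. -/
def discreteL2 {N : ℕ} (p : DampedWave) (e : Fin (N - 1) → ℝ) : ℝ :=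
  √(p.h N * ∑ i, e i ^ 2)

end DampedWave

end

/-! ### One-step stability in an inner product space -/

/-! Let `D` be the difference quotient of a grid function extended by zero (`grad`), so that `A / h²
= -D*D`. With `p` the velocity error and `q = De`, where `e` is the position error, the homogeneous
semi-discrete equation is `p' = -D*q - Γp`, `q' = Dp`. Its right-hand side is dissipative because
the contributions of `D` and `-D*` cancel (`inner_phaseOp_nonpos`). Hence a trapezoidal step never
increases the energy norm, whatever `h` and `k`, and an explicit Euler step multiplies it by at most
`1 + ck` when `k = O(h²)`, which is what the bound on `√k / h` provides. Since `‖De‖` controls `max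
|e|` (`abs_le_gridNorm_grad`), smallness in the energy norm gives the uniform limit for `u` and the
mean-square limit for `u_t`.

The delicate point is consistency, because `F` contains the boundary values divided by `h²`. For
FD-(0,1) the shifted velocity `w + (k/2) F` obeys an explicit Euler scheme. The boundary part of the
shift is `O(k / h²) = O(1)`, but only at the end nodes, so its norm is `O(√h)`
(`Regular.fd01_error_le`).

For FD-(1,1) the position equation contains `(k/2)(F(t_n) - F(t_{n+1}))`. It is written as `σ_n +
σ_{n+1}` and `σ` is moved into the velocity; the exact velocity is replaced by numbers whose
consecutive means reproduce the increments of `u` exactly. The equation for `q` then has no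
residual, which `D` would have amplified. The boundary part of `σ` has norm of order `k² / h^{3/2}`:
this is the origin of `k⁴ / h³ → 0`, and for constant boundary values that part can be taken to be
zero (`Regular.fd11_energy_error_le`).

Without a relation between `h` and `k` the energy argument is run one derivative lower: `e` plays
the role of `p`, and a discrete primitive of the momentum error `w - u_t + γe` the role of `q`
(`gridNorm_le_of_crankNicolson_dual`). The unit load at an end node, divided by `h²`, is written as
`D*D(X + Y)` with `‖Y‖ ≤ √ν` and `‖DX‖ = O(1/√ν)`. The part with `X` enters through `q`, at cost `k²
/ √ν`; the part with `Y` is absorbed into `e`, at cost `√ν / k`. The choice `ν = k³` balances them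
and gives an error `O(√k + h)` (`Regular.fd11_position_error_le`). -/

/-- Pairing the step with `x + y` turns the left side into `‖y‖² - ‖x‖²` and makes the contribution
of `A` nonpositive; what is left is divisible by `‖x‖ + ‖y‖`. -/
theorem norm_le_of_midpoint_step {X : Type*} [NormedAddCommGroup X] [InnerProductSpace ℝ X]
    {A : X → X} (hA : ∀ x, inner ℝ (A x) x ≤ 0) {k : ℝ} (hk : 0 ≤ k) {x y r : X}
    (h : y - x = (k / 2) • A (x + y) + r) : ‖y‖ ≤ ‖x‖ + ‖r‖ := by
  have h1 : ‖y‖ ^ 2 - ‖x‖ ^ 2 = inner ℝ (y - x) (x + y) := by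
    rw [inner_sub_left, inner_add_right, inner_add_right, real_inner_self_eq_norm_sq,
      real_inner_self_eq_norm_sq, real_inner_comm x y]
    ring
  have h2 : inner ℝ (y - x) (x + y) ≤ ‖r‖ * (‖x‖ + ‖y‖) := by
    rw [h, inner_add_left, real_inner_smul_left]
    have h3 := mul_nonneg hk (neg_nonneg.2 (hA (x + y)))
    have h4 := real_inner_le_norm r (x + y)
    have h5 := mul_le_mul_of_nonneg_left (norm_add_le x y) (norm_nonneg r)
    nlinarith
  have hx := norm_nonneg x
  have hy := norm_nonneg y
  have hr := norm_nonneg r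
  by_contra! hlt
  have h6 : 0 < ‖x‖ + ‖y‖ := by linarith
  nlinarith [mul_pos (sub_pos.2 hlt) h6]

/-- In `‖x + kAx‖²` dissipativity disposes of the cross term, and the remaining `k²‖Ax‖²` is at most
`ck‖x‖²`. This is where an explicit method needs `k` to be of the order of `‖A‖⁻²`. -/
theorem norm_le_of_explicit_step {X : Type*} [NormedAddCommGroup X] [InnerProductSpace ℝ X]
    {A : X → X} (hA : ∀ x, inner ℝ (A x) x ≤ 0) {k c : ℝ} (hk : 0 ≤ k) (hc : 0 ≤ c)
    (hAc : ∀ x, k * ‖A x‖ ^ 2 ≤ c * ‖x‖ ^ 2) {x y r : X}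
    (h : y = x + k • A x + r) : ‖y‖ ≤ (1 + c * k) * ‖x‖ + ‖r‖ := by
  have hck := mul_nonneg hc hk
  have h1 : ‖x + k • A x‖ ^ 2 ≤ ((1 + c * k) * ‖x‖) ^ 2 := by
    rw [norm_add_sq_real, norm_smul, real_inner_smul_right, real_inner_comm, Real.norm_eq_abs,
      abs_of_nonneg hk]
    have h3 := mul_nonneg hk (neg_nonneg.2 (hA x))
    have h4 := mul_le_mul_of_nonneg_left (hAc x) hk
    nlinarith [mul_nonneg hck (sq_nonneg ‖x‖), mul_nonneg (mul_nonneg hck hck) (sq_nonneg ‖x‖)]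
  have h2 : ‖x + k • A x‖ ≤ (1 + c * k) * ‖x‖ :=
    le_of_sq_le_sq h1 (by positivity)
  rw [h]
  exact (norm_add_le _ _).trans (by linarith)

theorem le_exp_mul_of_step_le {a : ℕ → ℝ} {c k ρ : ℝ} (hc : 0 ≤ c) (hk : 0 ≤ k) (hρ : 0 ≤ ρ)
    {n : ℕ} (ha0 : 0 ≤ a 0) (ha : ∀ j < n, a (j + 1) ≤ (1 + c * k) * a j + ρ) :
    a n ≤ Real.exp (c * (n * k)) * (a 0 + n * ρ) := by
  have key : ∀ m ≤ n, a m ≤ Real.exp (c * (m * k)) * (a 0 + m * ρ) := by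
    intro m
    induction m with
    | zero => simp
    | succ m ih =>
      intro hm
      have h1 := ih (by omega)
      have h2 := ha m (by omega)
      have hck := mul_nonneg hc hk
      have h3 : (1 + c * k) * Real.exp (c * (m * k)) ≤ Real.exp (c * ((m + 1 : ℕ) * k)) := by
        have : c * ((m + 1 : ℕ) * k) = c * k + c * (m * k) := by push_cast; ring
        rw [this, Real.exp_add]
        gcongr
        linarith [Real.add_one_le_exp (c * k)]
      have h4 : 1 ≤ Real.exp (c * ((m + 1 : ℕ) * k)) := Real.one_le_exp (by positivity)
      have h5 : 0 ≤ a 0 + m * ρ := by positivity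
      calc a (m + 1) ≤ (1 + c * k) * a m + ρ := h2
        _ ≤ (1 + c * k) * (Real.exp (c * (m * k)) * (a 0 + m * ρ)) + ρ := by gcongr
        _ = ((1 + c * k) * Real.exp (c * (m * k))) * (a 0 + m * ρ) + ρ := by ring
        _ ≤ Real.exp (c * ((m + 1 : ℕ) * k)) * (a 0 + m * ρ)
            + Real.exp (c * ((m + 1 : ℕ) * k)) * ρ := by
          gcongr
          nlinarith
        _ = _ := by push_cast; ring
  exact key n le_rfl

theorem le_add_of_step_le {a : ℕ → ℝ} {ρ : ℝ} {n : ℕ} (ha : ∀ j < n, a (j + 1) ≤ a j + ρ) :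
    a n ≤ a 0 + n * ρ := by
  have key : ∀ m ≤ n, a m ≤ a 0 + m * ρ := by
    intro m
    induction m with
    | zero => simp
    | succ m ih =>
      intro hm
      have h1 := ih (by omega)
      have h2 := ha m (by omega)
      push_cast
      linarith
  exact key n le_rfl

/-! ### The weighted Euclidean norm of grid functions -/

noncomputable section

/-- The norm `(h ∑ x_i²)^{1/2}`. -/
def gridNorm {ι : Type*} [Fintype ι] (h : ℝ) (x : ι → ℝ) : ℝ := √(h * ∑ i, x i ^ 2)

theorem gridNorm_eq {ι : Type*} [Fintype ι] {h : ℝ} (hh : 0 ≤ h) (x : ι → ℝ) :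
    gridNorm h x = √h * ‖WithLp.toLp 2 x‖ := by
  rw [gridNorm, Real.sqrt_mul hh, EuclideanSpace.norm_eq]
  simp

theorem gridNorm_nonneg {ι : Type*} [Fintype ι] (h : ℝ) (x : ι → ℝ) : 0 ≤ gridNorm h x :=
  Real.sqrt_nonneg _

theorem gridNorm_add_le {ι : Type*} [Fintype ι] {h : ℝ} (hh : 0 ≤ h) (x y : ι → ℝ) :
    gridNorm h (fun i => x i + y i) ≤ gridNorm h x + gridNorm h y := by
  rw [gridNorm_eq hh, gridNorm_eq hh, gridNorm_eq hh, ← mul_add]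
  exact mul_le_mul_of_nonneg_left (norm_add_le (WithLp.toLp 2 x) (WithLp.toLp 2 y))
    (Real.sqrt_nonneg h)

theorem gridNorm_mul {ι : Type*} [Fintype ι] {h : ℝ} (hh : 0 ≤ h) (c : ℝ) (x : ι → ℝ) :
    gridNorm h (fun i => c * x i) = |c| * gridNorm h x := by
  rw [gridNorm_eq hh, gridNorm_eq hh]
  have : WithLp.toLp 2 (fun i => c * x i) = c • WithLp.toLp 2 x := rfl
  rw [this, norm_smul, Real.norm_eq_abs]
  ring

theorem gridNorm_sub_le {ι : Type*} [Fintype ι] {h : ℝ} (hh : 0 ≤ h) (x y : ι → ℝ) :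
    gridNorm h (fun i => x i - y i) ≤ gridNorm h x + gridNorm h y := by
  rw [gridNorm_eq hh, gridNorm_eq hh, gridNorm_eq hh, ← mul_add]
  exact mul_le_mul_of_nonneg_left (norm_sub_le (WithLp.toLp 2 x) (WithLp.toLp 2 y))
    (Real.sqrt_nonneg h)

theorem gridNorm_mono {ι : Type*} [Fintype ι] {h : ℝ} (hh : 0 ≤ h) {x y : ι → ℝ}
    (hxy : ∀ i, |x i| ≤ |y i|) : gridNorm h x ≤ gridNorm h y := by
  refine Real.sqrt_le_sqrt (mul_le_mul_of_nonneg_left (Finset.sum_le_sum fun i _ => ?_) hh)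
  exact sq_le_sq.2 (hxy i)

theorem gridNorm_le_of_abs_le {ι : Type*} [Fintype ι] {h l c : ℝ} (hh : 0 ≤ h) (hc : 0 ≤ c)
    (hl : h * Fintype.card ι ≤ l) {x : ι → ℝ} (hx : ∀ i, |x i| ≤ c) :
    gridNorm h x ≤ √l * c := by
  have hl0 : 0 ≤ l := le_trans (by positivity) hl
  rw [gridNorm, Real.sqrt_le_left (by positivity), mul_pow, Real.sq_sqrt hl0]
  have : ∑ i, x i ^ 2 ≤ ∑ _i : ι, c ^ 2 :=
    Finset.sum_le_sum fun i _ => sq_le_sq.2 (by rw [abs_of_nonneg hc]; exact hx i)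
  rw [Finset.sum_const, Finset.card_univ, nsmul_eq_mul] at this
  calc h * ∑ i, x i ^ 2 ≤ h * (Fintype.card ι * c ^ 2) := by gcongr
    _ = h * Fintype.card ι * c ^ 2 := by ring
    _ ≤ l * c ^ 2 := by gcongr

theorem gridNorm_sumElim_sq {ι κ : Type*} [Fintype ι] [Fintype κ] {h : ℝ} (hh : 0 ≤ h)
    (x : ι → ℝ) (y : κ → ℝ) :
    gridNorm h (Sum.elim x y) ^ 2 = gridNorm h x ^ 2 + gridNorm h y ^ 2 := by
  simp only [gridNorm]
  rw [Real.sq_sqrt (mul_nonneg hh (Finset.sum_nonneg fun i _ => sq_nonneg _)),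
    Real.sq_sqrt (mul_nonneg hh (Finset.sum_nonneg fun i _ => sq_nonneg _)),
    Real.sq_sqrt (mul_nonneg hh (Finset.sum_nonneg fun i _ => sq_nonneg _)), Fintype.sum_sum_type]
  simp [mul_add]

theorem gridNorm_le_sumElim_left {ι κ : Type*} [Fintype ι] [Fintype κ] {h : ℝ} (hh : 0 ≤ h)
    (x : ι → ℝ) (y : κ → ℝ) : gridNorm h x ≤ gridNorm h (Sum.elim x y) := by
  refine le_of_sq_le_sq ?_ (gridNorm_nonneg _ _)
  rw [gridNorm_sumElim_sq hh]
  nlinarith [sq_nonneg (gridNorm h y)]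

theorem gridNorm_le_sumElim_right {ι κ : Type*} [Fintype ι] [Fintype κ] {h : ℝ} (hh : 0 ≤ h)
    (x : ι → ℝ) (y : κ → ℝ) : gridNorm h y ≤ gridNorm h (Sum.elim x y) := by
  refine le_of_sq_le_sq ?_ (gridNorm_nonneg _ _)
  rw [gridNorm_sumElim_sq hh]
  nlinarith [sq_nonneg (gridNorm h x)]

theorem gridNorm_sumElim_le {ι κ : Type*} [Fintype ι] [Fintype κ] {h : ℝ} (hh : 0 ≤ h)
    (x : ι → ℝ) (y : κ → ℝ) : gridNorm h (Sum.elim x y) ≤ gridNorm h x + gridNorm h y := by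
  have hx := gridNorm_nonneg h x
  have hy := gridNorm_nonneg h y
  refine le_of_sq_le_sq ?_ (add_nonneg hx hy)
  rw [gridNorm_sumElim_sq hh]
  nlinarith

/-! ### Difference operators -/

/-- The value of the grid function `v`, extended by zero, at the right end of an edge. -/
def rightEnd {m : ℕ} (v : Fin m → ℝ) (j : Fin (m + 1)) : ℝ :=
  if hj : (j : ℕ) < m then v ⟨j, hj⟩ else 0

/-- The value of the grid function `v`, extended by zero, at the left end of an edge. -/
def leftEnd {m : ℕ} (v : Fin m → ℝ) (j : Fin (m + 1)) : ℝ :=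
  if hj : 0 < (j : ℕ) then v ⟨j - 1, by omega⟩ else 0

/-- The difference quotients of a grid function, extended by zero, along the `m + 1` edges. -/
def grad {m : ℕ} (h : ℝ) (v : Fin m → ℝ) (j : Fin (m + 1)) : ℝ :=
  (rightEnd v j - leftEnd v j) / h

/-- The adjoint of `grad`. -/
def gradAdj {m : ℕ} (h : ℝ) (q : Fin (m + 1) → ℝ) (i : Fin m) : ℝ :=
  (q i.castSucc - q i.succ) / h

theorem grad_add {m : ℕ} (h : ℝ) (v w : Fin m → ℝ) (j : Fin (m + 1)) :
    grad h (fun i => v i + w i) j = grad h v j + grad h w j := by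
  simp only [grad, rightEnd, leftEnd]
  split_ifs <;> ring

theorem grad_mul {m : ℕ} (h c : ℝ) (v : Fin m → ℝ) (j : Fin (m + 1)) :
    grad h (fun i => c * v i) j = c * grad h v j := by
  simp only [grad, rightEnd, leftEnd]
  split_ifs <;> ring

theorem sum_rightEnd_mul {m : ℕ} (v : Fin m → ℝ) (q : Fin (m + 1) → ℝ) :
    ∑ j, rightEnd v j * q j = ∑ i, v i * q i.castSucc := by
  rw [Fin.sum_univ_castSucc]
  simp [rightEnd]

theorem sum_leftEnd_mul {m : ℕ} (v : Fin m → ℝ) (q : Fin (m + 1) → ℝ) :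
    ∑ j, leftEnd v j * q j = ∑ i, v i * q i.succ := by
  rw [Fin.sum_univ_succ]
  simp [leftEnd]

theorem sum_grad_mul {m : ℕ} (h : ℝ) (v : Fin m → ℝ) (q : Fin (m + 1) → ℝ) :
    ∑ j, grad h v j * q j = ∑ i, v i * gradAdj h q i := by
  have h1 : ∀ j, grad h v j * q j = (rightEnd v j * q j - leftEnd v j * q j) / h := fun j => by
    rw [grad]; ring
  have h2 : ∀ i, v i * gradAdj h q i = (v i * q i.castSucc - v i * q i.succ) / h := fun i => by
    rw [gradAdj]; ring
  simp only [h1, h2]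
  rw [← Finset.sum_div, ← Finset.sum_div, Finset.sum_sub_distrib, Finset.sum_sub_distrib,
    sum_rightEnd_mul, sum_leftEnd_mul]

theorem sum_grad_sq_le {m : ℕ} {h : ℝ} (v : Fin m → ℝ) :
    ∑ j, grad h v j ^ 2 ≤ 4 / h ^ 2 * ∑ i, v i ^ 2 := by
  have hr : ∑ j, rightEnd v j ^ 2 = ∑ i, v i ^ 2 := by
    rw [Fin.sum_univ_castSucc]; simp [rightEnd]
  have hl : ∑ j, leftEnd v j ^ 2 = ∑ i, v i ^ 2 := by
    rw [Fin.sum_univ_succ]; simp [leftEnd]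
  calc ∑ j, grad h v j ^ 2
      ≤ ∑ j, 2 / h ^ 2 * (rightEnd v j ^ 2 + leftEnd v j ^ 2) := by
        refine Finset.sum_le_sum fun j _ => ?_
        rw [grad, div_pow, div_mul_eq_mul_div]
        gcongr
        nlinarith [sq_nonneg (rightEnd v j + leftEnd v j)]
    _ = _ := by rw [← Finset.mul_sum, Finset.sum_add_distrib, hr, hl]; ring

theorem sum_gradAdj_sq_le {m : ℕ} {h : ℝ} (q : Fin (m + 1) → ℝ) :
    ∑ i, gradAdj h q i ^ 2 ≤ 4 / h ^ 2 * ∑ j, q j ^ 2 := by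
  have hr : ∑ i : Fin m, q i.castSucc ^ 2 ≤ ∑ j, q j ^ 2 := by
    rw [Fin.sum_univ_castSucc (fun j => q j ^ 2)]; nlinarith [sq_nonneg (q (Fin.last m))]
  have hl : ∑ i : Fin m, q i.succ ^ 2 ≤ ∑ j, q j ^ 2 := by
    rw [Fin.sum_univ_succ (fun j => q j ^ 2)]; nlinarith [sq_nonneg (q 0)]
  calc ∑ i, gradAdj h q i ^ 2
      ≤ ∑ i : Fin m, 2 / h ^ 2 * (q i.castSucc ^ 2 + q i.succ ^ 2) := by
        refine Finset.sum_le_sum fun j _ => ?_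
        rw [gradAdj, div_pow, div_mul_eq_mul_div]
        gcongr
        nlinarith [sq_nonneg (q j.castSucc + q j.succ)]
    _ = 2 / h ^ 2 * (∑ i : Fin m, q i.castSucc ^ 2 + ∑ i : Fin m, q i.succ ^ 2) := by
        rw [← Finset.mul_sum, Finset.sum_add_distrib]
    _ ≤ 2 / h ^ 2 * (∑ j, q j ^ 2 + ∑ j, q j ^ 2) := by gcongr
    _ = _ := by ring

/-- An inverse estimate. The loss of a factor `h` is affordable only for the explicit scheme, where
`k = O(h²)`. -/
theorem gridNorm_grad_le {m : ℕ} {h : ℝ} (hh : 0 < h) (v : Fin m → ℝ) :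
    gridNorm h (grad h v) ≤ 2 / h * gridNorm h v := by
  have h1 : (2 / h) * gridNorm h v = √((2 / h) ^ 2 * (h * ∑ i, v i ^ 2)) := by
    rw [Real.sqrt_mul (by positivity), Real.sqrt_sq (by positivity), gridNorm]
  rw [h1, gridNorm]
  refine Real.sqrt_le_sqrt ?_
  calc h * ∑ j, grad h v j ^ 2 ≤ h * (4 / h ^ 2 * ∑ i, v i ^ 2) := by
        gcongr; exact sum_grad_sq_le v
    _ = _ := by ring

/-- Discrete Sobolev inequality: `v i` is `h` times the sum of the difference quotients over the
edges to its left, because the extension vanishes at the end, and Cauchy-Schwarz applies. The sum is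
evaluated by duality with the indicator `χ` of those edges, whose adjoint difference is a point mass
at `i`. -/
theorem abs_le_gridNorm_grad {m : ℕ} {h l : ℝ} (hh : 0 < h) (hl : h * (m + 1) ≤ l)
    (v : Fin m → ℝ) (i : Fin m) : |v i| ≤ √l * gridNorm h (grad h v) := by
  let χ : Fin (m + 1) → ℝ := fun j => if j ≤ i.castSucc then 1 else 0
  have h1 : ∑ j, grad h v j * χ j = v i / h := by
    rw [sum_grad_mul, Finset.sum_eq_single i]
    · have h2 : ¬ i.succ ≤ i.castSucc := by simp [Fin.le_def]
      simp only [gradAdj, χ, if_pos le_rfl, if_neg h2]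
      ring
    · intro l _ hl
      have : χ l.castSucc = χ l.succ := by
        have hl' : (l : ℕ) ≠ i := fun h => hl (Fin.ext h)
        simp only [χ, Fin.le_def, Fin.val_castSucc, Fin.val_succ]
        congr 1
        exact propext ⟨fun _ => by omega, fun _ => by omega⟩
      simp [gradAdj, this]
    · simp
  have h3 : (∑ j, grad h v j * χ j) ^ 2 ≤ (∑ j, grad h v j ^ 2) * ∑ j, χ j ^ 2 :=
    Finset.sum_mul_sq_le_sq_mul_sq _ _ _
  have h4 : ∑ j, χ j ^ 2 ≤ (m + 1 : ℝ) := by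
    calc ∑ j, χ j ^ 2 ≤ ∑ _j : Fin (m + 1), (1 : ℝ) := by
          refine Finset.sum_le_sum fun j _ => ?_
          simp only [χ]; split_ifs <;> norm_num
      _ = _ := by simp
  have h5 : 0 ≤ ∑ j, grad h v j ^ 2 := Finset.sum_nonneg fun _ _ => sq_nonneg _
  have hl0 : 0 ≤ l := le_trans (by positivity) hl
  rw [gridNorm, ← Real.sqrt_mul hl0]
  refine Real.le_sqrt_of_sq_le ?_
  rw [sq_abs]
  rw [h1] at h3
  calc v i ^ 2 = h ^ 2 * (v i / h) ^ 2 := by field_simp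
    _ ≤ h ^ 2 * ((∑ j, grad h v j ^ 2) * (m + 1)) := by
      gcongr; exact h3.trans (by gcongr)
    _ = (h * (m + 1)) * (h * ∑ j, grad h v j ^ 2) := by ring
    _ ≤ _ := by gcongr

/-! ### The damped wave system in phase space -/

/-- The right-hand side of `p' = -D*q - Γp`, `q' = Dp`. -/
def phaseOp {m : ℕ} (h : ℝ) (γ : Fin m → ℝ) (x : EuclideanSpace ℝ (Fin m ⊕ Fin (m + 1))) :
    EuclideanSpace ℝ (Fin m ⊕ Fin (m + 1)) :=
  WithLp.toLp 2 (Sum.elim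
    (fun i => -(gradAdj h (fun j => x (Sum.inr j)) i + γ i * x (Sum.inl i)))
    (grad h fun i => x (Sum.inl i)))

/-- Summation by parts cancels the two difference terms and leaves `-∑ γ p²`. -/
theorem inner_phaseOp_nonpos {m : ℕ} (h : ℝ) {γ : Fin m → ℝ} (hγ : ∀ i, 0 ≤ γ i)
    (x : EuclideanSpace ℝ (Fin m ⊕ Fin (m + 1))) : inner ℝ (phaseOp h γ x) x ≤ 0 := by
  rw [PiLp.inner_apply, Fintype.sum_sum_type]
  simp only [phaseOp, Sum.elim_inl, Sum.elim_inr, RCLike.inner_apply, conj_trivial]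
  have h1 := sum_grad_mul h (fun i => x (Sum.inl i)) (fun j => x (Sum.inr j))
  have h2 : ∑ i, x (Sum.inl i) * -(gradAdj h (fun j => x (Sum.inr j)) i + γ i * x (Sum.inl i))
      = -∑ i, x (Sum.inl i) * gradAdj h (fun j => x (Sum.inr j)) i
        - ∑ i, γ i * x (Sum.inl i) ^ 2 := by
    rw [← Finset.sum_neg_distrib, ← Finset.sum_sub_distrib]
    exact Finset.sum_congr rfl fun i _ => by ring
  have h3 : ∑ j, x (Sum.inr j) * grad h (fun i => x (Sum.inl i)) j
      = ∑ j, grad h (fun i => x (Sum.inl i)) j * x (Sum.inr j) :=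
    Finset.sum_congr rfl fun i _ => by ring
  have h4 : 0 ≤ ∑ i, γ i * x (Sum.inl i) ^ 2 :=
    Finset.sum_nonneg fun i _ => mul_nonneg (hγ i) (sq_nonneg _)
  rw [h2, h3, h1]
  linarith

theorem norm_phaseOp_sq_le {m : ℕ} (h : ℝ) {γ : Fin m → ℝ} {Γ : ℝ} (hγ : ∀ i, |γ i| ≤ Γ)
    (x : EuclideanSpace ℝ (Fin m ⊕ Fin (m + 1))) :
    ‖phaseOp h γ x‖ ^ 2 ≤ (8 / h ^ 2 + 2 * Γ ^ 2) * ‖x‖ ^ 2 := by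
  rw [EuclideanSpace.norm_sq_eq, EuclideanSpace.norm_sq_eq, Fintype.sum_sum_type,
    Fintype.sum_sum_type]
  simp only [phaseOp, Sum.elim_inl, Sum.elim_inr, Real.norm_eq_abs, sq_abs]
  have h1 := sum_grad_sq_le (h := h) (fun i => x (Sum.inl i))
  have h2 := sum_gradAdj_sq_le (h := h) (fun j => x (Sum.inr j))
  have h3 : ∑ i, (-(gradAdj h (fun j => x (Sum.inr j)) i + γ i * x (Sum.inl i))) ^ 2
      ≤ 2 * ∑ i, gradAdj h (fun j => x (Sum.inr j)) i ^ 2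
        + 2 * Γ ^ 2 * ∑ i, x (Sum.inl i) ^ 2 := by
    rw [Finset.mul_sum, Finset.mul_sum, ← Finset.sum_add_distrib]
    refine Finset.sum_le_sum fun i _ => ?_
    have h4 : γ i ^ 2 ≤ Γ ^ 2 := sq_le_sq.2 ((hγ i).trans (le_abs_self _))
    have h5 := mul_le_mul_of_nonneg_right h4 (sq_nonneg (x (Sum.inl i)))
    nlinarith [sq_nonneg (gradAdj h (fun j => x (Sum.inr j)) i - γ i * x (Sum.inl i))]
  have h6 : 0 ≤ ∑ i, x (Sum.inl i) ^ 2 := Finset.sum_nonneg fun _ _ => sq_nonneg _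
  have h7 : 0 ≤ ∑ j, x (Sum.inr j) ^ 2 := Finset.sum_nonneg fun _ _ => sq_nonneg _
  have h8 : 4 / h ^ 2 * ∑ i, x (Sum.inl i) ^ 2 ≤ 8 / h ^ 2 * ∑ i, x (Sum.inl i) ^ 2 := by
    gcongr; norm_num
  have h9 := mul_nonneg (sq_nonneg Γ) h7
  have h10 : 2 * (4 / h ^ 2 * ∑ j, x (Sum.inr j) ^ 2) = 8 / h ^ 2 * ∑ j, x (Sum.inr j) ^ 2 := by
    ring
  nlinarith

/-- The two recursions are together one midpoint step for `phaseOp`, so the residuals simply add up.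
No smallness of `k` relative to `h` is involved. -/
theorem gridNorm_le_of_crankNicolson {m : ℕ} {h k ρ : ℝ} (hh : 0 ≤ h) (hk : 0 ≤ k)
    {γ : Fin m → ℝ} (hγ : ∀ i, 0 ≤ γ i) {p r : ℕ → Fin m → ℝ} {q s : ℕ → Fin (m + 1) → ℝ} {n : ℕ}
    (hp : ∀ j < n, ∀ i, p (j + 1) i - p j i =
      -(k / 2) * (gradAdj h (q j) i + gradAdj h (q (j + 1)) i + γ i * (p j i + p (j + 1) i))
        + r j i)
    (hq : ∀ j < n, ∀ l, q (j + 1) l - q j l =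
      k / 2 * (grad h (p j) l + grad h (p (j + 1)) l) + s j l)
    (hρ : ∀ j < n, gridNorm h (r j) + gridNorm h (s j) ≤ ρ) :
    gridNorm h (Sum.elim (p n) (q n)) ≤ gridNorm h (p 0) + gridNorm h (q 0) + n * ρ := by
  have step : ∀ j < n, gridNorm h (Sum.elim (p (j + 1)) (q (j + 1))) ≤
      gridNorm h (Sum.elim (p j) (q j)) + ρ := by
    intro j hj
    have key : WithLp.toLp 2 (Sum.elim (p (j + 1)) (q (j + 1)))
          - WithLp.toLp 2 (Sum.elim (p j) (q j)) = (k / 2) • phaseOp h γ (WithLp.toLp 2 (Sum.elim (p j) (q j))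
          + WithLp.toLp 2 (Sum.elim (p (j + 1)) (q (j + 1))))
          + WithLp.toLp 2 (Sum.elim (r j) (s j)) := by
      ext a
      rcases a with i | l
      · have := hp j hj i
        simp only [PiLp.sub_apply, PiLp.add_apply, PiLp.smul_apply, phaseOp, Sum.elim_inl,
          Sum.elim_inr, smul_eq_mul]
        rw [this]
        simp only [gradAdj]
        ring
      · have := hq j hj l
        simp only [PiLp.sub_apply, PiLp.add_apply, PiLp.smul_apply, phaseOp, Sum.elim_inl,
          Sum.elim_inr, smul_eq_mul]
        rw [this, grad_add]
    have h1 := norm_le_of_midpoint_step (inner_phaseOp_nonpos h hγ) hk key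
    have h2 := mul_le_mul_of_nonneg_left h1 (Real.sqrt_nonneg h)
    rw [mul_add, ← gridNorm_eq hh, ← gridNorm_eq hh, ← gridNorm_eq hh] at h2
    linarith [gridNorm_sumElim_le hh (r j) (s j), hρ j hj]
  exact (le_add_of_step_le (a := fun j => gridNorm h (Sum.elim (p j) (q j))) step).trans
    (by linarith [gridNorm_sumElim_le hh (p 0) (q 0)])

/-- The explicit counterpart; `hc` is the only place where the step sizes are tied together, and it
yields exponential growth with a rate independent of the mesh. -/
theorem gridNorm_le_of_explicitEuler {m : ℕ} {h k ρ Γ c : ℝ} (hh : 0 ≤ h) (hk : 0 ≤ k)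
    {γ : Fin m → ℝ} (hγ : ∀ i, 0 ≤ γ i) (hγΓ : ∀ i, γ i ≤ Γ)
    (hc : k * (8 / h ^ 2 + 2 * Γ ^ 2) ≤ c)
    {p r : ℕ → Fin m → ℝ} {q s : ℕ → Fin (m + 1) → ℝ} {n : ℕ}
    (hp : ∀ j < n, ∀ i, p (j + 1) i = p j i - k * (gradAdj h (q j) i + γ i * p j i) + r j i)
    (hq : ∀ j < n, ∀ l, q (j + 1) l = q j l + k * grad h (p j) l + s j l)
    (hρ0 : 0 ≤ ρ) (hρ : ∀ j < n, gridNorm h (r j) + gridNorm h (s j) ≤ ρ) :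
    gridNorm h (Sum.elim (p n) (q n)) ≤
      Real.exp (c * (n * k)) * (gridNorm h (p 0) + gridNorm h (q 0) + n * ρ) := by
  have hc0 : 0 ≤ c := le_trans (by positivity) hc
  have step : ∀ j < n, gridNorm h (Sum.elim (p (j + 1)) (q (j + 1))) ≤
      (1 + c * k) * gridNorm h (Sum.elim (p j) (q j)) + ρ := by
    intro j hj
    have key : WithLp.toLp 2 (Sum.elim (p (j + 1)) (q (j + 1)))
        = WithLp.toLp 2 (Sum.elim (p j) (q j))
          + k • phaseOp h γ (WithLp.toLp 2 (Sum.elim (p j) (q j)))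
          + WithLp.toLp 2 (Sum.elim (r j) (s j)) := by
      ext a
      rcases a with i | l
      · have := hp j hj i
        simp only [PiLp.add_apply, PiLp.smul_apply, phaseOp, Sum.elim_inl,
          Sum.elim_inr, smul_eq_mul]
        rw [this]
        ring
      · have := hq j hj l
        simp only [PiLp.add_apply, PiLp.smul_apply, phaseOp, Sum.elim_inl,
          Sum.elim_inr, smul_eq_mul]
        rw [this]
    have hA : ∀ x, k * ‖phaseOp h γ x‖ ^ 2 ≤ c * ‖x‖ ^ 2 := fun x => by
      have h1 := norm_phaseOp_sq_le h (Γ := Γ)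
        (fun i => (abs_of_nonneg (hγ i)).le.trans (hγΓ i)) x
      calc k * ‖phaseOp h γ x‖ ^ 2 ≤ k * ((8 / h ^ 2 + 2 * Γ ^ 2) * ‖x‖ ^ 2) := by gcongr
        _ = k * (8 / h ^ 2 + 2 * Γ ^ 2) * ‖x‖ ^ 2 := by ring
        _ ≤ _ := by gcongr
    have h1 := norm_le_of_explicit_step (inner_phaseOp_nonpos h hγ) hk hc0 hA key
    have h2 := mul_le_mul_of_nonneg_left h1 (Real.sqrt_nonneg h)
    rw [mul_add, mul_left_comm, ← gridNorm_eq hh, ← gridNorm_eq hh, ← gridNorm_eq hh] at h2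
    linarith [gridNorm_sumElim_le hh (r j) (s j), hρ j hj]
  refine (le_exp_mul_of_step_le (a := fun j => gridNorm h (Sum.elim (p j) (q j))) hc0 hk hρ0
    (gridNorm_nonneg _ _) step).trans ?_
  gcongr
  exact gridNorm_sumElim_le hh (p 0) (q 0)

end

/-! ### Taylor estimates on an interval -/

theorem abs_sub_le_of_derivWithin_bound {f f' : ℝ → ℝ} {α β B x y : ℝ}
    (hf : ∀ z ∈ Set.Icc α β, HasDerivWithinAt f (f' z) (Set.Icc α β) z)
    (hx : x ∈ Set.Icc α β) (hy : y ∈ Set.Icc α β) (hB : ∀ z ∈ Set.uIcc x y, |f' z| ≤ B) :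
    |f y - f x| ≤ B * |y - x| := by
  have hsub : Set.uIcc x y ⊆ Set.Icc α β := Set.uIcc_subset_Icc hx hy
  exact Convex.norm_image_sub_le_of_norm_hasDerivWithin_le
    (fun z hz => (hf z (hsub hz)).mono hsub) hB (convex_uIcc x y) Set.left_mem_uIcc
    Set.right_mem_uIcc

theorem abs_sub_le_of_mem_uIcc {x y z : ℝ} (hz : z ∈ Set.uIcc x y) : |z - x| ≤ |y - x| :=
  Set.abs_sub_left_of_mem_uIcc hz

/-- The mean value inequality is applied to the remainder itself, whose derivative is a remainder of
one order less. The factorials are given up, since only orders matter below. -/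
theorem abs_taylor_one_le {f f₁ f₂ : ℝ → ℝ} {α β C x y : ℝ}
    (h₁ : ∀ z ∈ Set.Icc α β, HasDerivWithinAt f (f₁ z) (Set.Icc α β) z)
    (h₂ : ∀ z ∈ Set.Icc α β, HasDerivWithinAt f₁ (f₂ z) (Set.Icc α β) z)
    (hC : ∀ z ∈ Set.Icc α β, |f₂ z| ≤ C) (hx : x ∈ Set.Icc α β) (hy : y ∈ Set.Icc α β) :
    |f y - f x - (y - x) * f₁ x| ≤ C * |y - x| ^ 2 := by
  have hC0 : 0 ≤ C := (abs_nonneg _).trans (hC x hx)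
  have hsub : Set.uIcc x y ⊆ Set.Icc α β := Set.uIcc_subset_Icc hx hy
  have key := abs_sub_le_of_derivWithin_bound (f := fun z => f z - (z - x) * f₁ x)
    (f' := fun z => f₁ z - f₁ x) (B := C * |y - x|) (x := x) (y := y)
    (fun z hz => by
      exact ((h₁ z hz).sub (((hasDerivWithinAt_id z _).sub_const x).mul_const (f₁ x))).congr_deriv
        (by ring))
    hx hy (fun z hz => by
      have h3 := abs_sub_le_of_derivWithin_bound h₂ hx (hsub hz)
        (fun w hw => hC w (Set.uIcc_subset_Icc hx (hsub hz) hw))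
      exact h3.trans (mul_le_mul_of_nonneg_left (abs_sub_le_of_mem_uIcc hz) hC0))
  calc |f y - f x - (y - x) * f₁ x| = |f y - (y - x) * f₁ x - (f x - (x - x) * f₁ x)| := by
        congr 1; ring
    _ ≤ C * |y - x| * |y - x| := key
    _ = _ := by ring

theorem abs_taylor_two_le {f f₁ f₂ f₃ : ℝ → ℝ} {α β C x y : ℝ}
    (h₁ : ∀ z ∈ Set.Icc α β, HasDerivWithinAt f (f₁ z) (Set.Icc α β) z)
    (h₂ : ∀ z ∈ Set.Icc α β, HasDerivWithinAt f₁ (f₂ z) (Set.Icc α β) z)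
    (h₃ : ∀ z ∈ Set.Icc α β, HasDerivWithinAt f₂ (f₃ z) (Set.Icc α β) z)
    (hC : ∀ z ∈ Set.Icc α β, |f₃ z| ≤ C) (hx : x ∈ Set.Icc α β) (hy : y ∈ Set.Icc α β) :
    |f y - f x - (y - x) * f₁ x - (y - x) ^ 2 / 2 * f₂ x| ≤ C * |y - x| ^ 3 := by
  have hC0 : 0 ≤ C := (abs_nonneg _).trans (hC x hx)
  have hsub : Set.uIcc x y ⊆ Set.Icc α β := Set.uIcc_subset_Icc hx hy
  have key := abs_sub_le_of_derivWithin_bound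
    (f := fun z => f z - (z - x) * f₁ x - (z - x) ^ 2 / 2 * f₂ x)
    (f' := fun z => f₁ z - f₁ x - (z - x) * f₂ x) (B := C * |y - x| ^ 2) (x := x) (y := y)
    (fun z hz => by
      have h := ((h₁ z hz).sub (((hasDerivWithinAt_id z _).sub_const x).mul_const (f₁ x))).sub
        (((((hasDerivWithinAt_id z (Set.Icc α β)).sub_const x).pow 2).div_const 2).mul_const (f₂ x))
      exact h.congr_deriv (by simp))
    hx hy (fun z hz => by
      have h4 := abs_taylor_one_le h₂ h₃ hC hx (hsub hz)
      refine h4.trans (mul_le_mul_of_nonneg_left ?_ hC0)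
      exact pow_le_pow_left₀ (abs_nonneg _) (abs_sub_le_of_mem_uIcc hz) 2)
  calc |f y - f x - (y - x) * f₁ x - (y - x) ^ 2 / 2 * f₂ x|
      = |f y - (y - x) * f₁ x - (y - x) ^ 2 / 2 * f₂ x
        - (f x - (x - x) * f₁ x - (x - x) ^ 2 / 2 * f₂ x)| := by congr 1; ring
    _ ≤ C * |y - x| ^ 2 * |y - x| := key
    _ = _ := by ring

theorem abs_second_difference_le {f f₁ f₂ f₃ : ℝ → ℝ} {α β C x h : ℝ}
    (h₁ : ∀ z ∈ Set.Icc α β, HasDerivWithinAt f (f₁ z) (Set.Icc α β) z)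
    (h₂ : ∀ z ∈ Set.Icc α β, HasDerivWithinAt f₁ (f₂ z) (Set.Icc α β) z)
    (h₃ : ∀ z ∈ Set.Icc α β, HasDerivWithinAt f₂ (f₃ z) (Set.Icc α β) z)
    (hC : ∀ z ∈ Set.Icc α β, |f₃ z| ≤ C) (hh : 0 ≤ h) (hl : α ≤ x - h) (hr : x + h ≤ β) :
    |f (x + h) - 2 * f x + f (x - h) - h ^ 2 * f₂ x| ≤ 2 * C * h ^ 3 := by
  have hx : x ∈ Set.Icc α β := ⟨by linarith, by linarith⟩
  have e1 := abs_taylor_two_le h₁ h₂ h₃ hC hx (y := x + h) ⟨by linarith, hr⟩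
  have e2 := abs_taylor_two_le h₁ h₂ h₃ hC hx (y := x - h) ⟨hl, by linarith⟩
  have a1 : |x + h - x| = h := by rw [add_sub_cancel_left, abs_of_nonneg hh]
  have a2 : |x - h - x| = h := by rw [show x - h - x = -h by ring, abs_neg, abs_of_nonneg hh]
  rw [a1] at e1
  rw [a2] at e2
  rw [abs_le] at *
  constructor <;> nlinarith [e1.1, e1.2, e2.1, e2.2]

/-- The trapezoidal rule with its first correction term. -/
theorem abs_corrected_trapezoid_le {f f₁ f₂ f₃ f₄ : ℝ → ℝ} {α β C x y : ℝ}
    (h₁ : ∀ z ∈ Set.Icc α β, HasDerivWithinAt f (f₁ z) (Set.Icc α β) z)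
    (h₂ : ∀ z ∈ Set.Icc α β, HasDerivWithinAt f₁ (f₂ z) (Set.Icc α β) z)
    (h₃ : ∀ z ∈ Set.Icc α β, HasDerivWithinAt f₂ (f₃ z) (Set.Icc α β) z)
    (h₄ : ∀ z ∈ Set.Icc α β, HasDerivWithinAt f₃ (f₄ z) (Set.Icc α β) z)
    (hC : ∀ z ∈ Set.Icc α β, |f₄ z| ≤ C) (hx : x ∈ Set.Icc α β) (hy : y ∈ Set.Icc α β) :
    |f y - f x - (y - x) / 2 * (f₁ x + f₁ y) + (y - x) ^ 3 / 24 * (f₃ x + f₃ y)|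
      ≤ C * |y - x| ^ 4 := by
  have hC0 : 0 ≤ C := (abs_nonneg _).trans (hC x hx)
  have hlin : ∀ z, HasDerivWithinAt (fun z => z - x) 1 (Set.Icc α β) z := fun z =>
    (hasDerivWithinAt_id z _).sub_const x
  have hsub : ∀ {y}, y ∈ Set.Icc α β → Set.uIcc x y ⊆ Set.Icc α β := fun hy =>
    Set.uIcc_subset_Icc hx hy
  have e3 : ∀ z ∈ Set.Icc α β, |f₃ z - f₃ x| ≤ C * |z - x| := fun z hz =>
    abs_sub_le_of_derivWithin_bound h₄ hx hz (fun w hw => hC w (hsub hz hw))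
  -- Apart from its `f₄` term, the derivative of the remainder is this expression. Differentiating
  -- it once more leaves only `f₃ x - f₃ z` and `f₄`, so four derivatives suffice.
  have e2 : ∀ z ∈ Set.Icc α β,
      |1 / 2 * (f₁ z - f₁ x) - (z - x) / 2 * f₂ z + (z - x) ^ 2 / 8 * (f₃ x + f₃ z)|
        ≤ C / 2 * |z - x| ^ 3 := by
    intro y hy
    have key := abs_sub_le_of_derivWithin_bound
      (f := fun z => 1 / 2 * (f₁ z - f₁ x) - (z - x) / 2 * f₂ z
        + (z - x) ^ 2 / 8 * (f₃ x + f₃ z))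
      (f' := fun z => (z - x) / 4 * (f₃ x - f₃ z) + (z - x) ^ 2 / 8 * f₄ z)
      (B := C / 2 * |y - x| ^ 2) (x := x) (y := y)
      (fun z hz => by
        have h := ((((h₂ z hz).sub_const (f₁ x)).const_mul (1 / 2)).sub
          (((hlin z).div_const 2).mul (h₃ z hz))).add
          ((((hlin z).pow 2).div_const 8).mul ((h₄ z hz).const_add (f₃ x)))
        exact h.congr_deriv (by simp; ring))
      hx hy (fun z hz => by
        have hzy := abs_sub_le_of_mem_uIcc hz
        have b1 := e3 z (hsub hy hz)
        have b2 := hC z (hsub hy hz)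
        have hz0 := abs_nonneg (z - x)
        have hsq : |z - x| ^ 2 ≤ |y - x| ^ 2 := pow_le_pow_left₀ hz0 hzy 2
        calc |(z - x) / 4 * (f₃ x - f₃ z) + (z - x) ^ 2 / 8 * f₄ z|
            ≤ |(z - x) / 4 * (f₃ x - f₃ z)| + |(z - x) ^ 2 / 8 * f₄ z| := abs_add_le _ _
          _ = |z - x| / 4 * |f₃ z - f₃ x| + |z - x| ^ 2 / 8 * |f₄ z| := by
            rw [abs_mul, abs_mul, abs_div, abs_div, abs_pow, abs_sub_comm (f₃ x)]
            norm_num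
          _ ≤ |z - x| / 4 * (C * |z - x|) + |z - x| ^ 2 / 8 * C := by gcongr
          _ = 3 / 8 * C * |z - x| ^ 2 := by ring
          _ ≤ C / 2 * |y - x| ^ 2 := by
            nlinarith [mul_le_mul_of_nonneg_left hsq hC0, mul_nonneg hC0 (sq_nonneg |y - x|)])
    calc _ = |1 / 2 * (f₁ y - f₁ x) - (y - x) / 2 * f₂ y + (y - x) ^ 2 / 8 * (f₃ x + f₃ y)
            - (1 / 2 * (f₁ x - f₁ x) - (x - x) / 2 * f₂ x + (x - x) ^ 2 / 8 * (f₃ x + f₃ x))| := by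
          congr 1; ring
      _ ≤ C / 2 * |y - x| ^ 2 * |y - x| := key
      _ = _ := by ring
  have key := abs_sub_le_of_derivWithin_bound
    (f := fun z => f z - (z - x) / 2 * (f₁ x + f₁ z) + (z - x) ^ 3 / 24 * (f₃ x + f₃ z))
    (f' := fun z => (1 / 2 * (f₁ z - f₁ x) - (z - x) / 2 * f₂ z
      + (z - x) ^ 2 / 8 * (f₃ x + f₃ z)) + (z - x) ^ 3 / 24 * f₄ z)
    (B := C * |y - x| ^ 3) (x := x) (y := y)
    (fun z hz => by
      have h := ((h₁ z hz).sub (((hlin z).div_const 2).mul ((h₂ z hz).const_add (f₁ x)))).add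
        ((((hlin z).pow 3).div_const 24).mul ((h₄ z hz).const_add (f₃ x)))
      exact h.congr_deriv (by simp; ring))
    hx hy (fun z hz => by
      have hzy := abs_sub_le_of_mem_uIcc hz
      have b1 := e2 z (hsub hy hz)
      have b2 := hC z (hsub hy hz)
      have hz0 := abs_nonneg (z - x)
      have hcu : |z - x| ^ 3 ≤ |y - x| ^ 3 := pow_le_pow_left₀ hz0 hzy 3
      have b3 : |(z - x) ^ 3 / 24 * f₄ z| ≤ |z - x| ^ 3 / 24 * C := by
        rw [abs_mul, abs_div, abs_pow]
        norm_num
        gcongr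
      refine (abs_add_le _ _).trans ((add_le_add b1 b3).trans ?_)
      nlinarith [mul_le_mul_of_nonneg_left hcu hC0, mul_nonneg hC0 (pow_nonneg hz0 3)])
  calc _ = |f y - (y - x) / 2 * (f₁ x + f₁ y) + (y - x) ^ 3 / 24 * (f₃ x + f₃ y)
          - (f x - (x - x) / 2 * (f₁ x + f₁ x) + (x - x) ^ 3 / 24 * (f₃ x + f₃ x))| := by
        congr 1; ring
    _ ≤ C * |y - x| ^ 3 * |y - x| := key
    _ = _ := by ring

/-! ### Partial derivatives on a rectangle -/

/-- The partial derivative is produced as a jointly smooth function on the closed rectangle, so that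
the construction can be iterated and every derivative is bounded by compactness. -/
theorem ContDiffOn.exists_hasDerivWithinAt_snd {f : ℝ × ℝ → ℝ} {a b T : ℝ} {m : ℕ} (hab : a < b)
    (hT : 0 < T) (hf : ContDiffOn ℝ (m + 1 : ℕ) f (Set.Icc a b ×ˢ Set.Icc 0 T)) :
    ∃ f' : ℝ × ℝ → ℝ, ContDiffOn ℝ m f' (Set.Icc a b ×ˢ Set.Icc 0 T) ∧
      ∀ x ∈ Set.Icc a b, ∀ t ∈ Set.Icc 0 T,
        HasDerivWithinAt (fun s => f (x, s)) (f' (x, t)) (Set.Icc 0 T) t := by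
  have hS : UniqueDiffOn ℝ (Set.Icc a b ×ˢ Set.Icc 0 T) :=
    (uniqueDiffOn_Icc hab).prod (uniqueDiffOn_Icc hT)
  refine ⟨fun z => fderivWithin ℝ f (Set.Icc a b ×ˢ Set.Icc 0 T) z (0, 1),
    (hf.fderivWithin hS (by norm_cast)).clm_apply contDiffOn_const, fun x hx t ht => ?_⟩
  have h1 : HasFDerivWithinAt f (fderivWithin ℝ f (Set.Icc a b ×ˢ Set.Icc 0 T) (x, t))
      (Set.Icc a b ×ˢ Set.Icc 0 T) (x, t) :=
    (hf.differentiableOn (by norm_cast) (x, t) ⟨hx, ht⟩).hasFDerivWithinAt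
  have h2 : HasDerivWithinAt (fun s : ℝ => (x, s)) ((0 : ℝ), (1 : ℝ)) (Set.Icc 0 T) t :=
    (hasDerivWithinAt_const t _ x).prodMk (hasDerivWithinAt_id t _)
  exact h1.comp_hasDerivWithinAt t h2 (fun _ hs => Set.mk_mem_prod hx hs)

theorem ContDiffOn.exists_hasDerivWithinAt_fst {f : ℝ × ℝ → ℝ} {a b T : ℝ} {m : ℕ} (hab : a < b)
    (hT : 0 < T) (hf : ContDiffOn ℝ (m + 1 : ℕ) f (Set.Icc a b ×ˢ Set.Icc 0 T)) :
    ∃ f' : ℝ × ℝ → ℝ, ContDiffOn ℝ m f' (Set.Icc a b ×ˢ Set.Icc 0 T) ∧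
      ∀ x ∈ Set.Icc a b, ∀ t ∈ Set.Icc 0 T,
        HasDerivWithinAt (fun y => f (y, t)) (f' (x, t)) (Set.Icc a b) x := by
  have hS : UniqueDiffOn ℝ (Set.Icc a b ×ˢ Set.Icc 0 T) :=
    (uniqueDiffOn_Icc hab).prod (uniqueDiffOn_Icc hT)
  refine ⟨fun z => fderivWithin ℝ f (Set.Icc a b ×ˢ Set.Icc 0 T) z (1, 0),
    (hf.fderivWithin hS (by norm_cast)).clm_apply contDiffOn_const, fun x hx t ht => ?_⟩
  have h1 : HasFDerivWithinAt f (fderivWithin ℝ f (Set.Icc a b ×ˢ Set.Icc 0 T) (x, t))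
      (Set.Icc a b ×ˢ Set.Icc 0 T) (x, t) :=
    (hf.differentiableOn (by norm_cast) (x, t) ⟨hx, ht⟩).hasFDerivWithinAt
  have h2 : HasDerivWithinAt (fun y : ℝ => (y, t)) ((1 : ℝ), (0 : ℝ)) (Set.Icc a b) x :=
    (hasDerivWithinAt_id x _).prodMk (hasDerivWithinAt_const x _ t)
  exact h1.comp_hasDerivWithinAt x h2 (fun _ hs => Set.mk_mem_prod hs ht)

theorem ContDiffOn.exists_abs_le {f : ℝ × ℝ → ℝ} {a b T : ℝ} {m : ℕ}
    (hf : ContDiffOn ℝ m f (Set.Icc a b ×ˢ Set.Icc 0 T)) :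
    ∃ C, ∀ x ∈ Set.Icc a b, ∀ t ∈ Set.Icc 0 T, |f (x, t)| ≤ C := by
  have hK : IsCompact (Set.Icc a b ×ˢ Set.Icc 0 T) := isCompact_Icc.prod isCompact_Icc
  obtain ⟨C, hC⟩ := hK.exists_bound_of_continuousOn hf.continuousOn
  exact ⟨C, fun x hx t ht => hC (x, t) (Set.mk_mem_prod hx ht)⟩

/-! ### Quantitative regularity of a classical solution -/

namespace DampedWave

/-- Bounds by one constant `C` for a solution `u` with time derivatives `u₁, u₂, u₃` and forcing
with time derivative `g₁`: the only properties of the solution that the error analysis uses. -/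
structure Regular (p : DampedWave) (T : ℝ) (u u₁ u₂ u₃ g₁ : ℝ → ℝ → ℝ) (C : ℝ) : Prop where
  nonneg : 0 ≤ C
  derivWithin_eq : ∀ x ∈ Set.Icc p.a p.b, ∀ t ∈ Set.Icc 0 T,
    derivWithin (fun s => u x s) (Set.Icc 0 T) t = u₁ x t
  γ_le : ∀ x ∈ Set.Icc p.a p.b, p.γ x ≤ C
  abs_u_le : ∀ x ∈ Set.Icc p.a p.b, ∀ t ∈ Set.Icc 0 T, |u x t| ≤ C
  abs_u₁_le : ∀ x ∈ Set.Icc p.a p.b, ∀ t ∈ Set.Icc 0 T, |u₁ x t| ≤ C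
  abs_u₃_le : ∀ x ∈ Set.Icc p.a p.b, ∀ t ∈ Set.Icc 0 T, |u₃ x t| ≤ C
  abs_g_le : ∀ x ∈ Set.Icc p.a p.b, ∀ t ∈ Set.Icc 0 T, |p.g x t| ≤ C
  abs_g₁_le : ∀ x ∈ Set.Icc p.a p.b, ∀ t ∈ Set.Icc 0 T, |g₁ x t| ≤ C
  lipschitz_u : ∀ x ∈ Set.Icc p.a p.b, ∀ s ∈ Set.Icc 0 T, ∀ t ∈ Set.Icc 0 T,
    |u x t - u x s| ≤ C * |t - s|
  lipschitz_u₁ : ∀ x ∈ Set.Icc p.a p.b, ∀ s ∈ Set.Icc 0 T, ∀ t ∈ Set.Icc 0 T,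
    |u₁ x t - u₁ x s| ≤ C * |t - s|
  lipschitz_u₂ : ∀ x ∈ Set.Icc p.a p.b, ∀ s ∈ Set.Icc 0 T, ∀ t ∈ Set.Icc 0 T,
    |u₂ x t - u₂ x s| ≤ C * |t - s|
  lipschitz_g : ∀ x ∈ Set.Icc p.a p.b, ∀ s ∈ Set.Icc 0 T, ∀ t ∈ Set.Icc 0 T,
    |p.g x t - p.g x s| ≤ C * |t - s|
  lipschitz_g₁ : ∀ x ∈ Set.Icc p.a p.b, ∀ s ∈ Set.Icc 0 T, ∀ t ∈ Set.Icc 0 T,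
    |g₁ x t - g₁ x s| ≤ C * |t - s|
  taylor_u : ∀ x ∈ Set.Icc p.a p.b, ∀ s ∈ Set.Icc 0 T, ∀ t ∈ Set.Icc 0 T,
    |u x t - u x s - (t - s) * u₁ x s| ≤ C * |t - s| ^ 2
  taylor_u₁ : ∀ x ∈ Set.Icc p.a p.b, ∀ s ∈ Set.Icc 0 T, ∀ t ∈ Set.Icc 0 T,
    |u₁ x t - u₁ x s - (t - s) * u₂ x s| ≤ C * |t - s| ^ 2
  taylor_g : ∀ x ∈ Set.Icc p.a p.b, ∀ s ∈ Set.Icc 0 T, ∀ t ∈ Set.Icc 0 T,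
    |p.g x t - p.g x s - (t - s) * g₁ x s| ≤ C * |t - s| ^ 2
  trapezoid : ∀ x ∈ Set.Icc p.a p.b, ∀ s ∈ Set.Icc 0 T, ∀ t ∈ Set.Icc 0 T,
    |u x t - u x s - (t - s) / 2 * (u₁ x s + u₁ x t) + (t - s) ^ 3 / 24 * (u₃ x s + u₃ x t)|
      ≤ C * |t - s| ^ 4
  second_difference : ∀ t ∈ Set.Icc 0 T, ∀ x h, 0 ≤ h → p.a ≤ x - h → x + h ≤ p.b →
    |u (x + h) t - 2 * u x t + u (x - h) t - h ^ 2 * (u₂ x t + p.γ x * u₁ x t - p.g x t)|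
      ≤ C * h ^ 3

theorem IsSolution.exists_regular {p : DampedWave} {γs : ℝ}
    (hγs : IsGreatest (p.γ '' Set.Icc p.a p.b) γs) {T : ℝ} (hT : 0 < T) {u : ℝ → ℝ → ℝ}
    (hu : p.IsSolution T u) : ∃ u₁ u₂ u₃ g₁ C, p.Regular T u u₁ u₂ u₃ g₁ C := by
  have hab := p.a_lt_b
  have f0 : ContDiffOn ℝ (4 : ℕ) (fun z : ℝ × ℝ => u z.1 z.2) (Set.Icc p.a p.b ×ˢ Set.Icc 0 T) := by
    exact_mod_cast hu.smooth
  obtain ⟨f1, c1, d1⟩ := ContDiffOn.exists_hasDerivWithinAt_snd (m := 3) hab hT f0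
  obtain ⟨f2, c2, d2⟩ := ContDiffOn.exists_hasDerivWithinAt_snd (m := 2) hab hT c1
  obtain ⟨f3, c3, d3⟩ := ContDiffOn.exists_hasDerivWithinAt_snd (m := 1) hab hT c2
  obtain ⟨f4, c4, d4⟩ := ContDiffOn.exists_hasDerivWithinAt_snd (m := 0) hab hT c3
  obtain ⟨e1, ce1, de1⟩ := ContDiffOn.exists_hasDerivWithinAt_fst (m := 3) hab hT f0
  obtain ⟨e2, ce2, de2⟩ := ContDiffOn.exists_hasDerivWithinAt_fst (m := 2) hab hT ce1
  obtain ⟨e3, ce3, de3⟩ := ContDiffOn.exists_hasDerivWithinAt_fst (m := 1) hab hT ce2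
  obtain ⟨m1, cm1, dm1⟩ := ContDiffOn.exists_hasDerivWithinAt_snd (m := 1) hab hT ce2
  obtain ⟨m2, cm2, dm2⟩ := ContDiffOn.exists_hasDerivWithinAt_snd (m := 0) hab hT cm1
  have uT : UniqueDiffOn ℝ (Set.Icc (0 : ℝ) T) := uniqueDiffOn_Icc hT
  have uX : UniqueDiffOn ℝ (Set.Icc p.a p.b) := uniqueDiffOn_Icc hab
  have D1 : ∀ x ∈ Set.Icc p.a p.b, ∀ t ∈ Set.Icc 0 T,
      derivWithin (fun s => u x s) (Set.Icc 0 T) t = f1 (x, t) := fun x hx t ht =>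
    (d1 x hx t ht).derivWithin (uT t ht)
  have D2 : ∀ x ∈ Set.Icc p.a p.b, ∀ t ∈ Set.Icc 0 T,
      iteratedDerivWithin 2 (fun s => u x s) (Set.Icc 0 T) t = f2 (x, t) := fun x hx t ht => by
    rw [iteratedDerivWithin_succ, iteratedDerivWithin_one]
    rw [derivWithin_congr (f := fun s => f1 (x, s)) (D1 x hx) (D1 x hx t ht)]
    exact (d2 x hx t ht).derivWithin (uT t ht)
  have E1 : ∀ x ∈ Set.Icc p.a p.b, ∀ t ∈ Set.Icc 0 T,
      derivWithin (fun y => u y t) (Set.Icc p.a p.b) x = e1 (x, t) := fun x hx t ht =>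
    (de1 x hx t ht).derivWithin (uX x hx)
  have E2 : ∀ x ∈ Set.Icc p.a p.b, ∀ t ∈ Set.Icc 0 T,
      iteratedDerivWithin 2 (fun y => u y t) (Set.Icc p.a p.b) x = e2 (x, t) :=
    fun x hx t ht => by
    rw [iteratedDerivWithin_succ, iteratedDerivWithin_one]
    rw [derivWithin_congr (f := fun y => e1 (y, t)) (fun y hy => E1 y hy t ht) (E1 x hx t ht)]
    exact (de2 x hx t ht).derivWithin (uX x hx)
  -- The equation expresses the forcing through `u`. As `γ` does not depend on `t`, this makes `g`
  -- twice differentiable in time with no smoothness of `γ` or `g` assumed; for the bounds, `γ` only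
  -- has to be bounded.
  have G : ∀ x ∈ Set.Icc p.a p.b, ∀ t ∈ Set.Icc 0 T,
      p.g x t = f2 (x, t) - e2 (x, t) + p.γ x * f1 (x, t) := fun x hx t ht => by
    have := hu.pde x hx t ht
    rw [D2 x hx t ht, E2 x hx t ht, D1 x hx t ht] at this
    linarith
  have dG : ∀ x ∈ Set.Icc p.a p.b, ∀ t ∈ Set.Icc 0 T, HasDerivWithinAt (fun s => p.g x s)
      (f3 (x, t) - m1 (x, t) + p.γ x * f2 (x, t)) (Set.Icc 0 T) t := fun x hx t ht =>
    (((d3 x hx t ht).sub (dm1 x hx t ht)).add ((d2 x hx t ht).const_mul (p.γ x))).congr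
      (fun s hs => G x hx s hs) (G x hx t ht)
  have dG1 : ∀ x ∈ Set.Icc p.a p.b, ∀ t ∈ Set.Icc 0 T,
      HasDerivWithinAt (fun s => f3 (x, s) - m1 (x, s) + p.γ x * f2 (x, s))
      (f4 (x, t) - m2 (x, t) + p.γ x * f3 (x, t)) (Set.Icc 0 T) t := fun x hx t ht =>
    ((d4 x hx t ht).sub (dm2 x hx t ht)).add ((d3 x hx t ht).const_mul (p.γ x))
  obtain ⟨C0, b0⟩ := f0.exists_abs_le
  obtain ⟨C1, b1⟩ := c1.exists_abs_le
  obtain ⟨C2, b2⟩ := c2.exists_abs_le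
  obtain ⟨C3, b3⟩ := c3.exists_abs_le
  obtain ⟨C4, b4⟩ := c4.exists_abs_le
  obtain ⟨C5, b5⟩ := ce2.exists_abs_le
  obtain ⟨C6, b6⟩ := ce3.exists_abs_le
  obtain ⟨C7, b7⟩ := cm1.exists_abs_le
  obtain ⟨C8, b8⟩ := cm2.exists_abs_le
  have ha : p.a ∈ Set.Icc p.a p.b := ⟨le_rfl, hab.le⟩
  have h0 : (0 : ℝ) ∈ Set.Icc 0 T := ⟨le_rfl, hT.le⟩
  have n0 := (abs_nonneg _).trans (b0 _ ha _ h0)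
  have n1 := (abs_nonneg _).trans (b1 _ ha _ h0)
  have n2 := (abs_nonneg _).trans (b2 _ ha _ h0)
  have n3 := (abs_nonneg _).trans (b3 _ ha _ h0)
  have n4 := (abs_nonneg _).trans (b4 _ ha _ h0)
  have n5 := (abs_nonneg _).trans (b5 _ ha _ h0)
  have n6 := (abs_nonneg _).trans (b6 _ ha _ h0)
  have n7 := (abs_nonneg _).trans (b7 _ ha _ h0)
  have n8 := (abs_nonneg _).trans (b8 _ ha _ h0)
  have hγ : ∀ x ∈ Set.Icc p.a p.b, p.γ x ≤ γs := fun x hx => hγs.2 ⟨x, hx, rfl⟩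
  have nγ : 0 ≤ γs := (p.γ_nonneg _ ha).trans (hγ _ ha)
  have q1 := mul_nonneg nγ n1
  have q2 := mul_nonneg nγ n2
  have q3 := mul_nonneg nγ n3
  have comb : ∀ {x y z w A B D : ℝ}, |x| ≤ A → |y| ≤ B → 0 ≤ w → w ≤ γs → |z| ≤ D →
      |x - y + w * z| ≤ A + B + γs * D := by
    intro x y z w A B D hx hy hw hw' hz
    have h1 : |w * z| ≤ γs * D := by
      rw [abs_mul, abs_of_nonneg hw]
      exact mul_le_mul hw' hz (abs_nonneg _) (hw.trans hw')
    exact (abs_add_le _ _).trans (add_le_add ((abs_sub _ _).trans (add_le_add hx hy)) h1)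
  -- One constant above every individual bound: the products with `γs` serve `g` and its time
  -- derivatives, and `2 * C6` is the constant of the second difference.
  set C := C0 + C1 + C2 + C3 + C4 + C5 + 2 * C6 + C7 + C8 + γs + γs * C1 + γs * C2 + γs * C3 with hC
  have lip : ∀ {f f' : ℝ → ℝ}, (∀ t ∈ Set.Icc 0 T, HasDerivWithinAt f (f' t) (Set.Icc 0 T) t) →
      (∀ t ∈ Set.Icc 0 T, |f' t| ≤ C) → ∀ s ∈ Set.Icc 0 T, ∀ t ∈ Set.Icc 0 T,
        |f t - f s| ≤ C * |t - s| := fun hf hb s hs t ht =>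
    abs_sub_le_of_derivWithin_bound hf hs ht (fun z hz => hb z (Set.uIcc_subset_Icc hs ht hz))
  have B1 : ∀ x ∈ Set.Icc p.a p.b, ∀ t ∈ Set.Icc 0 T, |f1 (x, t)| ≤ C :=
    fun x hx t ht => (b1 x hx t ht).trans (by linarith)
  have B2 : ∀ x ∈ Set.Icc p.a p.b, ∀ t ∈ Set.Icc 0 T, |f2 (x, t)| ≤ C :=
    fun x hx t ht => (b2 x hx t ht).trans (by linarith)
  have B3 : ∀ x ∈ Set.Icc p.a p.b, ∀ t ∈ Set.Icc 0 T, |f3 (x, t)| ≤ C :=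
    fun x hx t ht => (b3 x hx t ht).trans (by linarith)
  have B4 : ∀ x ∈ Set.Icc p.a p.b, ∀ t ∈ Set.Icc 0 T, |f4 (x, t)| ≤ C :=
    fun x hx t ht => (b4 x hx t ht).trans (by linarith)
  have BG1 : ∀ x ∈ Set.Icc p.a p.b, ∀ t ∈ Set.Icc 0 T,
      |f3 (x, t) - m1 (x, t) + p.γ x * f2 (x, t)| ≤ C := fun x hx t ht =>
    (comb (b3 x hx t ht) (b7 x hx t ht) (p.γ_nonneg x hx) (hγ x hx) (b2 x hx t ht)).trans
      (by linarith)
  have BG2 : ∀ x ∈ Set.Icc p.a p.b, ∀ t ∈ Set.Icc 0 T,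
      |f4 (x, t) - m2 (x, t) + p.γ x * f3 (x, t)| ≤ C := fun x hx t ht =>
    (comb (b4 x hx t ht) (b8 x hx t ht) (p.γ_nonneg x hx) (hγ x hx) (b3 x hx t ht)).trans
      (by linarith)
  refine ⟨fun x t => f1 (x, t), fun x t => f2 (x, t), fun x t => f3 (x, t),
    fun x t => f3 (x, t) - m1 (x, t) + p.γ x * f2 (x, t), C, ?_⟩
  exact
    { nonneg := by positivity
      derivWithin_eq := D1
      γ_le := fun x hx => (hγ x hx).trans (by linarith)
      abs_u_le := fun x hx t ht => (b0 x hx t ht).trans (by linarith)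
      abs_u₁_le := B1
      abs_u₃_le := B3
      abs_g_le := fun x hx t ht => by
        rw [G x hx t ht]
        exact (comb (b2 x hx t ht) (b5 x hx t ht) (p.γ_nonneg x hx) (hγ x hx)
          (b1 x hx t ht)).trans (by linarith)
      abs_g₁_le := BG1
      lipschitz_u := fun x hx => lip (d1 x hx) (B1 x hx)
      lipschitz_u₁ := fun x hx => lip (d2 x hx) (B2 x hx)
      lipschitz_u₂ := fun x hx => lip (d3 x hx) (B3 x hx)
      lipschitz_g := fun x hx => lip (dG x hx) (BG1 x hx)
      lipschitz_g₁ := fun x hx => lip (dG1 x hx) (BG2 x hx)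
      taylor_u := fun x hx s hs t ht => abs_taylor_one_le (d1 x hx) (d2 x hx) (B2 x hx) hs ht
      taylor_u₁ := fun x hx s hs t ht => abs_taylor_one_le (d2 x hx) (d3 x hx) (B3 x hx) hs ht
      taylor_g := fun x hx s hs t ht => abs_taylor_one_le (dG x hx) (dG1 x hx) (BG2 x hx) hs ht
      trapezoid := fun x hx s hs t ht =>
        abs_corrected_trapezoid_le (d1 x hx) (d2 x hx) (d3 x hx) (d4 x hx) (B4 x hx) hs ht
      second_difference := fun t ht x h hh hl hr => by
        have hx : x ∈ Set.Icc p.a p.b := ⟨by linarith, by linarith⟩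
        have := abs_second_difference_le (fun y hy => de1 y hy t ht) (fun y hy => de2 y hy t ht)
          (fun y hy => de3 y hy t ht) (fun y hy => b6 y hy t ht) hh hl hr
        rw [G x hx t ht]
        have h3 : 2 * C6 * h ^ 3 ≤ C * h ^ 3 := by gcongr; linarith
        refine le_trans (le_of_eq ?_) (this.trans h3)
        congr 1
        simp only
        ring }

end DampedWave

/-! ### The second difference matrix -/

theorem sum_ite_succ_eq {m : ℕ} (v : Fin m → ℝ) (i : Fin m) :
    ∑ j : Fin m, (if (i : ℕ) + 1 = j then v j else 0) = rightEnd v i.succ := by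
  by_cases hi : (i : ℕ) + 1 < m
  · rw [Finset.sum_eq_single ⟨i + 1, hi⟩]
    · simp [rightEnd, hi]
    · intro j _ hj
      exact if_neg fun h => hj (Fin.ext h.symm)
    · simp
  · rw [Finset.sum_eq_zero fun j _ => if_neg (by omega)]
    simp [rightEnd, hi]

theorem sum_ite_eq_succ {m : ℕ} (v : Fin m → ℝ) (i : Fin m) :
    ∑ j : Fin m, (if (j : ℕ) + 1 = i then v j else 0) = leftEnd v i.castSucc := by
  by_cases hi : 0 < (i : ℕ)
  · rw [Finset.sum_eq_single ⟨i - 1, by omega⟩]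
    · simp [leftEnd, hi, Nat.sub_add_cancel hi]
    · intro j _ hj
      exact if_neg fun h => hj (Fin.ext (by simp; omega))
    · simp
  · rw [Finset.sum_eq_zero fun j _ => if_neg (by omega)]
    simp [leftEnd, hi]

theorem gradAdj_grad {m : ℕ} (h : ℝ) (v : Fin m → ℝ) (i : Fin m) :
    gradAdj h (grad h v) i = (2 * v i - leftEnd v i.castSucc - rightEnd v i.succ) / h ^ 2 := by
  have h1 : rightEnd v i.castSucc = v i := by simp [rightEnd]
  have h2 : leftEnd v i.succ = v i := by simp [leftEnd]
  rw [gradAdj, grad, grad, h1, h2]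
  ring

/-- Extension by zero discards the end values `Y 0` and `Y (m + 1)`; they come back as loads at the
adjacent nodes. This is how the vector `B / h²` arises. For `m = 1` both loads fall on the same
node. -/
theorem gradAdj_grad_restrict {m : ℕ} (h : ℝ) (Y : ℕ → ℝ) (i : Fin m) :
    gradAdj h (grad h fun j : Fin m => Y (j + 1)) i =
      -(Y (i + 2) - 2 * Y (i + 1) + Y i) / h ^ 2
        + ((if (i : ℕ) = 0 then Y 0 else 0) + if (i : ℕ) + 1 = m then Y (m + 1) else 0) / h ^ 2 := by
  have h1 : leftEnd (fun j : Fin m => Y (j + 1)) i.castSucc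
      = Y i - if (i : ℕ) = 0 then Y 0 else 0 := by
    by_cases hi : (i : ℕ) = 0
    · simp [leftEnd, hi]
    · simp [leftEnd, hi, Nat.pos_of_ne_zero hi, Nat.sub_add_cancel (Nat.pos_of_ne_zero hi)]
  have h2 : rightEnd (fun j : Fin m => Y (j + 1)) i.succ
      = Y (i + 2) - if (i : ℕ) + 1 = m then Y (m + 1) else 0 := by
    by_cases hi : (i : ℕ) + 1 = m
    · have : Y (i + 2) = Y (m + 1) := congrArg Y (by omega)
      simp [rightEnd, hi, this]
    · have : (i : ℕ) + 1 < m := by omega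
      simp [rightEnd, hi, this]
  rw [gradAdj_grad, h1, h2]
  ring

theorem gradAdj_grad_sub {m : ℕ} (h : ℝ) (v w : Fin m → ℝ) (i : Fin m) :
    gradAdj h (grad h fun j => v j - w j) i
      = gradAdj h (grad h v) i - gradAdj h (grad h w) i := by
  simp only [gradAdj_grad, leftEnd, rightEnd]
  split_ifs <;> ring

theorem grad_restrict {m : ℕ} (h : ℝ) (Y : ℕ → ℝ) (h0 : Y 0 = 0) (hm : Y (m + 1) = 0)
    (j : Fin (m + 1)) : grad h (fun i : Fin m => Y (i + 1)) j = (Y (j + 1) - Y j) / h := by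
  have h1 : leftEnd (fun i : Fin m => Y (i + 1)) j = Y j := by
    by_cases hj : (j : ℕ) = 0
    · simp [leftEnd, hj, h0]
    · simp [leftEnd, Nat.pos_of_ne_zero hj, Nat.sub_add_cancel (Nat.pos_of_ne_zero hj)]
  have h2 : rightEnd (fun i : Fin m => Y (i + 1)) j = Y (j + 1) := by
    by_cases hj : (j : ℕ) < m
    · simp [rightEnd, hj]
    · have : (j : ℕ) = m := by omega
      simp [rightEnd, this, hm]
  rw [grad, h1, h2]

namespace DampedWave

theorem laplaceMatrix_mulVec (N : ℕ) (h : ℝ) (v : Fin (N - 1) → ℝ)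
    (i : Fin (N - 1)) :
    1 / h ^ 2 * (laplaceMatrix N).mulVec v i = -gradAdj h (grad h v) i := by
  have h1 : ∀ j, laplaceMatrix N i j * v j = (if i = j then -2 * v j else 0)
      + (if (i : ℕ) + 1 = j then v j else 0) + (if (j : ℕ) + 1 = i then v j else 0) := by
    intro j
    simp only [laplaceMatrix, Matrix.of_apply]
    by_cases e1 : i = j
    · subst e1; simp
    · by_cases e2 : (i : ℕ) + 1 = j
      · have : ¬ (j : ℕ) + 1 = i := by omega
        simp [e1, e2, this]
      · simp [e1, e2]
  rw [Matrix.mulVec, dotProduct, Finset.sum_congr rfl fun j _ => h1 j,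
    Finset.sum_add_distrib, Finset.sum_add_distrib, sum_ite_succ_eq, sum_ite_eq_succ,
    Finset.sum_ite_eq, if_pos (Finset.mem_univ _), gradAdj_grad]
  ring

/-! ### The mesh -/

theorem h_pos (p : DampedWave) {N : ℕ} (hN : 2 ≤ N) : 0 < p.h N := by
  have := p.a_lt_b
  have : (0 : ℝ) < N := by positivity
  exact div_pos (by linarith) this

theorem h_mul (p : DampedWave) {N : ℕ} (hN : 2 ≤ N) :
    p.h N * ((N - 1 : ℕ) + 1 : ℝ) = p.b - p.a := by
  have h1 : ((N - 1 : ℕ) + 1 : ℝ) = N := by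
    have : N - 1 + 1 = N := by omega
    exact_mod_cast this
  have : (0 : ℝ) < N := by positivity
  rw [h1, h]
  field_simp

theorem gridNorm_le_of_forall_node (p : DampedWave) {N : ℕ} (hN : 2 ≤ N) {c : ℝ} (hc : 0 ≤ c)
    {x : Fin (N - 1) → ℝ} (hx : ∀ i, |x i| ≤ c) :
    gridNorm (p.h N) x ≤ √(p.b - p.a) * c := by
  refine gridNorm_le_of_abs_le (p.h_pos hN).le hc ?_ hx
  rw [← p.h_mul hN, Fintype.card_fin]
  have := p.h_pos hN
  gcongr
  linarith

theorem node_sub_h (p : DampedWave) {N : ℕ} (hN : 2 ≤ N) (i : Fin (N - 1)) :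
    p.a ≤ p.node N i - p.h N := by
  have : 0 ≤ (i : ℕ) * p.h N := mul_nonneg (Nat.cast_nonneg _) (p.h_pos hN).le
  rw [node]
  linarith

theorem node_add_h (p : DampedWave) {N : ℕ} (hN : 2 ≤ N) (i : Fin (N - 1)) :
    p.node N i + p.h N ≤ p.b := by
  have h1 : ((i : ℕ) + 1 : ℝ) ≤ (N - 1 : ℕ) := by exact_mod_cast i.2
  have h2 := mul_le_mul_of_nonneg_left h1 (p.h_pos hN).le
  have h3 := p.h_mul hN
  rw [node]
  linarith

theorem node_mem (p : DampedWave) {N : ℕ} (hN : 2 ≤ N) (i : Fin (N - 1)) :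
    p.node N i ∈ Set.Icc p.a p.b :=
  ⟨by linarith [p.node_sub_h hN i, p.h_pos hN], by linarith [p.node_add_h hN i, p.h_pos hN]⟩

/-- The difference scheme in space, with its boundary terms, is consistent. -/
theorem Regular.abs_discrete_laplacian_le {p : DampedWave} {T : ℝ} {u u₁ u₂ u₃ g₁ : ℝ → ℝ → ℝ}
    {C : ℝ} (hr : p.Regular T u u₁ u₂ u₃ g₁ C) (hu : p.IsSolution T u) {N : ℕ} (hN : 2 ≤ N)
    {t : ℝ} (ht : t ∈ Set.Icc 0 T) (i : Fin (N - 1)) :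
    |-gradAdj (p.h N) (grad (p.h N) fun j => u (p.node N j) t) i
        + 1 / p.h N ^ 2 * p.boundaryVector N t i
        - (u₂ (p.node N i) t + p.γ (p.node N i) * u₁ (p.node N i) t - p.g (p.node N i) t)|
      ≤ C * p.h N := by
  have hh := p.h_pos hN
  have key := hr.second_difference t ht (p.node N i) (p.h N) hh.le (p.node_sub_h hN i)
    (p.node_add_h hN i)
  -- `Y` samples `u` at all mesh points including the two ends, so the loads in this identity are
  -- the boundary values and cancel against `boundaryVector`.
  have h1 := gradAdj_grad_restrict (p.h N) (fun m : ℕ => u (p.a + m * p.h N) t) i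
  have h2 : (fun j : Fin (N - 1) => u (p.a + ((j : ℕ) + 1 : ℕ) * p.h N) t)
      = fun j => u (p.node N j) t := by
    funext j; rw [node]; push_cast; rfl
  have h3 : u (p.a + ((i : ℕ) + 2 : ℕ) * p.h N) t = u (p.node N i + p.h N) t := by
    rw [node]; push_cast; congr 1; ring
  have h4 : u (p.a + (i : ℕ) * p.h N) t = u (p.node N i - p.h N) t := by
    rw [node]; congr 1; ring
  have h5 : u (p.a + ((i : ℕ) + 1 : ℕ) * p.h N) t = u (p.node N i) t := by
    rw [node]; push_cast; rfl
  have h6 : u (p.a + (0 : ℕ) * p.h N) t = p.ua t := by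
    rw [← hu.left_boundary t ht]; simp
  have h7 : u (p.a + ((N - 1 : ℕ) + 1 : ℕ) * p.h N) t = p.ub t := by
    rw [← hu.right_boundary t ht]
    congr 1
    have := p.h_mul hN
    push_cast
    linarith
  rw [h2, h3, h4, h5, h6, h7] at h1
  rw [h1, boundaryVector]
  generalize u₂ (p.node N i) t + p.γ (p.node N i) * u₁ (p.node N i) t - p.g (p.node N i) t = c
    at key ⊢
  set X := u (p.node N i + p.h N) t - 2 * u (p.node N i) t + u (p.node N i - p.h N) t with hX
  have e : -(-X / p.h N ^ 2
      + ((if (i : ℕ) = 0 then p.ua t else 0) + if (i : ℕ) + 1 = N - 1 then p.ub t else 0)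
        / p.h N ^ 2)
      + 1 / p.h N ^ 2
        * ((if (i : ℕ) = 0 then p.ua t else 0) + if (i : ℕ) + 1 = N - 1 then p.ub t else 0) - c
      = (X - p.h N ^ 2 * c) / p.h N ^ 2 := by
    field_simp
    ring
  rw [e, abs_div, abs_of_pos (by positivity : 0 < p.h N ^ 2), div_le_iff₀ (by positivity)]
  calc |X - p.h N ^ 2 * c| ≤ C * p.h N ^ 3 := key
    _ = _ := by ring

/-! ### The schemes in components -/

theorem M_mulVec_inl (p : DampedWave) (N : ℕ) (x : Grid N) (i : Fin (N - 1)) :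
    (p.M N).mulVec x (Sum.inl i) = x (Sum.inr i) := by
  rw [M, Matrix.fromBlocks_mulVec]
  simp

theorem M_mulVec_inr (p : DampedWave) {N : ℕ} (x : Grid N) (i : Fin (N - 1)) :
    (p.M N).mulVec x (Sum.inr i) =
      -gradAdj (p.h N) (grad (p.h N) fun j => x (Sum.inl j)) i
        - p.γ (p.node N i) * x (Sum.inr i) := by
  rw [M, Matrix.fromBlocks_mulVec, ← laplaceMatrix_mulVec N (p.h N)]
  simp only [Sum.elim_inr, Pi.add_apply, Matrix.smul_mulVec, Pi.smul_apply, smul_eq_mul,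
    Matrix.neg_mulVec, Pi.neg_apply, Matrix.mulVec_diagonal, Function.comp_def]
  ring

theorem aeval_one_add_X_mulVec (p : DampedWave) (N : ℕ) (k : ℝ) (x : Grid N) :
    (Polynomial.aeval (k • p.M N) (1 + Polynomial.X : Polynomial ℝ)).mulVec x
      = x + k • (p.M N).mulVec x := by
  simp [Matrix.add_mulVec, Matrix.smul_mulVec]

theorem aeval_one_add_half_X_mulVec (p : DampedWave) (N : ℕ) (k : ℝ) (x : Grid N) :
    (Polynomial.aeval (k • p.M N)
      (1 + Polynomial.C (1 / 2) * Polynomial.X : Polynomial ℝ)).mulVec x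
      = x + (k / 2) • (p.M N).mulVec x := by
  rw [map_add, map_one, map_mul, Polynomial.aeval_C, Polynomial.aeval_X, ← Algebra.smul_def,
    smul_smul, Matrix.add_mulVec, Matrix.one_mulVec, Matrix.smul_mulVec]
  congr 2
  ring

theorem aeval_one_sub_half_X_mulVec (p : DampedWave) (N : ℕ) (k : ℝ) (x : Grid N) :
    (Polynomial.aeval (k • p.M N)
      (1 - Polynomial.C (1 / 2) * Polynomial.X : Polynomial ℝ)).mulVec x
      = x - (k / 2) • (p.M N).mulVec x := by
  rw [map_sub, map_one, map_mul, Polynomial.aeval_C, Polynomial.aeval_X, ← Algebra.smul_def,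
    smul_smul, Matrix.sub_mulVec, Matrix.one_mulVec, Matrix.smul_mulVec]
  congr 2
  ring

theorem IsFD01.position_step {p : DampedWave} {N : ℕ} {k : ℝ}
    {V : ℕ → Grid N} (hV : p.IsFD01 N k V) (n : ℕ) (i : Fin (N - 1)) :
    V (n + 1) (Sum.inl i) = V n (Sum.inl i)
      + k * (V n (Sum.inr i) + k / 2 * p.F N (n * k) (Sum.inr i)) := by
  have h1 := congrFun (hV.2 n) (Sum.inl i)
  simp only [aeval_one_add_X_mulVec, map_one, Matrix.one_mulVec, Pi.add_apply, Pi.smul_apply,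
    smul_eq_mul, M_mulVec_inl] at h1
  have h2 : ∀ t, p.F N t (Sum.inl i) = 0 := fun t => rfl
  rw [h1, h2, h2]
  ring

/-- In the variable `w + (k/2) F` the scheme is explicit Euler with the forcing taken at the new
time level; the position equation has the same shifted velocity. -/
theorem IsFD01.velocity_step {p : DampedWave} {N : ℕ} {k : ℝ}
    {V : ℕ → Grid N} (hV : p.IsFD01 N k V) (n : ℕ) (i : Fin (N - 1)) :
    V (n + 1) (Sum.inr i) + k / 2 * p.F N ((n + 1) * k) (Sum.inr i) =
      V n (Sum.inr i) + k / 2 * p.F N (n * k) (Sum.inr i)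
      - k * (gradAdj (p.h N) (grad (p.h N) fun j => V n (Sum.inl j)) i
        + p.γ (p.node N i) * (V n (Sum.inr i) + k / 2 * p.F N (n * k) (Sum.inr i)))
      + k * p.F N ((n + 1) * k) (Sum.inr i) := by
  have h1 := congrFun (hV.2 n) (Sum.inr i)
  simp only [aeval_one_add_X_mulVec, map_one, Matrix.one_mulVec, Pi.add_apply, Pi.smul_apply,
    smul_eq_mul, M_mulVec_inr] at h1
  have h2 : ∀ t, (fun j : Fin (N - 1) => p.F N t (Sum.inl j)) = fun _ => 0 := fun t => rfl
  have h3 : gradAdj (p.h N) (grad (p.h N) fun _ : Fin (N - 1) => (0 : ℝ)) i = 0 := by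
    rw [gradAdj_grad]; simp [leftEnd, rightEnd]
  rw [h1, h2, h3]
  ring

/-- A trapezoidal step perturbed by an increment of the forcing. With time-dependent boundary values
the perturbation contains `1 / h²`, the main obstacle in the analysis of the implicit scheme. -/
theorem IsFD11.position_step {p : DampedWave} {N : ℕ} {k : ℝ}
    {V : ℕ → Grid N} (hV : p.IsFD11 N k V) (n : ℕ) (i : Fin (N - 1)) :
    V (n + 1) (Sum.inl i) - V n (Sum.inl i) =
      k / 2 * (V n (Sum.inr i) + V (n + 1) (Sum.inr i)
        + k / 2 * (p.F N (n * k) (Sum.inr i) - p.F N ((n + 1) * k) (Sum.inr i))) := by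
  have h1 := congrFun (hV.2 n) (Sum.inl i)
  simp only [aeval_one_add_half_X_mulVec, aeval_one_sub_half_X_mulVec, Pi.add_apply, Pi.sub_apply,
    Pi.smul_apply, smul_eq_mul, M_mulVec_inl] at h1
  have h2 : ∀ t, p.F N t (Sum.inl i) = 0 := fun t => rfl
  rw [h2, h2] at h1
  linear_combination h1

theorem IsFD11.velocity_step {p : DampedWave} {N : ℕ} {k : ℝ}
    {V : ℕ → Grid N} (hV : p.IsFD11 N k V) (n : ℕ) (i : Fin (N - 1)) :
    V (n + 1) (Sum.inr i) - V n (Sum.inr i) =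
      k / 2 * (p.F N (n * k) (Sum.inr i) + p.F N ((n + 1) * k) (Sum.inr i))
      - k / 2 * (gradAdj (p.h N) (grad (p.h N) fun j => V n (Sum.inl j)) i
        + gradAdj (p.h N) (grad (p.h N) fun j => V (n + 1) (Sum.inl j)) i)
      - k / 2 * (p.γ (p.node N i) * (V n (Sum.inr i) + V (n + 1) (Sum.inr i)
        + k / 2 * (p.F N (n * k) (Sum.inr i) - p.F N ((n + 1) * k) (Sum.inr i)))) := by
  have h1 := congrFun (hV.2 n) (Sum.inr i)
  simp only [aeval_one_add_half_X_mulVec, aeval_one_sub_half_X_mulVec, Pi.add_apply, Pi.sub_apply,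
    Pi.smul_apply, smul_eq_mul, M_mulVec_inr] at h1
  have h2 : ∀ t, (fun j : Fin (N - 1) => p.F N t (Sum.inl j)) = fun _ => 0 := fun t => rfl
  have h3 : gradAdj (p.h N) (grad (p.h N) fun _ : Fin (N - 1) => (0 : ℝ)) i = 0 := by
    rw [gradAdj_grad]; simp [leftEnd, rightEnd]
  rw [h2, h2, h3] at h1
  linear_combination h1

/-! ### Solvability of the schemes -/

theorem existsUnique_isSchemeSolution (p : DampedWave) {Q : Polynomial ℝ} (P : Polynomial ℝ)
    {N : ℕ} {k : ℝ} (hQ : IsUnit (Polynomial.aeval (k • p.M N) Q)) :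
    ∃! V : ℕ → Grid N, p.IsSchemeSolution Q P N k V := by
  set A := Polynomial.aeval (k • p.M N) Q with hA
  set B := Polynomial.aeval (k • p.M N) P with hB
  have hdet : IsUnit A.det := (Matrix.isUnit_iff_isUnit_det A).1 hQ
  let rhs : ℕ → Grid N → Grid N := fun n x =>
    B.mulVec x + (k / 2) • (B.mulVec (p.F N (n * k)) + A.mulVec (p.F N ((n + 1) * k)))
  refine ⟨fun n => Nat.rec (p.initialVector N) (fun n x => A⁻¹.mulVec (rhs n x)) n,
    ⟨rfl, fun n => ?_⟩, ?_⟩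
  · change A.mulVec (A⁻¹.mulVec _) = _
    rw [Matrix.mulVec_mulVec, Matrix.mul_nonsing_inv A hdet, Matrix.one_mulVec]
  · intro V hV
    funext n
    induction n with
    | zero => exact hV.1
    | succ n ih =>
      have h1 : A.mulVec (V (n + 1)) = rhs n (V n) := hV.2 n
      change V (n + 1) = A⁻¹.mulVec (rhs n _)
      rw [← ih, ← h1, Matrix.mulVec_mulVec, Matrix.nonsing_inv_mul A hdet, Matrix.one_mulVec]

theorem existsUnique_isFD01 (p : DampedWave) (N : ℕ) (k : ℝ) :
    ∃! V : ℕ → Grid N, p.IsFD01 N k V :=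
  p.existsUnique_isSchemeSolution _ (by simp)

/-- A kernel vector has `v = (k/2) w`; testing its second component with `w` gives `∑ w² ≤ -∑ (Dv)²
≤ 0`, so `1 - (k/2)M` is injective. -/
theorem existsUnique_isFD11 (p : DampedWave) {N : ℕ} (hN : 2 ≤ N) {k : ℝ} (hk : 0 < k) :
    ∃! V : ℕ → Grid N, p.IsFD11 N k V := by
  refine p.existsUnique_isSchemeSolution _ (Matrix.mulVec_injective_iff_isUnit.1 ?_)
  rw [← Matrix.coe_mulVecLin, injective_iff_map_eq_zero]
  intro x hx
  rw [Matrix.mulVecLin_apply, aeval_one_sub_half_X_mulVec] at hx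
  have h1 : ∀ i, x (Sum.inl i) = k / 2 * x (Sum.inr i) := fun i => by
    have := congrFun hx (Sum.inl i)
    simp only [Pi.sub_apply, Pi.smul_apply, smul_eq_mul, M_mulVec_inl, Pi.zero_apply] at this
    linarith
  have h2 : ∀ i, x (Sum.inr i) = -(k / 2) * (gradAdj (p.h N) (grad (p.h N) fun j =>
      x (Sum.inl j)) i + p.γ (p.node N i) * x (Sum.inr i)) := fun i => by
    have := congrFun hx (Sum.inr i)
    simp only [Pi.sub_apply, Pi.smul_apply, smul_eq_mul, M_mulVec_inr, Pi.zero_apply] at this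
    linarith
  set v : Fin (N - 1) → ℝ := fun j => x (Sum.inl j) with hv
  have h3 : ∑ i, v i * gradAdj (p.h N) (grad (p.h N) v) i = ∑ j, grad (p.h N) v j ^ 2 := by
    rw [← sum_grad_mul]
    exact Finset.sum_congr rfl fun j _ => by ring
  have h4 : 0 ≤ ∑ j, grad (p.h N) v j ^ 2 := Finset.sum_nonneg fun _ _ => sq_nonneg _
  have h5 : ∑ i, x (Sum.inr i) ^ 2 ≤ 0 := by
    have : ∑ i, x (Sum.inr i) ^ 2 ≤ -∑ i, v i * gradAdj (p.h N) (grad (p.h N) v) i := by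
      rw [← Finset.sum_neg_distrib]
      refine Finset.sum_le_sum fun i _ => ?_
      have e1 : v i = k / 2 * x (Sum.inr i) := h1 i
      have e2 := h2 i
      have e3 := mul_nonneg (mul_nonneg hk.le (p.γ_nonneg _ (p.node_mem hN i)))
        (sq_nonneg (x (Sum.inr i)))
      have e4 : x (Sum.inr i) ^ 2 = x (Sum.inr i) * (-(k / 2) * (gradAdj (p.h N)
          (grad (p.h N) v) i + p.γ (p.node N i) * x (Sum.inr i))) := by
        rw [← e2]; ring
      rw [e4, e1]
      nlinarith
    linarith
  have h6 : ∀ i, x (Sum.inr i) = 0 := fun i => by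
    have h7 : ∑ i, x (Sum.inr i) ^ 2 = 0 :=
      le_antisymm h5 (Finset.sum_nonneg fun _ _ => sq_nonneg _)
    have := (Finset.sum_eq_zero_iff_of_nonneg fun _ _ => sq_nonneg _).1 h7 i (Finset.mem_univ i)
    exact pow_eq_zero_iff two_ne_zero |>.1 this
  funext a
  rcases a with i | i
  · rw [h1 i, h6 i]; simp
  · exact h6 i

end DampedWave

/-! ### Grid functions concentrated at the two ends of the mesh -/

noncomputable section

/-- The number of ends of the mesh (`0`, `1` or `2`) to which the node `i` is adjacent. -/
def endCount {m : ℕ} (i : Fin m) : ℝ :=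
  (if (i : ℕ) = 0 then 1 else 0) + if (i : ℕ) + 1 = m then 1 else 0

theorem endCount_nonneg {m : ℕ} (i : Fin m) : 0 ≤ endCount i := by
  rw [endCount]; split_ifs <;> norm_num

/-- Concentration at the end nodes gains a factor `√h`, which compensates for part of the `1 / h²`
in the boundary load. -/
theorem gridNorm_endCount_le {m : ℕ} {h : ℝ} (hh : 0 ≤ h) :
    gridNorm h (endCount : Fin m → ℝ) ≤ 2 * √h := by
  have aux : ∀ a : ℕ, gridNorm h (fun i : Fin m => if (i : ℕ) = a then (1 : ℝ) else 0) ≤ √h := by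
    intro a
    refine Real.sqrt_le_sqrt (mul_le_of_le_one_right hh ?_)
    by_cases ha : a < m
    · rw [Finset.sum_eq_single ⟨a, ha⟩]
      · simp
      · intro j _ hj
        have : (j : ℕ) ≠ a := fun h => hj (Fin.ext h)
        simp [this]
      · simp
    · rw [Finset.sum_eq_zero]
      · norm_num
      · intro j _
        have : (j : ℕ) ≠ a := by omega
        simp [this]
  have h1 : (fun i : Fin m => if (i : ℕ) + 1 = m then (1 : ℝ) else 0)
      = fun i : Fin m => if (i : ℕ) = m - 1 then (1 : ℝ) else 0 := by
    funext i
    have : (i : ℕ) + 1 = m ↔ (i : ℕ) = m - 1 := by omega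
    simp only [this]
  have h2 := gridNorm_add_le hh (fun i : Fin m => if (i : ℕ) = 0 then (1 : ℝ) else 0)
    (fun i : Fin m => if (i : ℕ) + 1 = m then (1 : ℝ) else 0)
  have h3 := aux 0
  have h4 := aux (m - 1)
  rw [← h1] at h4
  exact h2.trans (by linarith)

namespace DampedWave

theorem gridNorm_le_of_forall_le (p : DampedWave) {N : ℕ} (hN : 2 ≤ N) {A B : ℝ} (hA : 0 ≤ A)
    (hB : 0 ≤ B) {x : Fin (N - 1) → ℝ} (hx : ∀ i, |x i| ≤ A + B * endCount i) :
    gridNorm (p.h N) x ≤ √(p.b - p.a) * A + 2 * √(p.h N) * B := by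
  have hh := (p.h_pos hN).le
  have h1 : gridNorm (p.h N) x ≤ gridNorm (p.h N) (fun i : Fin (N - 1) => A + B * endCount i) :=
    gridNorm_mono hh fun i => (hx i).trans (le_abs_self _)
  have h2 := gridNorm_add_le hh (fun _ : Fin (N - 1) => A) (fun i => B * endCount i)
  have h3 := p.gridNorm_le_of_forall_node hN hA (x := fun _ => A) fun i => (abs_of_nonneg hA).le
  have h4 := gridNorm_mul hh B (endCount : Fin (N - 1) → ℝ)
  rw [abs_of_nonneg hB] at h4
  have h5 := mul_le_mul_of_nonneg_left (gridNorm_endCount_le (m := N - 1) hh) hB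
  linarith

theorem Regular.abs_boundaryVector_le {p : DampedWave} {T : ℝ} {u u₁ u₂ u₃ g₁ : ℝ → ℝ → ℝ}
    {C : ℝ} (hr : p.Regular T u u₁ u₂ u₃ g₁ C) (hu : p.IsSolution T u) (N : ℕ) {t : ℝ}
    (ht : t ∈ Set.Icc 0 T) (i : Fin (N - 1)) :
    |p.boundaryVector N t i| ≤ C * endCount i := by
  have ha := hr.abs_u_le p.a ⟨le_rfl, p.a_lt_b.le⟩ t ht
  have hb := hr.abs_u_le p.b ⟨p.a_lt_b.le, le_rfl⟩ t ht
  rw [hu.left_boundary t ht] at ha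
  rw [hu.right_boundary t ht] at hb
  rw [boundaryVector, endCount, mul_add, mul_ite, mul_ite, mul_one, mul_zero]
  refine (abs_add_le _ _).trans (add_le_add ?_ ?_)
  · split_ifs <;> simp [ha]
  · split_ifs <;> simp [hb]

theorem Regular.abs_boundaryVector_sub_le {p : DampedWave} {T : ℝ} {u u₁ u₂ u₃ g₁ : ℝ → ℝ → ℝ}
    {C : ℝ} (hr : p.Regular T u u₁ u₂ u₃ g₁ C) (hu : p.IsSolution T u) (N : ℕ) {s t : ℝ}
    (hs : s ∈ Set.Icc 0 T) (ht : t ∈ Set.Icc 0 T) (i : Fin (N - 1)) :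
    |p.boundaryVector N t i - p.boundaryVector N s i| ≤ C * |t - s| * endCount i := by
  have ha := hr.lipschitz_u p.a ⟨le_rfl, p.a_lt_b.le⟩ s hs t ht
  have hb := hr.lipschitz_u p.b ⟨p.a_lt_b.le, le_rfl⟩ s hs t ht
  rw [hu.left_boundary t ht, hu.left_boundary s hs] at ha
  rw [hu.right_boundary t ht, hu.right_boundary s hs] at hb
  rw [boundaryVector, boundaryVector, add_sub_add_comm, endCount, mul_add, mul_ite, mul_ite,
    mul_one, mul_zero]
  refine (abs_add_le _ _).trans (add_le_add ?_ ?_)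
  · split_ifs <;> simp [ha]
  · split_ifs <;> simp [hb]

/-! ### The explicit scheme -/

theorem F_inr (p : DampedWave) (N : ℕ) (t : ℝ) (i : Fin (N - 1)) :
    p.F N t (Sum.inr i) = p.g (p.node N i) t + 1 / p.h N ^ 2 * p.boundaryVector N t i := rfl

/-- With `k ≤ K h²` a kick `(k/2) F` is bounded at the end nodes and `O(h)` elsewhere, hence `O(√h)`
in norm. The same count applied to increments of the boundary load gives `k · O(√h)` per step, and
the stability estimate adds these up. -/
theorem Regular.fd01_error_le {p : DampedWave} {T : ℝ} {u u₁ u₂ u₃ g₁ : ℝ → ℝ → ℝ}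
    {C : ℝ} (hr : p.Regular T u u₁ u₂ u₃ g₁ C) (hu : p.IsSolution T u) {K : ℝ} (hK : 0 ≤ K)
    {N : ℕ} (hN : 2 ≤ N) {k : ℝ} (hk : 0 < k) (hh1 : p.h N ≤ 1) (hkh : k ≤ K * p.h N ^ 2)
    {V : ℕ → Grid N} (hV : p.IsFD01 N k V) {n : ℕ} (hn : n * k ≤ T) :
    gridNorm (p.h N) (grad (p.h N) (p.positionError u k V n)) ≤
      Real.exp (K * (8 + 2 * C ^ 2) * T) * (C * K * (√(p.b - p.a) + 1)
        + T * (C * (√(p.b - p.a) * (1 + 4 * K) + 2 * K))) * √(p.h N) ∧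
    gridNorm (p.h N) (p.velocityError T u k V n) ≤
      (Real.exp (K * (8 + 2 * C ^ 2) * T) * (C * K * (√(p.b - p.a) + 1)
        + T * (C * (√(p.b - p.a) * (1 + 4 * K) + 2 * K))) + C * K * (√(p.b - p.a) + 1))
        * √(p.h N) := by
  have hh := p.h_pos hN
  set h := p.h N with hdef
  set l := √(p.b - p.a) with hl
  have hl0 : 0 ≤ l := Real.sqrt_nonneg _
  have hC := hr.nonneg
  have hs0 : 0 ≤ √h := Real.sqrt_nonneg _
  have hs1 : h ≤ √h := Real.le_sqrt_of_sq_le (by nlinarith)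
  have hT : 0 ≤ T := le_trans (by positivity) hn
  have hmem : ∀ j ≤ n, (j : ℝ) * k ∈ Set.Icc 0 T := fun j hj =>
    ⟨by positivity, le_trans (by gcongr) hn⟩
  have hkh2 : k / h ^ 2 ≤ K := by rwa [div_le_iff₀ (by positivity)]
  have hh2 : h ^ 2 ≤ h := by nlinarith
  have hkK : k ≤ K * h := hkh.trans (mul_le_mul_of_nonneg_left hh2 hK)
  have hkK1 : k ≤ K := hkK.trans (mul_le_of_le_one_right hK hh1)
  -- the velocity, shifted by half a kick
  let half : ℕ → Fin (N - 1) → ℝ := fun j i => k / 2 * p.F N (j * k) (Sum.inr i)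
  let P : ℕ → Fin (N - 1) → ℝ := fun j i =>
    V j (Sum.inr i) + half j i - u₁ (p.node N i) (j * k)
  let ρ : ℕ → Fin (N - 1) → ℝ := fun j i =>
    -(u (p.node N i) ((j + 1) * k) - u (p.node N i) (j * k) - k * u₁ (p.node N i) (j * k))
  let r : ℕ → Fin (N - 1) → ℝ := fun j i =>
    k * (-gradAdj h (grad h fun j' => u (p.node N j') (j * k)) i
        + 1 / h ^ 2 * p.boundaryVector N (j * k) i
        - (u₂ (p.node N i) (j * k) + p.γ (p.node N i) * u₁ (p.node N i) (j * k)
          - p.g (p.node N i) (j * k)))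
      + k * (p.g (p.node N i) ((j + 1) * k) - p.g (p.node N i) (j * k))
      - (u₁ (p.node N i) ((j + 1) * k) - u₁ (p.node N i) (j * k) - k * u₂ (p.node N i) (j * k))
      + k / h ^ 2 * (p.boundaryVector N ((j + 1) * k) i - p.boundaryVector N (j * k) i)
  have hhalf : ∀ j ≤ n, gridNorm h (half j) ≤ C * K * (l + 1) * √h := by
    intro j hj
    have b1 : ∀ i, |half j i| ≤ C * K / 2 * h + C * K / 2 * endCount i := by
      intro i
      have e1 := hr.abs_g_le _ (p.node_mem hN i) _ (hmem j hj)
      have e2 := hr.abs_boundaryVector_le hu N (hmem j hj) i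
      have e3 := endCount_nonneg i
      have : half j i = k / 2 * p.g (p.node N i) (j * k)
          + k / h ^ 2 / 2 * p.boundaryVector N (j * k) i := by
        simp only [half, F_inr]; ring
      rw [this]
      refine (abs_add_le _ _).trans ?_
      rw [abs_mul, abs_mul, abs_of_nonneg (by positivity : 0 ≤ k / 2),
        abs_of_nonneg (by positivity : 0 ≤ k / h ^ 2 / 2)]
      calc k / 2 * |p.g (p.node N i) (j * k)| + k / h ^ 2 / 2 * |p.boundaryVector N (j * k) i|
          ≤ K * h / 2 * C + K / 2 * (C * endCount i) := by gcongr
        _ = _ := by ring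
    have b2 := p.gridNorm_le_of_forall_le hN (by positivity) (by positivity) b1
    have b3 : l * (C * K / 2 * h) ≤ C * K * l * √h := by
      calc l * (C * K / 2 * h) = C * K * l * (h / 2) := by ring
        _ ≤ _ := by gcongr; linarith
    refine b2.trans ?_
    rw [← hl, ← hdef]
    linarith
  have hQ : ∀ j < n, ∀ a, grad h (p.positionError u k V (j + 1)) a
      = grad h (p.positionError u k V j) a + k * grad h (P j) a + grad h (ρ j) a := by
    intro j _ a
    rw [← grad_mul, ← grad_add, ← grad_add]
    congr 1
    funext i
    have := hV.position_step j i
    simp only [positionError, P, ρ, half]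
    rw [this]
    push_cast
    ring
  have hP : ∀ j < n, ∀ i, P (j + 1) i = P j i
      - k * (gradAdj h (grad h (p.positionError u k V j)) i + p.γ (p.node N i) * P j i)
      + r j i := by
    intro j _ i
    have e1 := hV.velocity_step j i
    have e2 : gradAdj h (grad h (p.positionError u k V j)) i = _ :=
      gradAdj_grad_sub h (fun i => V j (Sum.inl i)) (fun i => u (p.node N i) (j * k)) i
    rw [e2]
    simp only [P, r, half]
    push_cast
    rw [e1, F_inr p N ((j + 1) * k), ← hdef]
    ring
  have hρb : ∀ j < n, gridNorm h (r j) + gridNorm h (grad h (ρ j)) ≤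
      k * (C * (l * (1 + 4 * K) + 2 * K) * √h) := by
    intro j hj
    have m0 := hmem j hj.le
    have m1 := hmem (j + 1) hj
    push_cast at m1
    have hst : ((j : ℝ) + 1) * k - j * k = k := by ring
    have b1 : ∀ i, |ρ j i| ≤ C * k ^ 2 := by
      intro i
      have := hr.taylor_u _ (p.node_mem hN i) _ m0 _ m1
      rw [hst, abs_of_pos hk] at this
      simpa only [ρ, abs_neg] using this
    have b2 := (gridNorm_grad_le hh (ρ j)).trans (mul_le_mul_of_nonneg_left
      (p.gridNorm_le_of_forall_node hN (by positivity) b1) (by positivity))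
    -- The Taylor residual `k²` of the position equation is differentiated in space; the lost `1 /
    -- h` is recovered from `k / h² ≤ K`.
    have b3 : 2 / h * (l * (C * k ^ 2)) ≤ k * (C * l * (2 * K) * √h) := by
      calc 2 / h * (l * (C * k ^ 2)) = k * (C * l * (2 * (k / h ^ 2)) * h) := by field_simp
        _ ≤ _ := by gcongr
    have b4 : ∀ i, |r j i| ≤ k * (C * (1 + 2 * K) * h) + k * (C * K) * endCount i := by
      intro i
      have hx := p.node_mem hN i
      have e1 := hr.abs_discrete_laplacian_le hu hN m0 i
      have e2 := hr.lipschitz_g _ hx _ m0 _ m1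
      have e3 := hr.taylor_u₁ _ hx _ m0 _ m1
      have e4 := hr.abs_boundaryVector_sub_le hu N m0 m1 i
      rw [hst, abs_of_pos hk] at e2 e3 e4
      have e5 := endCount_nonneg i
      refine (abs_add_le _ _).trans (add_le_add ((abs_sub _ _).trans ((add_le_add
        (abs_add_le _ _) e3).trans ?_)) ?_)
      · rw [abs_mul, abs_mul, abs_of_pos hk]
        calc _ ≤ k * (C * h) + k * (C * k) + C * k ^ 2 := by gcongr
          _ = k * (C * (h + 2 * k)) := by ring
          _ ≤ k * (C * (h + 2 * (K * h))) := by gcongr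
          _ = _ := by ring
      · rw [abs_mul, abs_of_nonneg (by positivity : 0 ≤ k / h ^ 2)]
        calc _ ≤ K * (C * k * endCount i) := by gcongr
          _ = _ := by ring
    have b5 := p.gridNorm_le_of_forall_le hN (by positivity) (by positivity) b4
    rw [← hdef] at b5
    have b6 : l * (k * (C * (1 + 2 * K) * h)) ≤ k * (C * (l * (1 + 2 * K)) * √h) := by
      calc l * (k * (C * (1 + 2 * K) * h)) = k * (C * (l * (1 + 2 * K)) * h) := by ring
        _ ≤ _ := by gcongr
    linarith
  have hc : k * (8 / h ^ 2 + 2 * C ^ 2) ≤ K * (8 + 2 * C ^ 2) := by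
    calc k * (8 / h ^ 2 + 2 * C ^ 2) = k / h ^ 2 * 8 + k * (2 * C ^ 2) := by ring
      _ ≤ K * 8 + K * (2 * C ^ 2) := by gcongr
      _ = _ := by ring
  have key := gridNorm_le_of_explicitEuler hh.le hk.le (γ := fun i => p.γ (p.node N i))
    (fun i => p.γ_nonneg _ (p.node_mem hN i)) (fun i => hr.γ_le _ (p.node_mem hN i)) hc hP hQ
    (by positivity) hρb
  -- The initial data are exact, but the shifted velocity starts with the kick itself as its error.
  have hP0 : P 0 = half 0 := by
    funext i
    have e1 : V 0 (Sum.inr i) = p.ψ (p.node N i) := by rw [hV.1]; rfl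
    have e2 := hr.derivWithin_eq _ (p.node_mem hN i) 0 ⟨le_rfl, hT⟩
    rw [hu.initial_velocity _ (p.node_mem hN i)] at e2
    simp only [P, e1, e2]
    simp
  have hQ0 : gridNorm h (grad h (p.positionError u k V 0)) = 0 := by
    have e0 : p.positionError u k V 0 = fun _ => 0 := by
      funext i
      have e1 : V 0 (Sum.inl i) = p.φ (p.node N i) := by rw [hV.1]; rfl
      simp [positionError, e1, hu.initial_position _ (p.node_mem hN i)]
    rw [e0]
    simp [gridNorm, grad, leftEnd, rightEnd]
  have key2 : gridNorm h (Sum.elim (P n) (grad h (p.positionError u k V n))) ≤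
      Real.exp (K * (8 + 2 * C ^ 2) * T) * (C * K * (l + 1)
        + T * (C * (l * (1 + 4 * K) + 2 * K))) * √h := by
    refine key.trans ?_
    rw [hQ0, hP0]
    calc Real.exp (K * (8 + 2 * C ^ 2) * (n * k)) * (gridNorm h (half 0) + 0
          + n * (k * (C * (l * (1 + 4 * K) + 2 * K) * √h)))
        ≤ Real.exp (K * (8 + 2 * C ^ 2) * T) * (C * K * (l + 1) * √h + 0
          + T * (C * (l * (1 + 4 * K) + 2 * K) * √h)) := by
          rw [← mul_assoc (n : ℝ)]
          have := hhalf 0 (Nat.zero_le n)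
          have := gridNorm_nonneg h (half 0)
          gcongr
      _ = _ := by ring
  refine ⟨(gridNorm_le_sumElim_right hh.le _ _).trans key2, ?_⟩
  have e1 : p.velocityError T u k V n = fun i => P n i + (-1) * half n i := by
    funext i
    simp only [velocityError, P, hr.derivWithin_eq _ (p.node_mem hN i) _ (hmem n le_rfl)]
    ring
  rw [e1]
  refine (gridNorm_add_le hh.le _ _).trans ?_
  rw [gridNorm_mul hh.le, add_mul]
  have e2 := hhalf n le_rfl
  have e3 := (gridNorm_le_sumElim_left hh.le _ _).trans key2
  rw [abs_neg, abs_one, one_mul]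
  exact add_le_add e3 e2

end DampedWave

end

/-! ### Sequences with prescribed sums of consecutive terms -/

noncomputable section

/-- The sequence with initial term `c₀` for which `c n + c (n + 1) = r n`. -/
def alternating (c₀ : ℝ) (r : ℕ → ℝ) : ℕ → ℝ
  | 0 => c₀
  | n + 1 => r n - alternating c₀ r n

theorem alternating_add (c₀ : ℝ) (r : ℕ → ℝ) (n : ℕ) :
    alternating c₀ r n + alternating c₀ r (n + 1) = r n := by
  rw [alternating]; ring

/-- No cancellation between consecutive terms is used: over `T / k` steps one power of `k` is lost,
and `r` has to be that much smaller. -/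
theorem abs_alternating_le (c₀ : ℝ) {r : ℕ → ℝ} {ρ : ℝ} {n : ℕ} (hr : ∀ j < n, |r j| ≤ ρ) :
    |alternating c₀ r n| ≤ |c₀| + n * ρ :=
  le_add_of_step_le (a := fun j => |alternating c₀ r j|) fun j hj => by
    have := abs_sub (r j) (alternating c₀ r j)
    simp only [alternating]
    linarith [hr j hj]

namespace DampedWave

/-- Velocities whose means over consecutive time levels are the exact difference quotients. -/
theorem Regular.exists_midpoint_velocity {p : DampedWave} {T : ℝ} {u u₁ u₂ u₃ g₁ : ℝ → ℝ → ℝ}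
    {C : ℝ} (hr : p.Regular T u u₁ u₂ u₃ g₁ C) {x : ℝ} (hx : x ∈ Set.Icc p.a p.b) {k : ℝ}
    (hk : 0 < k) : ∃ U : ℕ → ℝ,
      (∀ n : ℕ, (n + 1) * k ≤ T →
        k / 2 * (U n + U (n + 1)) = u x ((n + 1) * k) - u x (n * k)) ∧
      ∀ n : ℕ, n * k ≤ T → |U n - u₁ x (n * k)| ≤ C * (1 + 2 * T) * k ^ 2 := by
  have hC := hr.nonneg
  -- The correction of the trapezoidal rule makes `r = O(k³)`, hence `U - u_t = O(k²)`. With `u₁`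
  -- alone the deviation could only be bounded by `O(k)`, and its increments, which are estimated
  -- termwise, would not sum to something small.
  let b : ℕ → ℝ := fun n => u₁ x (n * k) - k ^ 2 / 12 * u₃ x (n * k)
  let r : ℕ → ℝ := fun n => 2 / k * (u x ((n + 1) * k) - u x (n * k)) - b n - b (n + 1)
  refine ⟨fun n => b n + alternating 0 r n, fun n _ => ?_, fun n hn => ?_⟩
  · have h1 := alternating_add 0 r n
    calc k / 2 * (b n + alternating 0 r n + (b (n + 1) + alternating 0 r (n + 1)))
        = k / 2 * (b n + b (n + 1) + (alternating 0 r n + alternating 0 r (n + 1))) := by ring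
      _ = _ := by rw [h1]; simp only [r]; field_simp; ring
  · have hmem : ∀ j ≤ n, (j : ℝ) * k ∈ Set.Icc 0 T := fun j hj =>
      ⟨by positivity, le_trans (by gcongr) hn⟩
    have h1 : ∀ j < n, |r j| ≤ 2 * C * k ^ 3 := by
      intro j hj
      have m0 := hmem j hj.le
      have m1 := hmem (j + 1) hj
      push_cast at m1
      have e := hr.trapezoid x hx _ m0 _ m1
      rw [show ((j : ℝ) + 1) * k - j * k = k by ring, abs_of_pos hk] at e
      have e2 : r j = 2 / k * (u x ((j + 1) * k) - u x (j * k)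
          - k / 2 * (u₁ x (j * k) + u₁ x ((j + 1) * k))
          + k ^ 3 / 24 * (u₃ x (j * k) + u₃ x ((j + 1) * k))) := by
        simp only [r, b]
        push_cast
        field_simp
        ring
      rw [e2, abs_mul, abs_of_pos (by positivity : 0 < 2 / k)]
      calc _ ≤ 2 / k * (C * k ^ 4) := by gcongr
        _ = _ := by field_simp
    have h2 := abs_alternating_le 0 h1
    have h3 := hr.abs_u₃_le x hx _ (hmem n le_rfl)
    have h4 : (n : ℝ) * (2 * C * k ^ 3) ≤ 2 * C * T * k ^ 2 := by
      calc (n : ℝ) * (2 * C * k ^ 3) = n * k * (2 * C * k ^ 2) := by ring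
        _ ≤ T * (2 * C * k ^ 2) := by gcongr
        _ = _ := by ring
    have h5 : |k ^ 2 / 12 * u₃ x (n * k)| ≤ C * k ^ 2 := by
      rw [abs_mul, abs_of_nonneg (by positivity)]
      calc k ^ 2 / 12 * |u₃ x (n * k)| ≤ k ^ 2 / 12 * C := by gcongr
        _ ≤ _ := by nlinarith [mul_nonneg hC (sq_nonneg k)]
    calc |b n + alternating 0 r n - u₁ x (n * k)|
        = |alternating 0 r n - k ^ 2 / 12 * u₃ x (n * k)| := by
          congr 1; simp only [b]; ring
      _ ≤ |alternating 0 r n| + |k ^ 2 / 12 * u₃ x (n * k)| := abs_sub _ _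
      _ ≤ _ := by rw [abs_zero] at h2; linarith

/-- Bounded numbers whose means over consecutive time levels are the difference quotients of the
forcing. -/
theorem Regular.exists_midpoint_forcing {p : DampedWave} {T : ℝ} {u u₁ u₂ u₃ g₁ : ℝ → ℝ → ℝ}
    {C : ℝ} (hr : p.Regular T u u₁ u₂ u₃ g₁ C) {x : ℝ} (hx : x ∈ Set.Icc p.a p.b) {k : ℝ}
    (hk : 0 < k) : ∃ G : ℕ → ℝ,
      (∀ n : ℕ, (n + 1) * k ≤ T →
        k / 2 * (G n + G (n + 1)) = p.g x ((n + 1) * k) - p.g x (n * k)) ∧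
      ∀ n : ℕ, n * k ≤ T → |G n| ≤ C * (1 + 3 * T) := by
  have hC := hr.nonneg
  -- No correction is needed here: `r = O(k)` keeps `G` bounded, and `G` is used only with a factor
  -- `k²`.
  let b : ℕ → ℝ := fun n => g₁ x (n * k)
  let r : ℕ → ℝ := fun n => 2 / k * (p.g x ((n + 1) * k) - p.g x (n * k)) - b n - b (n + 1)
  refine ⟨fun n => b n + alternating 0 r n, fun n _ => ?_, fun n hn => ?_⟩
  · have h1 := alternating_add 0 r n
    calc k / 2 * (b n + alternating 0 r n + (b (n + 1) + alternating 0 r (n + 1)))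
        = k / 2 * (b n + b (n + 1) + (alternating 0 r n + alternating 0 r (n + 1))) := by ring
      _ = _ := by rw [h1]; simp only [r]; field_simp; ring
  · have hmem : ∀ j ≤ n, (j : ℝ) * k ∈ Set.Icc 0 T := fun j hj =>
      ⟨by positivity, le_trans (by gcongr) hn⟩
    have h1 : ∀ j < n, |r j| ≤ 3 * C * k := by
      intro j hj
      have m0 := hmem j hj.le
      have m1 := hmem (j + 1) hj
      push_cast at m1
      have e := hr.taylor_g x hx _ m0 _ m1
      have e' := hr.lipschitz_g₁ x hx _ m0 _ m1
      rw [show ((j : ℝ) + 1) * k - j * k = k by ring, abs_of_pos hk] at e e'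
      have e2 : r j = 2 / k * (p.g x ((j + 1) * k) - p.g x (j * k) - k * g₁ x (j * k))
          - (g₁ x ((j + 1) * k) - g₁ x (j * k)) := by
        simp only [r, b]
        push_cast
        field_simp
        ring
      rw [e2]
      refine (abs_sub _ _).trans ?_
      rw [abs_mul, abs_of_pos (by positivity : 0 < 2 / k)]
      calc _ ≤ 2 / k * (C * k ^ 2) + C * k := by gcongr
        _ = _ := by field_simp; ring
    have h2 := abs_alternating_le 0 h1
    have h3 := hr.abs_g₁_le x hx _ (hmem n le_rfl)
    have h4 : (n : ℝ) * (3 * C * k) ≤ 3 * C * T := by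
      calc (n : ℝ) * (3 * C * k) = n * k * (3 * C) := by ring
        _ ≤ T * (3 * C) := by gcongr
        _ = _ := by ring
    refine (abs_add_le _ _).trans ?_
    rw [abs_zero] at h2
    simp only [b]
    linarith

/-- A combination of the two unit vectors at the ends of the mesh. -/
def endVector {m : ℕ} (α β : ℝ) (i : Fin m) : ℝ :=
  (if (i : ℕ) = 0 then α else 0) + if (i : ℕ) + 1 = m then β else 0

theorem abs_endVector_le {m : ℕ} {α β D : ℝ} (hα : |α| ≤ D) (hβ : |β| ≤ D) (i : Fin m) :
    |endVector α β i| ≤ D * endCount i := by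
  rw [endVector, endCount, mul_add, mul_ite, mul_ite, mul_one, mul_zero]
  refine (abs_add_le _ _).trans (add_le_add ?_ ?_)
  · split_ifs <;> simp [hα]
  · split_ifs <;> simp [hβ]

/-! ### The energy estimate for the implicit scheme -/

set_option maxHeartbeats 800000 in
-- The sequences `α`, `β` are midpoint velocities of the boundary values and `μ` measures `D k² /
-- h^{3/2}`, the norm of the boundary kick. Leaving them free allows `α = β = 0`, `D = 0` when the
-- boundary values are constant.
theorem Regular.fd11_energy_error_le {p : DampedWave} {T : ℝ} {u u₁ u₂ u₃ g₁ : ℝ → ℝ → ℝ}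
    {C : ℝ} (hr : p.Regular T u u₁ u₂ u₃ g₁ C) (hu : p.IsSolution T u)
    {N : ℕ} (hN : 2 ≤ N) {k : ℝ} (hk : 0 < k) (hk1 : k ≤ 1)
    {V : ℕ → Grid N} (hV : p.IsFD11 N k V) {n : ℕ} (hn : n * k ≤ T) {α β : ℕ → ℝ} {D μ : ℝ}
    (hD : 0 ≤ D) (hα : ∀ j < n, k / 2 * (α j + α (j + 1)) = p.ua ((j + 1) * k) - p.ua (j * k))
    (hβ : ∀ j < n, k / 2 * (β j + β (j + 1)) = p.ub ((j + 1) * k) - p.ub (j * k))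
    (hαD : ∀ j ≤ n, |α j| ≤ D) (hβD : ∀ j ≤ n, |β j| ≤ D)
    (hαk : ∀ j < n, |α (j + 1) - α j| ≤ D * k) (hβk : ∀ j < n, |β (j + 1) - β j| ≤ D * k)
    (hμ : D * k ^ 2 ≤ μ * (p.h N * √(p.h N))) :
    gridNorm (p.h N) (grad (p.h N) (p.positionError u k V n)) ≤
      (1 + T) * (√(p.b - p.a) * (C * (C + 6) * (1 + 3 * T) * (p.h N + k)) + μ) ∧
    gridNorm (p.h N) (p.velocityError T u k V n) ≤
      (2 + T) * (√(p.b - p.a) * (C * (C + 6) * (1 + 3 * T) * (p.h N + k)) + μ) := by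
  have hh := p.h_pos hN
  set h := p.h N with hdef
  set l := √(p.b - p.a) with hl
  have hl0 : 0 ≤ l := Real.sqrt_nonneg _
  have hC := hr.nonneg
  have hT : 0 ≤ T := le_trans (by positivity) hn
  have hmem : ∀ j ≤ n, (j : ℝ) * k ∈ Set.Icc 0 T := fun j hj =>
    ⟨by positivity, le_trans (by gcongr) hn⟩
  have hk2 : k ^ 2 ≤ k := by nlinarith
  have hs : √h * √h = h := Real.mul_self_sqrt hh.le
  have hspos : 0 < √h := Real.sqrt_pos.2 hh
  have hμ0 : 0 ≤ μ := by
    have : 0 ≤ μ * (h * √h) := le_trans (by positivity) hμ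
    exact nonneg_of_mul_nonneg_left this (by positivity)
  have hμ' : √h * (k ^ 2 / h ^ 2 * D) ≤ μ := by
    rw [show √h * (k ^ 2 / h ^ 2 * D) = (D * k ^ 2) * √h / h ^ 2 by ring,
      div_le_iff₀ (by positivity)]
    calc D * k ^ 2 * √h ≤ μ * (h * √h) * √h := by gcongr
      _ = μ * (h * (√h * √h)) := by ring
      _ = _ := by rw [hs]; ring
  choose U hU hUb using fun i => hr.exists_midpoint_velocity (p.node_mem hN i) hk
  choose G hG hGb using fun i => hr.exists_midpoint_forcing (p.node_mem hN i) hk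
  have hlt : ∀ j < n, ((j : ℝ) + 1) * k ≤ T := fun j hj => by
    have := (hmem (j + 1) hj).2
    push_cast at this
    exact this
  -- Chosen so that `σ j + σ (j + 1)` is the forcing increment in the position equation; adding `σ`
  -- to the velocity removes that increment from both equations.
  let σ : ℕ → Fin (N - 1) → ℝ := fun j i =>
    -(k ^ 2 / 4) * (G i j + 1 / h ^ 2 * endVector (α j) (β j) i)
  let P : ℕ → Fin (N - 1) → ℝ := fun j i => V j (Sum.inr i) + σ j i - U i j
  let cons : ℕ → Fin (N - 1) → ℝ := fun j i =>
    -gradAdj h (grad h fun j' => u (p.node N j') (j * k)) i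
      + 1 / h ^ 2 * p.boundaryVector N (j * k) i
      - (u₂ (p.node N i) (j * k) + p.γ (p.node N i) * u₁ (p.node N i) (j * k)
        - p.g (p.node N i) (j * k))
  let dσ : ℕ → Fin (N - 1) → ℝ := fun j i => σ (j + 1) i - σ j i
  let τ : ℕ → Fin (N - 1) → ℝ := fun j i =>
    k / 2 * (cons j i + cons (j + 1) i)
      + k / 2 * p.γ (p.node N i) * ((u₁ (p.node N i) (j * k) - U i j)
        + (u₁ (p.node N i) ((j + 1) * k) - U i (j + 1)))
      - (u₁ (p.node N i) ((j + 1) * k) - u₁ (p.node N i) (j * k) - k * u₂ (p.node N i) (j * k))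
      + k / 2 * (u₂ (p.node N i) ((j + 1) * k) - u₂ (p.node N i) (j * k))
      + (u₁ (p.node N i) ((j + 1) * k) - U i (j + 1)) - (u₁ (p.node N i) (j * k) - U i j)
  have hσ : ∀ j < n, ∀ i, σ j i + σ (j + 1) i =
      k / 2 * (p.F N (j * k) (Sum.inr i) - p.F N ((j + 1) * k) (Sum.inr i)) := by
    intro j hj i
    have e1 := hG i j (hlt j hj)
    have e2 : k / 2 * (endVector (α j) (β j) i + endVector (α (j + 1)) (β (j + 1)) i)
        = p.boundaryVector N ((j + 1) * k) i - p.boundaryVector N (j * k) i := by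
      simp only [endVector, boundaryVector]
      have a1 := hα j hj
      have b1 := hβ j hj
      split_ifs <;> linarith
    rw [F_inr, F_inr, ← hdef]
    simp only [σ]
    linear_combination (-(k / 2)) * e1 - k / 2 * (1 / h ^ 2) * e2
  have hσb : ∀ j ≤ n, gridNorm h (σ j) ≤ l * (C * (1 + 3 * T) / 4 * k) + μ / 2 := by
    intro j hj
    have b1 : ∀ i, |σ j i| ≤ k ^ 2 / 4 * (C * (1 + 3 * T)) + k ^ 2 / 4 / h ^ 2 * D * endCount i := by
      intro i
      have e1 := hGb i j (hmem j hj).2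
      have e2 := abs_endVector_le (hαD j hj) (hβD j hj) i
      simp only [σ]
      rw [abs_mul, abs_neg, abs_of_nonneg (by positivity)]
      calc _ ≤ k ^ 2 / 4 * (C * (1 + 3 * T) + 1 / h ^ 2 * (D * endCount i)) := by
            refine mul_le_mul_of_nonneg_left ((abs_add_le _ _).trans (add_le_add e1 ?_))
              (by positivity)
            rw [abs_mul, abs_of_nonneg (by positivity)]
            gcongr
        _ = _ := by ring
    have b2 := p.gridNorm_le_of_forall_le hN (by positivity) (by positivity) b1
    rw [← hdef] at b2
    refine b2.trans (add_le_add ?_ ?_)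
    · calc l * (k ^ 2 / 4 * (C * (1 + 3 * T))) = l * (C * (1 + 3 * T) / 4 * k ^ 2) := by ring
        _ ≤ _ := by gcongr
    · calc 2 * √h * (k ^ 2 / 4 / h ^ 2 * D) = √h * (k ^ 2 / h ^ 2 * D) / 2 := by ring
        _ ≤ μ / 2 := by linarith
  -- At the end nodes the extra factor `k` comes from the slow variation of `α` and `β`. For the
  -- interior part the bound on `G` is enough, as `k²` is already present.
  have hdσb : ∀ j < n, gridNorm h (dσ j) ≤ k * (l * (C * (1 + 3 * T) / 2 * k) + μ / 2) := by
    intro j hj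
    have b1 : ∀ i, |dσ j i| ≤ k * (k / 2 * (C * (1 + 3 * T)))
        + k * (k ^ 2 / 4 / h ^ 2 * D) * endCount i := by
      intro i
      have e1 := (abs_sub _ _).trans (add_le_add (hGb i (j + 1) (hmem (j + 1) hj).2)
        (hGb i j (hmem j hj.le).2))
      have e2 := abs_endVector_le (hαk j hj) (hβk j hj) i
      have e3 : dσ j i = -(k ^ 2 / 4) * ((G i (j + 1) - G i j)
          + 1 / h ^ 2 * endVector (α (j + 1) - α j) (β (j + 1) - β j) i) := by
        simp only [dσ, σ, endVector]
        split_ifs <;> ring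
      rw [e3, abs_mul, abs_neg, abs_of_nonneg (by positivity)]
      calc _ ≤ k ^ 2 / 4 * (C * (1 + 3 * T) + C * (1 + 3 * T)
            + 1 / h ^ 2 * (D * k * endCount i)) := by
            refine mul_le_mul_of_nonneg_left ((abs_add_le _ _).trans (add_le_add e1 ?_))
              (by positivity)
            rw [abs_mul, abs_of_nonneg (by positivity)]
            gcongr
        _ = _ := by ring
    have b2 := p.gridNorm_le_of_forall_le hN (by positivity) (by positivity) b1
    rw [← hdef] at b2
    refine b2.trans ?_
    calc l * (k * (k / 2 * (C * (1 + 3 * T)))) + 2 * √h * (k * (k ^ 2 / 4 / h ^ 2 * D))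
        = k * (l * (C * (1 + 3 * T) / 2 * k) + √h * (k ^ 2 / h ^ 2 * D) / 2) := by ring
      _ ≤ _ := by gcongr
  have hτb : ∀ j < n, gridNorm h (τ j) ≤
      l * (k * (C * h + C * (C + 4) * (1 + 2 * T) * k)) := by
    intro j hj
    refine p.gridNorm_le_of_forall_node hN (by positivity) fun i => ?_
    have m0 := hmem j hj.le
    have m1 := hmem (j + 1) hj
    have c0 : |cons j i| ≤ C * h := hr.abs_discrete_laplacian_le hu hN m0 i
    have c1 : |cons (j + 1) i| ≤ C * h := hr.abs_discrete_laplacian_le hu hN m1 i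
    have u0 := hUb i j m0.2
    have u1 := hUb i (j + 1) m1.2
    push_cast at m1 u1
    have hx := p.node_mem hN i
    have hst : ((j : ℝ) + 1) * k - j * k = k := by ring
    have e2 := hr.lipschitz_u₂ _ hx _ m0 _ m1
    have e3 := hr.taylor_u₁ _ hx _ m0 _ m1
    rw [hst, abs_of_pos hk] at e2 e3
    rw [abs_sub_comm] at u0 u1
    have g0 := p.γ_nonneg _ hx
    have g1 := hr.γ_le _ hx
    have t1 : |k / 2 * (cons j i + cons (j + 1) i)| ≤ k * (C * h) := by
      rw [abs_mul, abs_of_pos (half_pos hk)]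
      calc _ ≤ k / 2 * (C * h + C * h) := by
            gcongr; exact (abs_add_le _ _).trans (add_le_add c0 c1)
        _ = _ := by ring
    have t2 : |k / 2 * p.γ (p.node N i) * ((u₁ (p.node N i) (j * k) - U i j)
        + (u₁ (p.node N i) ((j + 1) * k) - U i (j + 1)))| ≤ C * C * (1 + 2 * T) * k ^ 2 := by
      rw [abs_mul, abs_of_nonneg (by positivity)]
      calc _ ≤ k / 2 * C * (C * (1 + 2 * T) * k ^ 2 + C * (1 + 2 * T) * k ^ 2) := by
            gcongr; exact (abs_add_le _ _).trans (add_le_add u0 u1)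
        _ = k * (C * C * (1 + 2 * T) * k ^ 2) := by ring
        _ ≤ _ := mul_le_of_le_one_left (by positivity) hk1
    have t3 : |k / 2 * (u₂ (p.node N i) ((j + 1) * k) - u₂ (p.node N i) (j * k))|
        ≤ C * k ^ 2 := by
      rw [abs_mul, abs_of_pos (half_pos hk)]
      calc _ ≤ k / 2 * (C * k) := by gcongr
        _ ≤ _ := by nlinarith [mul_nonneg hC (sq_nonneg k)]
    have t4 : |τ j i| ≤ k * (C * h) + C * C * (1 + 2 * T) * k ^ 2 + C * k ^ 2 + C * k ^ 2
        + C * (1 + 2 * T) * k ^ 2 + C * (1 + 2 * T) * k ^ 2 :=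
      (abs_sub _ _).trans (add_le_add ((abs_add_le _ _).trans (add_le_add ((abs_add_le _ _).trans
        (add_le_add ((abs_sub _ _).trans (add_le_add ((abs_add_le _ _).trans
          (add_le_add t1 t2)) e3)) t3)) u1)) u0)
    have t5 : 0 ≤ C * k ^ 2 * T := by positivity
    calc |τ j i| ≤ _ := t4
      _ ≤ k * (C * h) + C * (C + 4) * (1 + 2 * T) * k ^ 2 := by nlinarith
      _ = _ := by ring
  -- The residual is exactly `0`: the means of `U` are the increments of `u`, and the means of `σ`
  -- are the increments of the forcing.
  have hQ : ∀ j < n, ∀ a, grad h (p.positionError u k V (j + 1)) a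
      - grad h (p.positionError u k V j) a
      = k / 2 * (grad h (P j) a + grad h (P (j + 1)) a) + 0 := by
    intro j hj a
    rw [← grad_add, ← grad_mul, add_zero, sub_eq_iff_eq_add', ← grad_add]
    congr 1
    funext i
    have e1 := hV.position_step j i
    have e2 := hσ j hj i
    have e3 := hU i j (hlt j hj)
    simp only [positionError, P]
    push_cast
    linear_combination e1 + e3 - k / 2 * e2
  have hP : ∀ j < n, ∀ i, P (j + 1) i - P j i = -(k / 2) *
      (gradAdj h (grad h (p.positionError u k V j)) i
        + gradAdj h (grad h (p.positionError u k V (j + 1))) i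
        + p.γ (p.node N i) * (P j i + P (j + 1) i)) + (dσ j i + τ j i) := by
    intro j hj i
    have e1 := hV.velocity_step j i
    have e2 : ∀ j : ℕ, gradAdj h (grad h (p.positionError u k V j)) i = _ := fun j =>
      gradAdj_grad_sub h (fun i => V j (Sum.inl i)) (fun i => u (p.node N i) (j * k)) i
    have e3 := hσ j hj i
    rw [e2, e2]
    rw [F_inr, F_inr, ← hdef] at e1 e3
    simp only [P, dσ, τ, cons]
    push_cast
    linear_combination e1 + k / 2 * p.γ (p.node N i) * e3
  have hρ : ∀ j < n, gridNorm h (fun i => dσ j i + τ j i)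
      + gridNorm h (fun _ : Fin (N - 1 + 1) => (0 : ℝ)) ≤
      k * (l * (C * (C + 6) * (1 + 3 * T) * (h + k)) + μ) := by
    intro j hj
    have e0 : gridNorm h (fun _ : Fin (N - 1 + 1) => (0 : ℝ)) = 0 := by simp [gridNorm]
    rw [e0, add_zero]
    refine (gridNorm_add_le hh.le _ _).trans ((add_le_add (hdσb j hj) (hτb j hj)).trans ?_)
    have e1 : C * (1 + 3 * T) / 2 * k + (C * h + C * (C + 4) * (1 + 2 * T) * k)
        ≤ C * (C + 6) * (1 + 3 * T) * (h + k) := by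
      have a1 : C * (C + 4) * (1 + 2 * T) * k ≤ C * (C + 4) * (1 + 3 * T) * k := by
        gcongr; norm_num
      have a2 : C * h ≤ C * (C + 6) * (1 + 3 * T) * h := by
        have b1 : C ≤ C * (C + 6) := le_mul_of_one_le_right hC (by linarith)
        have b2 : C * (C + 6) ≤ C * (C + 6) * (1 + 3 * T) :=
          le_mul_of_one_le_right (by positivity) (by linarith)
        gcongr
        linarith
      have a3 : 0 ≤ C * (1 + 3 * T) * k := by positivity
      nlinarith
    have e2 := mul_le_mul_of_nonneg_left e1 hl0
    calc _ = k * (l * (C * (1 + 3 * T) / 2 * k + (C * h + C * (C + 4) * (1 + 2 * T) * k))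
          + μ / 2) := by ring
      _ ≤ _ := by gcongr; linarith
  have hUe : ∀ j ≤ n, gridNorm h (fun i => U i j - u₁ (p.node N i) (j * k)) ≤
      l * (C * (1 + 2 * T) * k) := by
    intro j hj
    refine p.gridNorm_le_of_forall_node hN (by positivity) fun i => ?_
    exact (hUb i j (hmem j hj).2).trans (by gcongr)
  have hsum : l * (C * (1 + 3 * T) / 4 * k) + μ / 2 + l * (C * (1 + 2 * T) * k) ≤
      l * (C * (C + 6) * (1 + 3 * T) * (h + k)) + μ := by
    have e1 : C * (1 + 3 * T) / 4 * k + C * (1 + 2 * T) * k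
        ≤ C * (C + 6) * (1 + 3 * T) * (h + k) := by
      have a1 : C * (1 + 2 * T) * k ≤ C * (1 + 3 * T) * k := by gcongr; norm_num
      have a2 : 0 ≤ C * (C + 6) * (1 + 3 * T) * h := by positivity
      have a3 : 0 ≤ C * (1 + 3 * T) * k := by positivity
      have a4 : 0 ≤ C * (C * (1 + 3 * T) * k) := by positivity
      nlinarith
    have e2 := mul_le_mul_of_nonneg_left e1 hl0
    linarith
  have hP0 : gridNorm h (P 0) ≤ l * (C * (C + 6) * (1 + 3 * T) * (h + k)) + μ := by
    have e1 : P 0 = fun i => σ 0 i - (U i 0 - u₁ (p.node N i) ((0 : ℕ) * k)) := by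
      funext i
      have e1 : V 0 (Sum.inr i) = p.ψ (p.node N i) := by rw [hV.1]; rfl
      have e2 := hr.derivWithin_eq _ (p.node_mem hN i) 0 ⟨le_rfl, hT⟩
      rw [hu.initial_velocity _ (p.node_mem hN i)] at e2
      simp only [P, e1, e2]
      simp
      ring
    rw [e1]
    refine (gridNorm_sub_le hh.le (σ 0) _).trans ?_
    exact (add_le_add (hσb 0 (Nat.zero_le n)) (hUe 0 (Nat.zero_le n))).trans hsum
  have hQ0 : gridNorm h (grad h (p.positionError u k V 0)) = 0 := by
    have e0 : p.positionError u k V 0 = fun _ => 0 := by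
      funext i
      have e1 : V 0 (Sum.inl i) = p.φ (p.node N i) := by rw [hV.1]; rfl
      simp [positionError, e1, hu.initial_position _ (p.node_mem hN i)]
    rw [e0]
    simp [gridNorm, grad, leftEnd, rightEnd]
  have hvel : p.velocityError T u k V n = fun i => P n i - (σ n i
      - (U i n - u₁ (p.node N i) (n * k))) := by
    funext i
    simp only [velocityError, P, hr.derivWithin_eq _ (p.node_mem hN i) _ (hmem n le_rfl)]
    ring
  clear_value P dσ τ σ cons
  have key := gridNorm_le_of_crankNicolson hh.le hk.le (γ := fun i => p.γ (p.node N i))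
    (fun i => p.γ_nonneg _ (p.node_mem hN i)) hP hQ hρ
  have key2 : gridNorm h (Sum.elim (P n) (grad h (p.positionError u k V n))) ≤
      (1 + T) * (l * (C * (C + 6) * (1 + 3 * T) * (h + k)) + μ) := by
    refine key.trans ?_
    rw [hQ0, ← mul_assoc (n : ℝ), add_mul, one_mul, add_zero]
    gcongr
  refine ⟨(gridNorm_le_sumElim_right hh.le _ _).trans key2, ?_⟩
  rw [hvel]
  have e2 := (gridNorm_le_sumElim_left hh.le _ _).trans key2
  have e3 := gridNorm_sub_le hh.le (σ n) (fun i => U i n - u₁ (p.node N i) (n * k))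
  have e4 := (e3.trans (add_le_add (hσb n le_rfl) (hUe n le_rfl))).trans hsum
  refine (gridNorm_sub_le hh.le _ _).trans ((add_le_add e2 e4).trans (le_of_eq ?_))
  ring

end DampedWave

end

noncomputable section

/-! ### Stability in a weaker norm -/

/-- The primitive of a grid function, with value `0` on the first edge. -/
def primitive {m : ℕ} (h : ℝ) (x : Fin m → ℝ) (j : Fin (m + 1)) : ℝ :=
  h * ∑ i : Fin m, if (i : ℕ) < j then x i else 0

/-- Inverts the adjoint difference, so that a bounded source of the momentum equation can be passed
to the equation for `q`. -/
theorem gradAdj_primitive {m : ℕ} {h : ℝ} (hh : h ≠ 0) (x : Fin m → ℝ) (i : Fin m) :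
    gradAdj h (primitive h x) i = -x i := by
  have h1 : ∀ l : Fin m, (if (l : ℕ) < (i.succ : Fin (m + 1)) then x l else 0)
      = (if (l : ℕ) < (i.castSucc : Fin (m + 1)) then x l else 0) + if i = l then x l else 0 := by
    intro l
    rcases lt_trichotomy l i with hl | hl | hl
    · have e1 : (l : ℕ) < i := hl
      have e2 : (l : ℕ) < i + 1 := by omega
      simp [e1, e2, hl.ne']
    · subst hl; simp
    · have e0 : (i : ℕ) < l := hl
      have e1 : ¬ (l : ℕ) < i := by omega
      have e2 : ¬ (l : ℕ) < i + 1 := by omega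
      simp [e1, e2, hl.ne]
  rw [gradAdj, primitive, primitive, Finset.sum_congr rfl fun l _ => h1 l, Finset.sum_add_distrib,
    Finset.sum_ite_eq, if_pos (Finset.mem_univ _)]
  field_simp
  ring

theorem abs_primitive_le {m : ℕ} {h c l : ℝ} (hh : 0 ≤ h) (hc : 0 ≤ c) (hl : h * (m + 1) ≤ l)
    {x : Fin m → ℝ} (hx : ∀ i, |x i| ≤ c) (j : Fin (m + 1)) : |primitive h x j| ≤ l * c := by
  have h1 : |∑ i : Fin m, if (i : ℕ) < j then x i else 0| ≤ ∑ _i : Fin m, c := by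
    refine (Finset.abs_sum_le_sum_abs _ _).trans (Finset.sum_le_sum fun i _ => ?_)
    split_ifs
    · exact hx i
    · simpa using hc
  rw [Finset.sum_const, Finset.card_univ, Fintype.card_fin, nsmul_eq_mul] at h1
  rw [primitive, abs_mul, abs_of_nonneg hh]
  calc _ ≤ h * (m * c) := by gcongr
    _ ≤ h * (m + 1) * c := by nlinarith [mul_nonneg hh hc]
    _ ≤ l * c := by gcongr

theorem gradAdj_grad_add {m : ℕ} (h : ℝ) (v w : Fin m → ℝ) (i : Fin m) :
    gradAdj h (grad h fun j => v j + w j) i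
      = gradAdj h (grad h v) i + gradAdj h (grad h w) i := by
  simp only [gradAdj_grad, leftEnd, rightEnd]
  split_ifs <;> ring

theorem gradAdj_grad_mul {m : ℕ} (h c : ℝ) (v : Fin m → ℝ) (i : Fin m) :
    gradAdj h (grad h fun j => c * v j) i = c * gradAdj h (grad h v) i := by
  simp only [gradAdj_grad, leftEnd, rightEnd]
  split_ifs <;> ring

/-- Stability of the trapezoidal rule for `p' = y - Γp`, `y' = -D*Dp`, where `y` and the part
`-D*s'` of its source are only measured in a negative norm. -/
theorem gridNorm_le_of_crankNicolson_dual {m : ℕ} {h k l c ρ : ℝ} (hh : 0 < h) (hk : 0 ≤ k)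
    (hl : h * (m + 1) ≤ l) (hc : 0 ≤ c) {γ : Fin m → ℝ} (hγ : ∀ i, 0 ≤ γ i)
    {p y r f : ℕ → Fin m → ℝ} {s : ℕ → Fin (m + 1) → ℝ} {n : ℕ}
    (hp : ∀ j < n, ∀ i, p (j + 1) i - p j i =
      k / 2 * (y j i + y (j + 1) i - γ i * (p j i + p (j + 1) i)) + r j i)
    (hy : ∀ j < n, ∀ i, y (j + 1) i - y j i =
      -(k / 2) * (gradAdj h (grad h (p j)) i + gradAdj h (grad h (p (j + 1))) i) + f j i
        - (gradAdj h (s (j + 1)) i - gradAdj h (s j) i))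
    (hy0 : ∀ i, y 0 i = -gradAdj h (s 0) i) (hf : ∀ j < n, ∀ i, |f j i| ≤ c)
    (hρ : ∀ j < n, gridNorm h (r j) + gridNorm h (fun a => s (j + 1) a - s j a) ≤ ρ) :
    gridNorm h (p n) ≤ gridNorm h (p 0) + gridNorm h (s 0) + n * (ρ + √l * (l * c)) := by
  -- `q` is built by accumulating its own trapezoidal equation from `s 0`, so that `y = -D*q`
  -- follows by induction. The pair `(p, q)` then solves the system of the energy estimate.
  let q : ℕ → Fin (m + 1) → ℝ := fun j a => s j a + ∑ i ∈ Finset.range j,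
    (k / 2 * (grad h (p i) a + grad h (p (i + 1)) a) + primitive h (f i) a)
  have hq : ∀ j < n, ∀ a, q (j + 1) a - q j a =
      k / 2 * (grad h (p j) a + grad h (p (j + 1)) a)
        + ((s (j + 1) a - s j a) + primitive h (f j) a) := by
    intro j _ a
    simp only [q, Finset.sum_range_succ]
    ring
  have hqy : ∀ j ≤ n, ∀ i, y j i = -gradAdj h (q j) i := by
    intro j
    induction j with
    | zero => intro _ i; simp [hy0, q, gradAdj]
    | succ j ih =>
      intro hj i
      have e1 := ih (by omega) i
      have e2 := hy j hj i
      have e3 := gradAdj_primitive hh.ne' (f j) i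
      have e4 := hq j hj i.castSucc
      have e5 := hq j hj i.succ
      simp only [gradAdj] at *
      rw [← sub_eq_zero]
      linear_combination e1 + e2 + e3 + (e4 - e5) / h
  have hp' : ∀ j < n, ∀ i, p (j + 1) i - p j i =
      -(k / 2) * (gradAdj h (q j) i + gradAdj h (q (j + 1)) i + γ i * (p j i + p (j + 1) i))
        + r j i := by
    intro j hj i
    rw [hp j hj i, hqy j hj.le i, hqy (j + 1) hj i]
    ring
  have hρ' : ∀ j < n, gridNorm h (r j)
      + gridNorm h (fun a => (s (j + 1) a - s j a) + primitive h (f j) a)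
      ≤ ρ + √l * (l * c) := by
    intro j hj
    have hl0 : 0 ≤ l := le_trans (by positivity) hl
    have e1 := gridNorm_add_le hh.le (fun a => s (j + 1) a - s j a) (primitive h (f j))
    have e2 : gridNorm h (primitive h (f j)) ≤ √l * (l * c) :=
      gridNorm_le_of_abs_le hh.le (by positivity)
        (by rw [Fintype.card_fin]; push_cast; exact hl)
        (abs_primitive_le hh.le hc hl (hf j hj))
    linarith [hρ j hj]
  have hq0 : q 0 = s 0 := by funext a; simp [q]
  have key := gridNorm_le_of_crankNicolson hh.le hk hγ hp' hq hρ'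
  rw [hq0] at key
  exact (gridNorm_le_sumElim_left hh.le _ _).trans key

/-! ### Profiles concentrated near the ends of the mesh -/

/-- The unit load at the first node is the discrete Laplacian of the sum of a profile with small
norm and one with a controlled gradient. -/
theorem exists_left_profiles (m : ℕ) {h ν : ℝ} (hh : 0 < h) (hν : 0 < ν) :
    ∃ X Y : Fin m → ℝ,
      (∀ i : Fin m, gradAdj h (grad h X) i + gradAdj h (grad h Y) i
        = if (i : ℕ) = 0 then 1 / h ^ 2 else 0) ∧
      gridNorm h Y ≤ √ν ∧ gridNorm h (grad h X) ≤ √(2 / ν + 2 / (h * (m + 1))) := by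
  -- A discrete exponential layer of width about `ν`: this ratio satisfies `h r / (1 - r) = ν`,
  -- which bounds `‖Y‖²`, and `1 - r ≤ h / ν`, which bounds the gradient of `X`.
  set r : ℝ := ν / (ν + h) with hr
  have hr0 : 0 ≤ r := by positivity
  have hr1 : 1 - r = h / (ν + h) := by rw [hr]; field_simp; ring
  have hr2 : 1 - r ≤ h / ν := by rw [hr1]; gcongr; linarith
  have hr3 : r ≤ 1 := by
    have : 0 ≤ 1 - r := by rw [hr1]; positivity
    linarith
  have hpow : ∀ j : ℕ, 0 ≤ r ^ j ∧ r ^ j ≤ 1 := fun j =>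
    ⟨pow_nonneg hr0 j, pow_le_one₀ hr0 hr3⟩
  have hgeom : ∀ n : ℕ, (1 - r) * ∑ i : Fin n, r ^ (i : ℕ) ≤ 1 := fun n => by
    rw [Fin.sum_univ_eq_sum_range (fun i => r ^ i), mul_neg_geom_sum]
    linarith [(hpow n).1]
  -- `X + Y = c` is linear, hence without second difference inside; the only load comes from the end
  -- value `Y 0 = 1`, which extension by zero drops. The factor `c` makes both profiles vanish at
  -- the far end.
  let c : ℕ → ℝ := fun j => 1 - j / (m + 1)
  have hc : ∀ j : ℕ, j ≤ m + 1 → 0 ≤ c j ∧ c j ≤ 1 := fun j hj => by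
    have e1 : (j : ℝ) ≤ m + 1 := by exact_mod_cast hj
    have e2 : (j : ℝ) / (m + 1) ≤ 1 := by rw [div_le_one (by positivity)]; exact e1
    have e3 : 0 ≤ (j : ℝ) / (m + 1) := by positivity
    constructor <;> simp only [c] <;> linarith
  let X : ℕ → ℝ := fun j => c j * (1 - r ^ j)
  let Y : ℕ → ℝ := fun j => c j * r ^ j
  have hc1 : c (m + 1) = 0 := by
    simp only [c]; push_cast; rw [div_self (by positivity)]; ring
  have hX0 : X 0 = 0 := by simp [X]
  have hX1 : X (m + 1) = 0 := by simp [X, hc1]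
  refine ⟨fun i => X (i + 1), fun i => Y (i + 1), fun i => ?_, ?_, ?_⟩
  · have hY0 : Y 0 = 1 := by simp [Y, c]
    have hY1 : Y (m + 1) = 0 := by simp [Y, hc1]
    have hlin : X (i + 2) - 2 * X (i + 1) + X i + (Y (i + 2) - 2 * Y (i + 1) + Y i) = 0 := by
      simp only [X, Y, c]; push_cast; ring
    rw [gradAdj_grad_restrict, gradAdj_grad_restrict, hX0, hX1, hY0, hY1]
    have : X (i + 2) - 2 * X (i + 1) + X i = -(Y (i + 2) - 2 * Y (i + 1) + Y i) := by linarith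
    rw [this]
    split_ifs <;> ring
  · refine Real.sqrt_le_sqrt ?_
    have e1 : ∑ i : Fin m, Y (i + 1) ^ 2 ≤ r * ∑ i : Fin m, r ^ (i : ℕ) := by
      rw [Finset.mul_sum]
      refine Finset.sum_le_sum fun i _ => ?_
      have a1 := hc (i + 1) (by omega)
      have a2 := hpow (i + 1)
      have a3 : 0 ≤ Y (i + 1) := mul_nonneg a1.1 a2.1
      have a4 : Y (i + 1) ≤ r ^ ((i : ℕ) + 1) := mul_le_of_le_one_left a2.1 a1.2
      calc Y (i + 1) ^ 2 = Y (i + 1) * Y (i + 1) := sq _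
        _ ≤ r ^ ((i : ℕ) + 1) * 1 := mul_le_mul a4 (a4.trans a2.2) a3 a2.1
        _ = _ := by ring
    have e2 : h * r = ν * (1 - r) := by rw [hr1, hr]; field_simp
    calc h * ∑ i : Fin m, Y (i + 1) ^ 2 ≤ h * (r * ∑ i : Fin m, r ^ (i : ℕ)) := by gcongr
      _ = ν * ((1 - r) * ∑ i : Fin m, r ^ (i : ℕ)) := by rw [← mul_assoc, e2]; ring
      _ ≤ ν * 1 := by gcongr; exact hgeom m
      _ = ν := mul_one ν
  · refine Real.sqrt_le_sqrt ?_
    have e1 : ∀ j : Fin (m + 1), grad h (fun i : Fin m => X (i + 1)) j ^ 2 ≤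
        2 / h ^ 2 * ((1 - r) * (1 - r) * r ^ (j : ℕ) + 1 / (m + 1) ^ 2) := by
      intro j
      rw [grad_restrict h X hX0 hX1, div_pow, div_mul_eq_mul_div]
      have a1 := hc (j + 1) (by omega)
      have a2 := hpow j
      -- Discrete product rule: a geometrically decaying term from the layer, and a small term from
      -- the slope of `c`.
      have a3 : X (j + 1) - X j = c (j + 1) * ((1 - r) * r ^ (j : ℕ))
          - 1 / (m + 1) * (1 - r ^ (j : ℕ)) := by
        simp only [X, c]; push_cast; ring
      have a4 : (c (j + 1) * ((1 - r) * r ^ (j : ℕ))) ^ 2 ≤ (1 - r) * (1 - r) * r ^ (j : ℕ) := by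
        have b1 : c (j + 1) ^ 2 ≤ 1 := pow_le_one₀ a1.1 a1.2
        have b2 : (r ^ (j : ℕ)) ^ 2 ≤ r ^ (j : ℕ) := pow_le_of_le_one a2.1 a2.2 two_ne_zero
        calc _ = c (j + 1) ^ 2 * ((1 - r) * (1 - r) * (r ^ (j : ℕ)) ^ 2) := by ring
          _ ≤ 1 * ((1 - r) * (1 - r) * r ^ (j : ℕ)) := by
            have := mul_self_nonneg (1 - r)
            gcongr
          _ = _ := one_mul _
      have a5 : (1 / (m + 1 : ℝ) * (1 - r ^ (j : ℕ))) ^ 2 ≤ 1 / (m + 1) ^ 2 := by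
        have b1 : (1 - r ^ (j : ℕ)) ^ 2 ≤ 1 := pow_le_one₀ (by linarith) (by linarith)
        calc _ = 1 / (m + 1 : ℝ) ^ 2 * (1 - r ^ (j : ℕ)) ^ 2 := by rw [mul_pow, div_pow, one_pow]
          _ ≤ 1 / (m + 1 : ℝ) ^ 2 * 1 := by gcongr
          _ = _ := mul_one _
      gcongr
      rw [a3]
      nlinarith [sq_nonneg (c (j + 1) * ((1 - r) * r ^ (j : ℕ)) + 1 / (m + 1) * (1 - r ^ (j : ℕ)))]
    have e2 : ∑ j : Fin (m + 1), grad h (fun i : Fin m => X (i + 1)) j ^ 2 ≤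
        2 / h ^ 2 * ((1 - r) * ((1 - r) * ∑ j : Fin (m + 1), r ^ (j : ℕ)) + 1 / (m + 1)) := by
      refine (Finset.sum_le_sum fun j _ => e1 j).trans (le_of_eq ?_)
      rw [← Finset.mul_sum, Finset.sum_add_distrib, ← Finset.mul_sum, Finset.sum_const,
        Finset.card_univ, Fintype.card_fin, nsmul_eq_mul]
      push_cast
      field_simp
    calc h * ∑ j : Fin (m + 1), grad h (fun i : Fin m => X (i + 1)) j ^ 2
        ≤ h * (2 / h ^ 2 * ((1 - r) * 1 + 1 / (m + 1))) := by
          refine mul_le_mul_of_nonneg_left (e2.trans ?_) hh.le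
          have : 0 ≤ 1 - r := by linarith
          gcongr
          exact hgeom (m + 1)
      _ ≤ h * (2 / h ^ 2 * (h / ν * 1 + 1 / (m + 1))) := by gcongr
      _ = _ := by field_simp

theorem leftEnd_comp_rev {m : ℕ} (v : Fin m → ℝ) (j : Fin (m + 1)) :
    leftEnd (fun i => v i.rev) j = rightEnd v j.rev := by
  by_cases hj : 0 < (j : ℕ)
  · have h1 : ((j.rev : Fin (m + 1)) : ℕ) < m := by rw [Fin.val_rev]; omega
    rw [leftEnd, rightEnd, dif_pos hj, dif_pos h1]
    congr 1
    ext
    simp only [Fin.val_rev]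
    omega
  · have h1 : ¬ ((j.rev : Fin (m + 1)) : ℕ) < m := by rw [Fin.val_rev]; omega
    rw [leftEnd, rightEnd, dif_neg hj, dif_neg h1]

theorem grad_comp_rev {m : ℕ} (h : ℝ) (v : Fin m → ℝ) (j : Fin (m + 1)) :
    grad h (fun i => v i.rev) j = -grad h v j.rev := by
  have h1 := leftEnd_comp_rev v j
  have h2 := leftEnd_comp_rev (fun i => v i.rev) j.rev
  simp only [Fin.rev_rev] at h2
  rw [grad, grad, h1, ← h2]
  ring

theorem gradAdj_grad_comp_rev {m : ℕ} (h : ℝ) (v : Fin m → ℝ) (i : Fin m) :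
    gradAdj h (grad h fun i : Fin m => v i.rev) i = gradAdj h (grad h v) i.rev := by
  rw [gradAdj, gradAdj, grad_comp_rev, grad_comp_rev, Fin.rev_castSucc, Fin.rev_succ]
  ring

theorem gridNorm_comp_rev {m : ℕ} (h : ℝ) (x : Fin m → ℝ) :
    gridNorm h (fun i : Fin m => x i.rev) = gridNorm h x := by
  rw [gridNorm, gridNorm]
  congr 2
  exact Equiv.sum_comp Fin.revPerm fun i => x i ^ 2

theorem exists_right_profiles (m : ℕ) {h ν : ℝ} (hh : 0 < h) (hν : 0 < ν) :
    ∃ X Y : Fin m → ℝ,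
      (∀ i : Fin m, gradAdj h (grad h X) i + gradAdj h (grad h Y) i
        = if (i : ℕ) + 1 = m then 1 / h ^ 2 else 0) ∧
      gridNorm h Y ≤ √ν ∧ gridNorm h (grad h X) ≤ √(2 / ν + 2 / (h * (m + 1))) := by
  obtain ⟨X, Y, h1, h2, h3⟩ := exists_left_profiles m hh hν
  refine ⟨fun i => X i.rev, fun i => Y i.rev, fun i => ?_, ?_, ?_⟩
  · rw [gradAdj_grad_comp_rev, gradAdj_grad_comp_rev, h1]
    have : ((i.rev : Fin m) : ℕ) = 0 ↔ (i : ℕ) + 1 = m := by rw [Fin.val_rev]; omega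
    simp only [this]
  · rwa [gridNorm_comp_rev]
  · have : grad h (fun i : Fin m => X i.rev) = fun j => (-1) * grad h X j.rev := by
      funext j; rw [grad_comp_rev]; ring
    rw [this, gridNorm_mul hh.le, abs_neg, abs_one, one_mul, gridNorm_comp_rev]
    exact h3

end

/-! ### Mean-square convergence of FD-(1,1) without a relation between the step sizes -/

noncomputable section

theorem gridNorm_combination_le {ι : Type*} [Fintype ι] {h : ℝ} (hh : 0 ≤ h) {a b A N : ℝ}
    {x y : ι → ℝ} (ha : |a| ≤ A) (hb : |b| ≤ A) (hx : gridNorm h x ≤ N) (hy : gridNorm h y ≤ N) :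
    gridNorm h (fun i => a * x i + b * y i) ≤ 2 * (A * N) := by
  have h1 := gridNorm_add_le hh (fun i => a * x i) (fun i => b * y i)
  rw [gridNorm_mul hh, gridNorm_mul hh] at h1
  have hA := (abs_nonneg a).trans ha
  have h2 := mul_le_mul ha hx (gridNorm_nonneg h x) hA
  have h3 := mul_le_mul hb hy (gridNorm_nonneg h y) hA
  linarith

namespace DampedWave

/-- Midpoint velocities at a boundary point, as in `Regular.exists_midpoint_velocity`, together with
the bounds that they satisfy for `k ≤ 1`. -/
theorem Regular.exists_boundary_velocity {p : DampedWave} {T : ℝ} {u u₁ u₂ u₃ g₁ : ℝ → ℝ → ℝ}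
    {C : ℝ} (hr : p.Regular T u u₁ u₂ u₃ g₁ C) {x : ℝ} (hx : x ∈ Set.Icc p.a p.b)
    {φ : ℝ → ℝ} (hφ : ∀ t ∈ Set.Icc 0 T, u x t = φ t) {k : ℝ} (hk : 0 < k) (hk1 : k ≤ 1) :
    ∃ α : ℕ → ℝ,
      (∀ n : ℕ, (n + 1) * k ≤ T → k / 2 * (α n + α (n + 1)) = φ ((n + 1) * k) - φ (n * k)) ∧
      (∀ n : ℕ, n * k ≤ T → |α n| ≤ C * (3 + 4 * T)) ∧
      ∀ n : ℕ, (n + 1) * k ≤ T → |α (n + 1) - α n| ≤ C * (3 + 4 * T) * k := by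
  obtain ⟨α, h1, h2⟩ := hr.exists_midpoint_velocity hx hk
  have hC := hr.nonneg
  have hk2 : k ^ 2 ≤ k := by nlinarith
  have hT : ∀ {s : ℝ} {n : ℕ}, n * k ≤ s → 0 ≤ s := fun h => le_trans (by positivity) h
  refine ⟨α, fun n hn => ?_, fun n hn => ?_, fun n hn => ?_⟩
  · have hn' : n * k ≤ T := by nlinarith
    rw [h1 n hn, hφ _ ⟨by positivity, hn⟩, hφ _ ⟨by positivity, hn'⟩]
  · have hT0 := hT hn
    have e1 := hr.abs_u₁_le x hx (n * k) ⟨by positivity, hn⟩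
    have e2 := h2 n hn
    have e3 : C * (1 + 2 * T) * k ^ 2 ≤ C * (1 + 2 * T) * 1 := by gcongr; linarith
    have e4 : |α n| ≤ |α n - u₁ x (n * k)| + |u₁ x (n * k)| := by
      simpa using abs_add_le (α n - u₁ x (n * k)) (u₁ x (n * k))
    nlinarith [mul_nonneg hC hT0]
  · have hn' : n * k ≤ T := by nlinarith
    have hT0 := hT hn'
    have e1 := hr.lipschitz_u₁ x hx (n * k) ⟨by positivity, hn'⟩ ((n + 1) * k) ⟨by positivity, hn⟩
    rw [show ((n : ℝ) + 1) * k - n * k = k by ring, abs_of_pos hk] at e1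
    have e2 := h2 n hn'
    have e3 := h2 (n + 1) (by push_cast; exact hn)
    push_cast at e3
    have e4 : C * (1 + 2 * T) * k ^ 2 ≤ C * (1 + 2 * T) * k := by gcongr
    have e5 : α (n + 1) - α n = (α (n + 1) - u₁ x ((n + 1) * k))
        + (u₁ x ((n + 1) * k) - u₁ x (n * k)) - (α n - u₁ x (n * k)) := by ring
    rw [e5]
    refine (abs_sub _ _).trans ((add_le_add ((abs_add_le _ _).trans (add_le_add e3 e1)) e2).trans ?_)
    linarith

/-- The system for the position error `e` and the momentum error `η`, in which the only source
that is not small in `L²` is the second difference in time of the boundary load. -/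
theorem Regular.fd11_momentum_system {p : DampedWave} {T : ℝ} {u u₁ u₂ u₃ g₁ : ℝ → ℝ → ℝ}
    {C : ℝ} (hr : p.Regular T u u₁ u₂ u₃ g₁ C) (hu : p.IsSolution T u)
    {N : ℕ} (hN : 2 ≤ N) {k : ℝ} (hk : 0 < k) (hk1 : k ≤ 1)
    {V : ℕ → Grid N} (hV : p.IsFD11 N k V) {n : ℕ} (hn : n * k ≤ T) :
    ∃ η x f : ℕ → Fin (N - 1) → ℝ,
      (∀ i, p.positionError u k V 0 i = 0) ∧ (∀ i, η 0 i = 0) ∧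
      (∀ j < n, ∀ i, p.positionError u k V (j + 1) i - p.positionError u k V j i =
        k / 2 * (η j i + η (j + 1) i
          - p.γ (p.node N i) * (p.positionError u k V j i + p.positionError u k V (j + 1) i))
        - k ^ 2 / 4 * (1 / p.h N ^ 2
          * (p.boundaryVector N ((j + 1) * k) i - p.boundaryVector N (j * k) i)) + x j i) ∧
      (∀ j < n, ∀ i, η (j + 1) i - η j i =
        -(k / 2) * (gradAdj (p.h N) (grad (p.h N) (p.positionError u k V j)) i
          + gradAdj (p.h N) (grad (p.h N) (p.positionError u k V (j + 1))) i) + f j i) ∧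
      (∀ j < n, ∀ i, |x j i| ≤ 3 * C * k ^ 2) ∧
      ∀ j < n, ∀ i, |f j i| ≤ k * (C * p.h N + 2 * C * (1 + C) * k) := by
  have hC := hr.nonneg
  have hT : 0 ≤ T := le_trans (by positivity) hn
  have hmem : ∀ j ≤ n, (j : ℝ) * k ∈ Set.Icc 0 T := fun j hj =>
    ⟨by positivity, le_trans (by gcongr) hn⟩
  set h := p.h N with hdef
  have hh : 0 < h := p.h_pos hN
  let cons : ℕ → Fin (N - 1) → ℝ := fun j i =>
    -gradAdj h (grad h fun j' => u (p.node N j') (j * k)) i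
      + 1 / h ^ 2 * p.boundaryVector N (j * k) i
      - (u₂ (p.node N i) (j * k) + p.γ (p.node N i) * u₁ (p.node N i) (j * k)
        - p.g (p.node N i) (j * k))
  -- Adding `γe` to the velocity error moves the damping into the position equation. The boundary
  -- increment cancels from the momentum equation along with it, leaving a discrete divergence plus
  -- a small bounded source.
  refine ⟨fun j i => V j (Sum.inr i) - u₁ (p.node N i) (j * k)
      + p.γ (p.node N i) * p.positionError u k V j i,
    fun j i => k / 2 * (u₁ (p.node N i) ((j + 1) * k) - u₁ (p.node N i) (j * k))
      - (u (p.node N i) ((j + 1) * k) - u (p.node N i) (j * k) - k * u₁ (p.node N i) (j * k))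
      - k ^ 2 / 4 * (p.g (p.node N i) ((j + 1) * k) - p.g (p.node N i) (j * k)),
    fun j i => k / 2 * (cons j i + cons (j + 1) i)
      + k / 2 * (u₂ (p.node N i) ((j + 1) * k) - u₂ (p.node N i) (j * k))
      - (u₁ (p.node N i) ((j + 1) * k) - u₁ (p.node N i) (j * k) - k * u₂ (p.node N i) (j * k))
      + p.γ (p.node N i) * (k / 2 * (u₁ (p.node N i) ((j + 1) * k) - u₁ (p.node N i) (j * k))
      - (u (p.node N i) ((j + 1) * k) - u (p.node N i) (j * k) - k * u₁ (p.node N i) (j * k))),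
    fun i => ?_, fun i => ?_, fun j hj i => ?_, fun j hj i => ?_, fun j hj i => ?_,
    fun j hj i => ?_⟩
  · have e1 : V 0 (Sum.inl i) = p.φ (p.node N i) := by rw [hV.1]; rfl
    simp [positionError, e1, hu.initial_position _ (p.node_mem hN i)]
  · have e1 : V 0 (Sum.inl i) = p.φ (p.node N i) := by rw [hV.1]; rfl
    have e2 : V 0 (Sum.inr i) = p.ψ (p.node N i) := by rw [hV.1]; rfl
    have e3 := hr.derivWithin_eq _ (p.node_mem hN i) 0 ⟨le_rfl, hT⟩
    rw [hu.initial_velocity _ (p.node_mem hN i)] at e3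
    simp [positionError, e1, e2, e3, hu.initial_position _ (p.node_mem hN i)]
  · have e1 := hV.position_step j i
    rw [F_inr, F_inr, ← hdef] at e1
    simp only [positionError]
    push_cast
    linear_combination e1
  · have e1 := hV.velocity_step j i
    have e2 := hV.position_step j i
    have e3 : ∀ j : ℕ, gradAdj h (grad h (p.positionError u k V j)) i = _ := fun j =>
      gradAdj_grad_sub h (fun i => V j (Sum.inl i)) (fun i => u (p.node N i) (j * k)) i
    rw [e3, e3]
    rw [F_inr, F_inr, ← hdef] at e1 e2
    simp only [positionError, cons]
    push_cast
    linear_combination e1 + p.γ (p.node N i) * e2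
  all_goals
    have hx := p.node_mem hN i
    have m0 := hmem j hj.le
    have m1 := hmem (j + 1) hj
    have c0 : |cons j i| ≤ C * h := hr.abs_discrete_laplacian_le hu hN m0 i
    have c1 : |cons (j + 1) i| ≤ C * h := hr.abs_discrete_laplacian_le hu hN m1 i
    push_cast at m1
    have hst : ((j : ℝ) + 1) * k - j * k = k := by ring
    have e1 := hr.lipschitz_u₁ _ hx _ m0 _ m1
    have e2 := hr.taylor_u _ hx _ m0 _ m1
    have e3 := hr.lipschitz_g _ hx _ m0 _ m1
    have e4 := hr.lipschitz_u₂ _ hx _ m0 _ m1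
    have e5 := hr.taylor_u₁ _ hx _ m0 _ m1
    rw [hst, abs_of_pos hk] at e1 e2 e3 e4 e5
    have t1 : |k / 2 * (u₁ (p.node N i) ((j + 1) * k) - u₁ (p.node N i) (j * k))|
        ≤ C * k ^ 2 := by
      rw [abs_mul, abs_of_pos (half_pos hk)]
      calc _ ≤ k / 2 * (C * k) := by gcongr
        _ ≤ _ := by nlinarith [mul_nonneg hC (sq_nonneg k)]
    have t2 := (abs_sub _ _).trans (add_le_add t1 e2)
  · have t3 : |k ^ 2 / 4 * (p.g (p.node N i) ((j + 1) * k) - p.g (p.node N i) (j * k))|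
        ≤ C * k ^ 2 := by
      rw [abs_mul, abs_of_nonneg (by positivity)]
      calc _ ≤ k ^ 2 / 4 * (C * 1) := by gcongr; exact e3.trans (by gcongr)
        _ ≤ _ := by nlinarith [mul_nonneg hC (sq_nonneg k)]
    exact (abs_sub _ _).trans ((add_le_add t2 t3).trans (by linarith))
  · have t3 : |k / 2 * (u₂ (p.node N i) ((j + 1) * k) - u₂ (p.node N i) (j * k))|
        ≤ C * k ^ 2 := by
      rw [abs_mul, abs_of_pos (half_pos hk)]
      calc _ ≤ k / 2 * (C * k) := by gcongr
        _ ≤ _ := by nlinarith [mul_nonneg hC (sq_nonneg k)]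
    have t4 : |k / 2 * (cons j i + cons (j + 1) i)| ≤ k * (C * h) := by
      rw [abs_mul, abs_of_pos (half_pos hk)]
      calc _ ≤ k / 2 * (C * h + C * h) := by
            gcongr; exact (abs_add_le _ _).trans (add_le_add c0 c1)
        _ = _ := by ring
    have t5 : |p.γ (p.node N i) * (k / 2 * (u₁ (p.node N i) ((j + 1) * k)
        - u₁ (p.node N i) (j * k)) - (u (p.node N i) ((j + 1) * k) - u (p.node N i) (j * k)
          - k * u₁ (p.node N i) (j * k)))| ≤ C * (C * k ^ 2 + C * k ^ 2) := by
      rw [abs_mul, abs_of_nonneg (p.γ_nonneg _ hx)]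
      exact mul_le_mul (hr.γ_le _ hx) t2 (abs_nonneg _) hC
    refine (abs_add_le _ _).trans ((add_le_add ((abs_sub _ _).trans (add_le_add
      ((abs_add_le _ _).trans (add_le_add t4 t3)) e5)) t5).trans (le_of_eq ?_))
    ring

/-- Scalar sequences that split the effect of a boundary value into a smooth part `α` and a part
`a` starting from rest, with the alternating sums `c` of the increments of the latter. -/
theorem exists_split_sequences {α : ℕ → ℝ} {D k T : ℝ} (hk : 0 < k) {n : ℕ} (hn : n * k ≤ T)
    (hα : ∀ j ≤ n, |α j| ≤ D) :
    ∃ a c : ℕ → ℝ, a 0 = 0 ∧ c 0 = 0 ∧ (∀ j, a j + a (j + 1) = α j + α (j + 1)) ∧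
      (∀ j, c j + c (j + 1) = k / 2 * (a (j + 1) - a j)) ∧ ∀ j ≤ n, |c j| ≤ 2 * D * T := by
  -- Subtracting an alternating sequence keeps all consecutive sums and makes `a` start at zero. The
  -- price is that increments of `a` are only bounded, so `c` is bounded by summing `T / k` terms of
  -- size `O(k)`.
  let a : ℕ → ℝ := fun j => α j - (-1) ^ j * α 0
  let r : ℕ → ℝ := fun j => k / 2 * (a (j + 1) - a j)
  have hD : 0 ≤ D := (abs_nonneg _).trans (hα 0 (Nat.zero_le n))
  have ha : ∀ j ≤ n, |a j| ≤ 2 * D := fun j hj => by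
    refine (abs_sub _ _).trans ?_
    rw [abs_mul, abs_neg_one_pow, one_mul]
    linarith [hα j hj, hα 0 (Nat.zero_le n)]
  refine ⟨a, alternating 0 r, by simp [a], rfl, fun j => by simp only [a, pow_succ]; ring,
    alternating_add 0 r, fun j hj => ?_⟩
  have h1 : ∀ l < j, |r l| ≤ k * (2 * D) := fun l hl => by
    simp only [r]
    rw [abs_mul, abs_of_pos (half_pos hk)]
    calc _ ≤ k / 2 * (2 * D + 2 * D) := by
          gcongr
          exact (abs_sub _ _).trans (add_le_add (ha _ (by omega)) (ha _ (by omega)))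
      _ = _ := by ring
  have h2 := abs_alternating_le 0 h1
  rw [abs_zero, zero_add, ← mul_assoc] at h2
  calc |alternating 0 r j| ≤ j * k * (2 * D) := h2
    _ ≤ T * (2 * D) := by
      have : (j : ℝ) * k ≤ T := le_trans (by gcongr) hn
      gcongr
    _ = _ := by ring

set_option maxHeartbeats 800000 in
-- The boundary increment in the position equation is moved into the momentum through the profiles.
-- The `X` part varies slowly and has a controlled gradient, so it fits the weak norm of the
-- momentum. `Y` has no useful gradient bound, so its momentum increments are compensated by a small
-- change of the position error.
theorem Regular.fd11_position_error_le {p : DampedWave} {T : ℝ} {u u₁ u₂ u₃ g₁ : ℝ → ℝ → ℝ}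
    {C : ℝ} (hr : p.Regular T u u₁ u₂ u₃ g₁ C) (hu : p.IsSolution T u)
    {N : ℕ} (hN : 2 ≤ N) {k : ℝ} (hk : 0 < k) (hk1 : k ≤ 1)
    {V : ℕ → Grid N} (hV : p.IsFD11 N k V) {n : ℕ} (hn : n * k ≤ T) {D L Λ : ℝ}
    (hD : D = C * (3 + 4 * T)) (hL : L = p.b - p.a) (hΛ : Λ = √(2 + 2 / L)) :
    gridNorm (p.h N) (p.positionError u k V n) ≤
      (1 + T) * (D * Λ + (12 + 4 * C) * D * T + 3 * √L * C
        + 2 * √L * L * C * (1 + C)) * √k + T * (√L * L * C) * p.h N := by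
  have hC := hr.nonneg
  have hT : 0 ≤ T := le_trans (by positivity) hn
  have hD0 : 0 ≤ D := by rw [hD]; positivity
  have hL0 : 0 < L := by rw [hL]; linarith [p.a_lt_b]
  have hlt : ∀ j < n, ((j : ℝ) + 1) * k ≤ T := fun j hj => by
    refine le_trans ?_ hn
    gcongr
    exact_mod_cast hj
  have hle : ∀ j ≤ n, (j : ℝ) * k ≤ T := fun j hj => le_trans (by gcongr) hn
  obtain ⟨η, x, f, he0, hη0, he, hη, hx, hf⟩ := hr.fd11_momentum_system hu hN hk hk1 hV hn
  set e := p.positionError u k V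
  obtain ⟨α, hα, hαD, hαk⟩ := hr.exists_boundary_velocity (x := p.a) ⟨le_rfl, p.a_lt_b.le⟩
    hu.left_boundary hk hk1
  obtain ⟨β, hβ, hβD, hβk⟩ := hr.exists_boundary_velocity (x := p.b) ⟨p.a_lt_b.le, le_rfl⟩
    hu.right_boundary hk hk1
  rw [← hD] at hαD hβD hαk hβk
  obtain ⟨a, c, ha0, hc0, ha, hc, hcD⟩ := exists_split_sequences hk hn fun j hj => hαD j (hle j hj)
  obtain ⟨b, d, hb0, hd0, hb, hd, hdD⟩ := exists_split_sequences hk hn fun j hj => hβD j (hle j hj)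
  have hh := p.h_pos hN
  have hm := p.h_mul hN
  rw [← hL] at hm
  -- The layer width `k³` balances the two costs: `k² / √ν` for the gradient of `X` and `√ν / k` for
  -- summing `O(√ν)` changes over `T / k` steps both equal `√k`.
  obtain ⟨X, Y, hXY, hY, hX⟩ := exists_left_profiles (N - 1) hh (pow_pos hk 3)
  obtain ⟨X', Y', hXY', hY', hX'⟩ := exists_right_profiles (N - 1) hh (pow_pos hk 3)
  rw [hm] at hX hX'
  set h := p.h N with hdef
  -- the sizes of the two kinds of profiles
  have hkk : √k * √k = k := Real.mul_self_sqrt hk.le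
  have hsk : 0 < √k := Real.sqrt_pos.2 hk
  have hkle : k ≤ √k := Real.le_sqrt_of_sq_le (by nlinarith)
  have hk3 : √(k ^ 3) = k * √k := by
    rw [show k ^ 3 = k ^ 2 * k by ring, Real.sqrt_mul (by positivity), Real.sqrt_sq hk.le]
  rw [hk3] at hY hY'
  have hΞ : k * √k * √(2 / k ^ 3 + 2 / L) ≤ Λ := by
    rw [hΛ, ← hk3, ← Real.sqrt_mul (by positivity)]
    refine Real.sqrt_le_sqrt ?_
    have e1 : k ^ 3 * (2 / k ^ 3 + 2 / L) = 2 + k ^ 3 * (2 / L) := by field_simp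
    rw [e1]
    have e2 : k ^ 3 ≤ 1 := pow_le_one₀ hk.le hk1
    have e3 : k ^ 3 * (2 / L) ≤ 2 / L := mul_le_of_le_one_left (by positivity) e2
    linarith
  set Ξ := √(2 / k ^ 3 + 2 / L) with hΞdef
  have hΞ0 : 0 ≤ Ξ := Real.sqrt_nonneg _
  have hΞ2 : k ^ 2 * Ξ ≤ Λ * √k := by
    calc k ^ 2 * Ξ = k * (√k * √k) * Ξ := by rw [hkk]; ring
      _ = k * √k * Ξ * √k := by ring
      _ ≤ _ := by gcongr
  -- the corrections
  let S : ℕ → Fin (N - 1) → ℝ := fun j i => k / 2 * (α j * X i + β j * X' i)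
  let S' : ℕ → Fin (N - 1) → ℝ := fun j i => k / 2 * (a j * Y i + b j * Y' i)
  -- By the choice of `c` and `d`, `z j + z (j + 1) = S' (j + 1) - S' j`. Adding `z` to the position
  -- error therefore reproduces the momentum increment caused by the `Y` profiles.
  let z : ℕ → Fin (N - 1) → ℝ := fun j i => c j * Y i + d j * Y' i
  let s : ℕ → Fin (N - 1 + 1) → ℝ := fun j l => k / 2 * grad h (S j) l
  let P : ℕ → Fin (N - 1) → ℝ := fun j i => e j i + z j i
  let y : ℕ → Fin (N - 1) → ℝ := fun j i =>
    η j i - k / 2 * (gradAdj h (grad h (S j)) i + gradAdj h (grad h (S' j)) i)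
  have hS : ∀ j i, gradAdj h (grad h (S j)) i
      = k / 2 * (α j * gradAdj h (grad h X) i + β j * gradAdj h (grad h X') i) := fun j i => by
    simp only [S]
    rw [gradAdj_grad_mul, gradAdj_grad_add, gradAdj_grad_mul, gradAdj_grad_mul]
  have hS' : ∀ j i, gradAdj h (grad h (S' j)) i
      = k / 2 * (a j * gradAdj h (grad h Y) i + b j * gradAdj h (grad h Y') i) := fun j i => by
    simp only [S']
    rw [gradAdj_grad_mul, gradAdj_grad_add, gradAdj_grad_mul, gradAdj_grad_mul]
  have hz : ∀ j i, gradAdj h (grad h (z j)) i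
      = c j * gradAdj h (grad h Y) i + d j * gradAdj h (grad h Y') i := fun j i => by
    simp only [z]
    rw [gradAdj_grad_add, gradAdj_grad_mul, gradAdj_grad_mul]
  have hs : ∀ j i, gradAdj h (s j) i = k / 2 * gradAdj h (grad h (S j)) i := fun j i => by
    simp only [s, gradAdj]; ring
  have hPz : ∀ j i, gradAdj h (grad h (P j)) i
      = gradAdj h (grad h (e j)) i + gradAdj h (grad h (z j)) i := fun j i =>
    gradAdj_grad_add h (e j) (z j) i
  have hload : ∀ j < n, ∀ i, 1 / h ^ 2
      * (p.boundaryVector N ((j + 1) * k) i - p.boundaryVector N (j * k) i)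
      = gradAdj h (grad h (S j)) i + gradAdj h (grad h (S' j)) i
        + (gradAdj h (grad h (S (j + 1))) i + gradAdj h (grad h (S' (j + 1))) i) := by
    intro j hj i
    have e1 := hα j (hlt j hj)
    have e2 := hβ j (hlt j hj)
    have e3 : gradAdj h (grad h (S j)) i + gradAdj h (grad h (S' j)) i
        + (gradAdj h (grad h (S (j + 1))) i + gradAdj h (grad h (S' (j + 1))) i)
        = k / 2 * (α j + α (j + 1)) * (gradAdj h (grad h X) i + gradAdj h (grad h Y) i)
        + k / 2 * (β j + β (j + 1)) * (gradAdj h (grad h X') i + gradAdj h (grad h Y') i) := by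
      rw [hS, hS, hS', hS']
      linear_combination k / 2 * gradAdj h (grad h Y) i * ha j
        + k / 2 * gradAdj h (grad h Y') i * hb j
    rw [e3, hXY, hXY', e1, e2, boundaryVector, boundaryVector]
    split_ifs <;> ring
  have hP : ∀ j < n, ∀ i, P (j + 1) i - P j i =
      k / 2 * (y j i + y (j + 1) i - p.γ (p.node N i) * (P j i + P (j + 1) i))
      + (z (j + 1) i - z j i + k / 2 * (p.γ (p.node N i) * (z j i + z (j + 1) i)) + x j i) := by
    intro j hj i
    have e1 := he j hj i
    rw [hload j hj i] at e1
    simp only [P, y]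
    linear_combination e1
  have hy : ∀ j < n, ∀ i, y (j + 1) i - y j i =
      -(k / 2) * (gradAdj h (grad h (P j)) i + gradAdj h (grad h (P (j + 1))) i) + f j i
        - (gradAdj h (s (j + 1)) i - gradAdj h (s j) i) := by
    intro j hj i
    have e1 := hη j hj i
    rw [hPz, hPz, hz, hz, hs, hs]
    simp only [y]
    rw [hS' j, hS' (j + 1)]
    linear_combination e1 + k / 2 * gradAdj h (grad h Y) i * hc j
      + k / 2 * gradAdj h (grad h Y') i * hd j
  -- Since `a` and `b` start at zero, the initial momentum contains only the `X` profiles, as the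
  -- dual stability estimate requires.
  have hy0 : ∀ i, y 0 i = -gradAdj h (s 0) i := by
    intro i
    rw [hs]
    simp only [y]
    rw [hS' 0, hη0, ha0, hb0]
    ring
  have hP0 : gridNorm h (P 0) = 0 := by
    have : P 0 = fun _ => 0 := by
      funext i; simp only [P, z, he0, hc0, hd0]; ring
    rw [this]
    simp [gridNorm]
  have hzb : ∀ j ≤ n, gridNorm h (z j) ≤ k * (4 * D * T * √k) := by
    intro j hj
    refine (gridNorm_combination_le hh.le (hcD j hj) (hdD j hj) hY hY').trans (le_of_eq ?_)
    ring
  have hgradS : ∀ {v w A : ℝ}, |v| ≤ A → |w| ≤ A →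
      gridNorm h (fun l => k / 2 * grad h (fun i => k / 2 * (v * X i + w * X' i)) l) ≤
        k ^ 2 / 2 * (A * Ξ) := by
    intro v w A hv hw
    have e1 : (fun l => k / 2 * grad h (fun i => k / 2 * (v * X i + w * X' i)) l)
        = fun l => k ^ 2 / 4 * (v * grad h X l + w * grad h X' l) := by
      funext l
      rw [grad_mul, grad_add, grad_mul, grad_mul]
      ring
    rw [e1, gridNorm_mul hh.le, abs_of_nonneg (by positivity)]
    have e2 := gridNorm_combination_le hh.le hv hw hX hX'
    calc _ ≤ k ^ 2 / 4 * (2 * (A * Ξ)) := by gcongr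
      _ = _ := by ring
  have hs0 : gridNorm h (s 0) ≤ D * Λ * √k := by
    have e1 := hgradS (hαD 0 (hle 0 (Nat.zero_le n))) (hβD 0 (hle 0 (Nat.zero_le n)))
    have e2 : D * (k ^ 2 * Ξ) ≤ D * (Λ * √k) := by gcongr
    have e3 : 0 ≤ D * (k ^ 2 * Ξ) := by positivity
    calc gridNorm h (s 0) ≤ k ^ 2 / 2 * (D * Ξ) := e1
      _ ≤ _ := by linarith
  have hds : ∀ j < n, gridNorm h (fun l => s (j + 1) l - s j l) ≤ k * (D * Λ * √k) := by
    intro j hj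
    have e1 := hgradS (hαk j (hlt j hj)) (hβk j (hlt j hj))
    have e0 : (fun l => s (j + 1) l - s j l) = fun l => k / 2 * grad h (fun i =>
        k / 2 * ((α (j + 1) - α j) * X i + (β (j + 1) - β j) * X' i)) l := by
      funext l
      simp only [s, S]
      rw [grad_mul, grad_add, grad_mul, grad_mul, grad_mul, grad_add, grad_mul, grad_mul,
        grad_mul, grad_add, grad_mul, grad_mul]
      ring
    rw [e0]
    have e2 : D * (k ^ 2 * Ξ) ≤ D * (Λ * √k) := by gcongr
    have e3 : 0 ≤ D * (k ^ 2 * Ξ) := by positivity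
    calc _ ≤ k ^ 2 / 2 * (D * k * Ξ) := e1
      _ = k * (D * (k ^ 2 * Ξ) / 2) := by ring
      _ ≤ k * (D * Λ * √k) := by gcongr; linarith
  have hrb : ∀ j < n, gridNorm h (fun i => z (j + 1) i - z j i
      + k / 2 * (p.γ (p.node N i) * (z j i + z (j + 1) i)) + x j i) ≤
      k * ((8 + 4 * C) * D * T * √k + 3 * √L * C * √k) := by
    intro j hj
    have z0 := hzb j hj.le
    have z1 := hzb (j + 1) hj
    have t1 := (gridNorm_sub_le hh.le (z (j + 1)) (z j)).trans (add_le_add z1 z0)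
    have t2 : gridNorm h (fun i => p.γ (p.node N i) * (z j i + z (j + 1) i)) ≤
        C * (k * (8 * D * T * √k)) := by
      have e1 : gridNorm h (fun i => p.γ (p.node N i) * (z j i + z (j + 1) i)) ≤
          gridNorm h (fun i => C * (z j i + z (j + 1) i)) := gridNorm_mono hh.le fun i => by
        rw [abs_mul, abs_mul, abs_of_nonneg (p.γ_nonneg _ (p.node_mem hN i)), abs_of_nonneg hC]
        gcongr
        exact hr.γ_le _ (p.node_mem hN i)
      refine e1.trans ?_
      rw [gridNorm_mul hh.le, abs_of_nonneg hC]
      gcongr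
      exact (gridNorm_add_le hh.le (z j) (z (j + 1))).trans (by linarith)
    have t3 : gridNorm h (fun i => k / 2 * (p.γ (p.node N i) * (z j i + z (j + 1) i))) ≤
        k * (4 * C * D * T * √k) := by
      rw [gridNorm_mul hh.le, abs_of_pos (half_pos hk)]
      calc _ ≤ k / 2 * (C * (k * (8 * D * T * √k))) := by gcongr
        _ = k * (k * (4 * C * D * T * √k)) := by ring
        _ ≤ k * (4 * C * D * T * √k) :=
          mul_le_mul_of_nonneg_left (mul_le_of_le_one_left (by positivity) hk1) hk.le
    have t4 : gridNorm h (x j) ≤ k * (3 * √L * C * √k) := by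
      have := p.gridNorm_le_of_forall_node hN (by positivity) (hx j hj)
      rw [← hL, ← hdef] at this
      refine this.trans ?_
      calc √L * (3 * C * k ^ 2) = k * (3 * √L * C * k) := by ring
        _ ≤ _ := by gcongr
    have t5 := gridNorm_add_le hh.le (fun i => z (j + 1) i - z j i
      + k / 2 * (p.γ (p.node N i) * (z j i + z (j + 1) i))) (x j)
    have t6 := gridNorm_add_le hh.le (fun i => z (j + 1) i - z j i)
      (fun i => k / 2 * (p.γ (p.node N i) * (z j i + z (j + 1) i)))
    refine (t5.trans (add_le_add (t6.trans (add_le_add t1 t3)) t4)).trans (le_of_eq ?_)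
    ring
  have hen : gridNorm h (e n) ≤ gridNorm h (P n) + gridNorm h (z n) := by
    have : e n = fun i => P n i - z n i := by funext i; simp only [P]; ring
    rw [this]
    exact gridNorm_sub_le hh.le _ _
  have hzn := hzb n le_rfl
  clear_value P y z s S S'
  have key := gridNorm_le_of_crankNicolson_dual hh hk.le hm.le (by positivity)
    (fun i => p.γ_nonneg _ (p.node_mem hN i)) hP hy hy0 hf
    (fun j hj => add_le_add (hrb j hj) (hds j hj))
  rw [hP0, zero_add] at key
  have hzn' : k * (4 * D * T * √k) ≤ 4 * D * T * √k :=
    mul_le_of_le_one_left (by positivity) hk1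
  have key2 : (n : ℝ) * (k * ((8 + 4 * C) * D * T * √k + 3 * √L * C * √k) + k * (D * Λ * √k)
      + √L * (L * (k * (C * h + 2 * C * (1 + C) * k)))) ≤
      T * ((8 + 4 * C) * D * T * √k + 3 * √L * C * √k + D * Λ * √k
        + √L * (L * (C * h + 2 * C * (1 + C) * √k))) := by
    have hΛ0 : 0 ≤ Λ := by rw [hΛ]; exact Real.sqrt_nonneg _
    calc _ = n * k * ((8 + 4 * C) * D * T * √k + 3 * √L * C * √k + D * Λ * √k
        + √L * (L * (C * h + 2 * C * (1 + C) * k))) := by ring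
      _ ≤ _ := by gcongr
  have q1 : 0 ≤ T * (4 * D * T * √k) := by positivity
  have q2 : 0 ≤ (8 + 4 * C) * D * T * √k := by positivity
  have q3 : 0 ≤ 3 * √L * C * √k := by positivity
  have q4 : 0 ≤ 2 * √L * L * C * (1 + C) * √k := by positivity
  calc gridNorm h (e n) ≤ D * Λ * √k + T * ((8 + 4 * C) * D * T * √k + 3 * √L * C * √k
        + D * Λ * √k + √L * (L * (C * h + 2 * C * (1 + C) * √k))) + 4 * D * T * √k := by
        linarith
    _ ≤ _ := by linarith

end DampedWave

end

/-! ### From the error bounds to the limits -/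

namespace DampedWave

theorem exists_pos_mul_sqrt_lt {A ε : ℝ} (hA : 0 ≤ A) (hε : 0 < ε) :
    ∃ δ : ℝ, 0 < δ ∧ δ ≤ 1 ∧ A * √δ < ε := by
  refine ⟨min 1 ((ε / (A + 1)) ^ 2), lt_min one_pos (by positivity), min_le_left _ _, ?_⟩
  have h1 : √(min 1 ((ε / (A + 1)) ^ 2)) ≤ ε / (A + 1) := by
    rw [← Real.sqrt_sq (by positivity : 0 ≤ ε / (A + 1))]
    exact Real.sqrt_le_sqrt ((min_le_right _ _).trans (by rw [Real.sqrt_sq (by positivity)]))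
  calc _ ≤ A * (ε / (A + 1)) := by gcongr
    _ < ε := by
      rw [← mul_div_assoc, div_lt_iff₀ (by positivity)]
      nlinarith

theorem le_sqrt_of_le_one {x δ : ℝ} (hx : x ≤ δ) (hδ0 : 0 ≤ δ) (hδ : δ ≤ 1) : x ≤ √δ :=
  hx.trans (Real.le_sqrt_of_sq_le (by nlinarith))

/-- A small discrete gradient forces a small maximum. -/
theorem abs_positionError_le (p : DampedWave) {N : ℕ} (hN : 2 ≤ N) (u : ℝ → ℝ → ℝ) (k : ℝ)
    (V : ℕ → Grid N) (n : ℕ) (i : Fin (N - 1)) :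
    |p.positionError u k V n i| ≤
      √(p.b - p.a) * gridNorm (p.h N) (grad (p.h N) (p.positionError u k V n)) :=
  abs_le_gridNorm_grad (p.h_pos hN) (p.h_mul hN).le _ i

theorem Regular.fd01_converges {p : DampedWave} {T : ℝ} {u u₁ u₂ u₃ g₁ : ℝ → ℝ → ℝ}
    {C : ℝ} (hr : p.Regular T u u₁ u₂ u₃ g₁ C) (hu : p.IsSolution T u) (hT : 0 < T) {γs : ℝ}
    (hγs : IsGreatest (p.γ '' Set.Icc p.a p.b) γs) {ε : ℝ} (hε : 0 < ε) :
    ∃ δ : ℝ, 0 < δ ∧ ∀ N : ℕ, 2 ≤ N → ∀ k : ℝ, 0 < k → p.h N < δ → k < δ →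
      k < 2 / γs → √k / p.h N < √γs / 2 → ∀ V : ℕ → Grid N, p.IsFD01 N k V →
        ∀ n : ℕ, n * k ≤ T → (∀ i, |p.positionError u k V n i| < ε) ∧
          p.discreteL2 (p.velocityError T u k V n) < ε := by
  have hC := hr.nonneg
  have hγ0 : 0 ≤ γs := by
    obtain ⟨x, hx, rfl⟩ := hγs.1
    exact p.γ_nonneg x hx
  set A := Real.exp (γs / 4 * (8 + 2 * C ^ 2) * T) * (C * (γs / 4) * (√(p.b - p.a) + 1)
    + T * (C * (√(p.b - p.a) * (1 + 4 * (γs / 4)) + 2 * (γs / 4)))) with hA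
  set A' := C * (γs / 4) * (√(p.b - p.a) + 1) with hA'
  have hA0 : 0 ≤ A := by positivity
  have hA0' : 0 ≤ A' := by positivity
  have hl := Real.sqrt_nonneg (p.b - p.a)
  obtain ⟨δ, hδ, hδ1, hδε⟩ := exists_pos_mul_sqrt_lt
    (by positivity : 0 ≤ √(p.b - p.a) * A + (A + A')) hε
  refine ⟨δ, hδ, fun N hN k hk hh _ _ hstab V hV n hn => ?_⟩
  have hhp := p.h_pos hN
  -- Squaring the stability condition gives the parabolic relation `k ≤ K h²` with `K = γs / 4`.
  have hkh : k ≤ γs / 4 * p.h N ^ 2 := by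
    rw [div_lt_iff₀ hhp] at hstab
    have h1 := Real.sq_sqrt hk.le
    have h2 := Real.sq_sqrt hγ0
    have h3 := pow_le_pow_left₀ (Real.sqrt_nonneg k) hstab.le 2
    calc k = √k ^ 2 := h1.symm
      _ ≤ (√γs / 2 * p.h N) ^ 2 := h3
      _ = √γs ^ 2 / 4 * p.h N ^ 2 := by ring
      _ = _ := by rw [h2]
  obtain ⟨e1, e2⟩ := hr.fd01_error_le hu (by positivity) hN hk (hh.le.trans hδ1) hkh hV hn
  have hs : √(p.h N) ≤ √δ := Real.sqrt_le_sqrt hh.le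
  have hs0 := Real.sqrt_nonneg δ
  rw [← hA] at e1 e2
  rw [← hA'] at e2
  have q1 : 0 ≤ A * √δ := by positivity
  have q2 : 0 ≤ A' * √δ := by positivity
  have q3 : 0 ≤ √(p.b - p.a) * (A * √δ) := by positivity
  constructor
  · intro i
    have e3 := p.abs_positionError_le hN u k V n i
    have e4 : A * √(p.h N) ≤ A * √δ := by gcongr
    have e5 := mul_le_mul_of_nonneg_left (e1.trans e4) hl
    linarith
  · have e4 : (A + A') * √(p.h N) ≤ (A + A') * √δ := by gcongr
    have e5 : p.discreteL2 (p.velocityError T u k V n) ≤ _ := e2.trans e4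
    linarith

theorem Regular.fd11_converges_L2 {p : DampedWave} {T : ℝ} {u u₁ u₂ u₃ g₁ : ℝ → ℝ → ℝ}
    {C : ℝ} (hr : p.Regular T u u₁ u₂ u₃ g₁ C) (hu : p.IsSolution T u) (hT : 0 < T)
    {ε : ℝ} (hε : 0 < ε) :
    ∃ δ : ℝ, 0 < δ ∧ ∀ N : ℕ, 2 ≤ N → ∀ k : ℝ, 0 < k → p.h N < δ → k < δ →
      ∀ V : ℕ → Grid N, p.IsFD11 N k V → ∀ n : ℕ, n * k ≤ T →
        p.discreteL2 (p.positionError u k V n) < ε := by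
  have hC := hr.nonneg
  obtain ⟨D, hD⟩ : ∃ D, D = C * (3 + 4 * T) := ⟨_, rfl⟩
  obtain ⟨L, hL⟩ : ∃ L, L = p.b - p.a := ⟨_, rfl⟩
  obtain ⟨Λ, hΛ⟩ : ∃ Λ, Λ = √(2 + 2 / L) := ⟨_, rfl⟩
  have hD0 : 0 ≤ D := by rw [hD]; positivity
  have hL0 : 0 < L := by rw [hL]; linarith [p.a_lt_b]
  have hΛ0 : 0 ≤ Λ := by rw [hΛ]; exact Real.sqrt_nonneg _
  set A := (1 + T) * (D * Λ + (12 + 4 * C) * D * T + 3 * √L * C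
    + 2 * √L * L * C * (1 + C)) with hA
  set A' := T * (√L * L * C) with hA'
  have hA0 : 0 ≤ A := by positivity
  have hA0' : 0 ≤ A' := by positivity
  obtain ⟨δ, hδ, hδ1, hδε⟩ := exists_pos_mul_sqrt_lt (by positivity : 0 ≤ A + A') hε
  refine ⟨δ, hδ, fun N hN k hk hh hkδ V hV n hn => ?_⟩
  have e1 : p.discreteL2 (p.positionError u k V n) ≤ A * √k + A' * p.h N :=
    hr.fd11_position_error_le hu hN hk (hkδ.le.trans hδ1) hV hn hD hL hΛ
  have e2 : √k ≤ √δ := Real.sqrt_le_sqrt hkδ.le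
  have e3 : p.h N ≤ √δ := le_sqrt_of_le_one hh.le hδ.le hδ1
  calc _ ≤ _ := e1
    _ ≤ A * √δ + A' * √δ := by gcongr
    _ = (A + A') * √δ := by ring
    _ < ε := hδε

theorem Regular.fd11_converges {p : DampedWave} {T : ℝ} {u u₁ u₂ u₃ g₁ : ℝ → ℝ → ℝ}
    {C : ℝ} (hr : p.Regular T u u₁ u₂ u₃ g₁ C) (hu : p.IsSolution T u) (hT : 0 < T)
    {ε : ℝ} (hε : 0 < ε) :
    ∃ δ : ℝ, 0 < δ ∧ ∀ N : ℕ, 2 ≤ N → ∀ k : ℝ, 0 < k → p.h N < δ → k < δ →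
      ((∀ t ∈ Set.Icc 0 T, p.ua t = p.ua 0 ∧ p.ub t = p.ub 0) ∨ k ^ 4 / p.h N ^ 3 < δ) →
      ∀ V : ℕ → Grid N, p.IsFD11 N k V → ∀ n : ℕ, n * k ≤ T →
        (∀ i, |p.positionError u k V n i| < ε) ∧
          p.discreteL2 (p.velocityError T u k V n) < ε := by
  have hC := hr.nonneg
  obtain ⟨D, hD⟩ : ∃ D, D = C * (3 + 4 * T) := ⟨_, rfl⟩
  have hD0 : 0 ≤ D := by rw [hD]; positivity
  set l := √(p.b - p.a) with hl
  have hl0 : 0 ≤ l := Real.sqrt_nonneg _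
  obtain ⟨W, hW⟩ : ∃ W, W = C * (C + 6) * (1 + 3 * T) := ⟨_, rfl⟩
  have hW0 : 0 ≤ W := by rw [hW]; positivity
  obtain ⟨δ, hδ, hδ1, hδε⟩ := exists_pos_mul_sqrt_lt
    (by positivity : 0 ≤ (l + 1) * ((2 + T) * (l * (W * 2) + D))) hε
  refine ⟨δ, hδ, fun N hN k hk hh hkδ hcase V hV n hn => ?_⟩
  have hhp := p.h_pos hN
  have hk1 := hkδ.le.trans hδ1
  have hs0 := Real.sqrt_nonneg δ
  have hlt : ∀ j < n, ((j : ℝ) + 1) * k ≤ T := fun j hj => by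
    refine le_trans ?_ hn
    gcongr
    exact_mod_cast hj
  have hle : ∀ j ≤ n, (j : ℝ) * k ≤ T := fun j hj => le_trans (by gcongr) hn
  have key : gridNorm (p.h N) (grad (p.h N) (p.positionError u k V n)) ≤
        (1 + T) * (l * (W * (p.h N + k)) + D * √δ) ∧
      gridNorm (p.h N) (p.velocityError T u k V n) ≤
        (2 + T) * (l * (W * (p.h N + k)) + D * √δ) := by
    rw [hW, hl]
    rcases hcase with hconst | hsmall
    · have hb : ∀ j < n, p.ua ((j + 1) * k) = p.ua (j * k) ∧ p.ub ((j + 1) * k) = p.ub (j * k) := by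
        intro j hj
        have h1 := hconst _ ⟨by positivity, hlt j hj⟩
        have h2 := hconst _ ⟨by positivity, hle j hj.le⟩
        exact ⟨h1.1.trans h2.1.symm, h1.2.trans h2.2.symm⟩
      -- Constant boundary values have zero increments, so there is no boundary kick and the
      -- estimate holds for every `μ ≥ 0`; `D * √δ` is kept so that both cases share one bound.
      refine hr.fd11_energy_error_le hu hN hk hk1 hV hn (α := fun _ => 0) (β := fun _ => 0)
        (D := 0) le_rfl (fun j hj => ?_) (fun j hj => ?_) (by simp) (by simp) (by simp) (by simp)
        (by rw [zero_mul]; positivity)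
      · rw [(hb j hj).1]; ring
      · rw [(hb j hj).2]; ring
    · obtain ⟨α, hα, hαD, hαk⟩ := hr.exists_boundary_velocity (x := p.a) ⟨le_rfl, p.a_lt_b.le⟩
        hu.left_boundary hk hk1
      obtain ⟨β, hβ, hβD, hβk⟩ := hr.exists_boundary_velocity (x := p.b) ⟨p.a_lt_b.le, le_rfl⟩
        hu.right_boundary hk hk1
      rw [← hD] at hαD hβD hαk hβk
      refine hr.fd11_energy_error_le hu hN hk hk1 hV hn hD0 (fun j hj => hα j (hlt j hj))
        (fun j hj => hβ j (hlt j hj)) (fun j hj => hαD j (hle j hj))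
        (fun j hj => hβD j (hle j hj)) (fun j hj => hαk j (hlt j hj))
        (fun j hj => hβk j (hlt j hj)) ?_
      rw [div_lt_iff₀ (by positivity)] at hsmall
      -- The square root of `k⁴ ≤ δ h³`, which is the form that the bound on the boundary kick
      -- requires with `μ = D√δ`.
      have h1 : k ^ 2 ≤ √δ * (p.h N * √(p.h N)) := by
        refine le_of_sq_le_sq ?_ (by positivity)
        calc (k ^ 2) ^ 2 = k ^ 4 := by ring
          _ ≤ δ * p.h N ^ 3 := hsmall.le
          _ = √δ ^ 2 * (p.h N ^ 2 * √(p.h N) ^ 2) := by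
            rw [Real.sq_sqrt hδ.le, Real.sq_sqrt hhp.le]; ring
          _ = _ := by ring
      calc D * k ^ 2 ≤ D * (√δ * (p.h N * √(p.h N))) := by gcongr
        _ = _ := by ring
  have e1 : l * (W * (p.h N + k)) + D * √δ ≤ (l * (W * 2) + D) * √δ := by
    have h1 := le_sqrt_of_le_one hh.le hδ.le hδ1
    have h2 := le_sqrt_of_le_one hkδ.le hδ.le hδ1
    calc _ ≤ l * (W * (√δ + √δ)) + D * √δ := by gcongr
      _ = _ := by ring
  set E := (l * (W * 2) + D) * √δ with hE
  have hE0 : 0 ≤ E := by positivity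
  have e2 : (l + 1) * ((2 + T) * E) < ε := by
    calc _ = (l + 1) * ((2 + T) * (l * (W * 2) + D)) * √δ := by rw [hE]; ring
      _ < ε := hδε
  have q1 : 0 ≤ (2 + T) * E := by positivity
  have q2 : 0 ≤ l * ((2 + T) * E) := by positivity
  constructor
  · intro i
    have e3 := p.abs_positionError_le hN u k V n i
    have e4 : (1 + T) * (l * (W * (p.h N + k)) + D * √δ) ≤ (2 + T) * E :=
      mul_le_mul (by linarith) e1 (by positivity) (by positivity)
    have e5 := mul_le_mul_of_nonneg_left (key.1.trans e4) hl0
    linarith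
  · have e4 : (2 + T) * (l * (W * (p.h N + k)) + D * √δ) ≤ (2 + T) * E := by gcongr
    have e5 : p.discreteL2 (p.velocityError T u k V n) ≤ _ := key.2.trans e4
    linarith

end DampedWave

theorem mainTheorem3 (p : DampedWave) (γs : ℝ) (hγs : IsGreatest (p.γ '' Set.Icc p.a p.b) γs)
    (T : ℝ) (hT : 0 < T) (u : ℝ → ℝ → ℝ) (hu : p.IsSolution T u) :
    -- both schemes determine their approximations uniquely
    (∀ N : ℕ, 2 ≤ N → ∀ k : ℝ, 0 < k →
      (∃! V : ℕ → DampedWave.Grid N, p.IsFD01 N k V) ∧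
      (∃! V : ℕ → DampedWave.Grid N, p.IsFD11 N k V)) ∧
    -- FD-(0,1) converges under its stability conditions
    (∀ ε : ℝ, 0 < ε → ∃ δ : ℝ, 0 < δ ∧
      ∀ N : ℕ, 2 ≤ N → ∀ k : ℝ, 0 < k → p.h N < δ → k < δ →
        k < 2 / γs → √k / p.h N < √γs / 2 →
        ∀ V : ℕ → DampedWave.Grid N, p.IsFD01 N k V →
          ∀ n : ℕ, n * k ≤ T →
            (∀ i, |p.positionError u k V n i| < ε) ∧
            p.discreteL2 (p.velocityError T u k V n) < ε) ∧
    -- FD-(1,1) converges to `u` unconditionally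
    (∀ ε : ℝ, 0 < ε → ∃ δ : ℝ, 0 < δ ∧
      ∀ N : ℕ, 2 ≤ N → ∀ k : ℝ, 0 < k → p.h N < δ → k < δ →
        ∀ V : ℕ → DampedWave.Grid N, p.IsFD11 N k V →
          ∀ n : ℕ, n * k ≤ T →
            p.discreteL2 (p.positionError u k V n) < ε) ∧
    -- FD-(1,1) converges uniformly in `u` and in discrete `L²` in `u_t`: unconditionally if the
    -- boundary values do not depend on time, and otherwise as soon as `k⁴ / h³ → 0`
    (∀ ε : ℝ, 0 < ε → ∃ δ : ℝ, 0 < δ ∧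
      ∀ N : ℕ, 2 ≤ N → ∀ k : ℝ, 0 < k → p.h N < δ → k < δ →
        ((∀ t ∈ Set.Icc 0 T, p.ua t = p.ua 0 ∧ p.ub t = p.ub 0) ∨ k ^ 4 / p.h N ^ 3 < δ) →
        ∀ V : ℕ → DampedWave.Grid N, p.IsFD11 N k V →
          ∀ n : ℕ, n * k ≤ T →
            (∀ i, |p.positionError u k V n i| < ε) ∧
            p.discreteL2 (p.velocityError T u k V n) < ε) := by
  obtain ⟨u₁, u₂, u₃, g₁, C, hr⟩ := hu.exists_regular hγs hT
  exact ⟨fun N hN k hk => ⟨p.existsUnique_isFD01 N k, p.existsUnique_isFD11 hN hk⟩,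
    fun ε hε => hr.fd01_converges hu hT hγs hε, fun ε hε => hr.fd11_converges_L2 hu hT hε,
    fun ε hε => hr.fd11_converges hu hT hε⟩
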